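/- **Setting.** For each $m\in\mathbb N$ let $G=G_m$ be a fixed simple graph on $N_v=N_v(m)$ vertices with degrees $d_i$, and let $p,\alpha,\beta\in[0,1]$ depend on $m$ (suppressed in the notation; all limits and order symbols are for $m\to\infty$). The treated set is drawn by Bernoulli assignment: $Z_1,\dots,Z_{N_v}$ are Bernoulli$(p)$. The observed graph $\tilde G$ has an edge $\{i,j\}$ with probability $\alpha$ if $\{i,j\}$ is not an edge of $G$, and with probability $1-\beta$ if it is. All treatment indicators and all edge indicators of $\tilde G$ are mutually independent. In a graph $H$ the exposure of $i$ is $c_{11}$ or $c_{10}$ if $i$ is treated and has, respectively has not, a treated neighbour in $H$, and $c_{01}$ or $c_{00}$ if $i$ is untreated and has, respectively has not, a treated neighbour in $H$. Vertex $i$ has potential outcomes $y_i(c_k)$; its observed outcome $Y_i$ is $y_i$ at its exposure in $G$; $\overline y(c_k)=\frac1{N_v}\sum_i y_i(c_k)$. **Estimator.** Let $\hat\alpha,\hat\beta$ be random variables on the same probability space (arbitrarily dependent on the data), $\tilde d_i$ the degree of $i$ in $\tilde G$, and $$\hat d_i=\frac{\tilde d_i-(N_v-1)\hat\alpha}{1-\hat\alpha-\hat\beta}.$$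 With $u=(1-p)^d$, $v=(1-\alpha p)^{N_v-1-d}(1-(1-\beta)p)^d$, $w=(1-p)^d(1-\alpha p)^{N_v-1-d}$, the expected confusion matrix (rows: exposure in $\tilde G$, columns: exposure in $G$, order $c_{11},c_{10},c_{01},c_{00}$) of a vertex of degree $d$ is $$P(d,\alpha,\beta)=\begin{pmatrix}pB&0\\0&(1-p)B\end{pmatrix},\qquad B=\begin{pmatrix}1-u-v+w&u-w\\ v-w&w\end{pmatrix}.$$ Let $\tilde{\boldsymbol y}_i$ be the 4-vector with entry $Y_i$ at the exposure of $i$ in $\tilde G$ and $0$ elsewhere. Put $\tilde{\boldsymbol y}_{\mathrm{MME},i}=P(\hat d_i,\hat\alpha,\hat\beta)^{-1}\tilde{\boldsymbol y}_i$, and let $\tilde y_{A\&S,i}(c_k)$ (the Aronow–Samii estimator) be $Y_i/\tilde p_i^e(c_k)$ if $i$ has exposure $c_k$ in $\tilde G$ and $\tilde p^e_i(c_k)>0$, and $0$ otherwise, where $\tilde p_i^e(c_k)$ is the probability, over an independent Bernoulli$(p)$ assignment with $\tilde G$ fixed, that $i$ has exposure $c_k$ in $\tilde G$. Finally $$\tilde{\overline{\boldsymbol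 y}}_{\mathrm{MME}}=\frac1{N_v}\sum_{i}\Big\{\tilde{\boldsymbol y}_{\mathrm{MME},i}\,I_{\{C_1\le\hat d_i<C_2\}}+\tilde{\boldsymbol y}_{A\&S,i}\,I_{\{\hat d_i<C_1\text{ or }\hat d_i\ge C_2\}}\Big\}.$$ Here $[C_1,C_2)$ is any window of degrees of order $1/p$ around the mean degree $\bar d$: for some constants $a,b,\varepsilon>0$ and all large $m$, $a/p\le C_1\le(1-\varepsilon)\bar d$ and $(1+\varepsilon)\bar d\le C_2\le b/p$. **Theorem.** Assume: - (homogeneous network) there are zero-truncated Poisson laws with mean $\bar d=\bar d(m)$ such that the supremum over $k$ of the difference between the fraction of vertices of $G$ with degree at most $k$ and the distribution function of that law at $k$ tends to $0$; - $N_v\to\infty$; $p=o(1)$, $p=\omega(1/N_v)$, $\bar d=\Theta(1/p)$; - the number of ordered pairs of distinct vertices without a common neighbour in $G$ is $\sim N_v^2$; - $|y_i(c_k)|\le c$ for a constant $c$, for all $m,i,k$; - $1-\beta=\Omega(1)$, $\alpha=\Theta(1/(pN_v))$, $\alpha=o(p)$; - $\hat\alpha,\hat\beta$ are consistent: $\hat\alpha/\alpha\to1$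 and $\hat\beta-\beta\to0$ in probability. Then for every exposure level $c_k$: 1. (consistency) $\tilde{\overline y}_{\mathrm{MME}}(c_k)-\overline y(c_k)\to0$ in probability; 2. (asymptotic unbiasedness) if moreover the estimates respect the ranges of the error rates, that is, for some constants $K$ and $\eta>0$ and all large $m$, almost surely $0\le\hat\alpha\le K\alpha$ and $0\le\hat\beta\le1-\eta$ (as is the case for $\hat\alpha=\alpha$, $\hat\beta=\beta$), then $\tilde{\overline y}_{\mathrm{MME}}(c_k)$ is integrable for all large $m$ and $\mathbb E[\tilde{\overline y}_{\mathrm{MME}}(c_k)]-\overline y(c_k)\to0$. -/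

import Mathlib

open MeasureTheory ProbabilityTheory Filter Asymptotics
open scoped Topology NNReal

namespace NoisyInterference

/-! Four-level exposure model -/

/-- The four exposure levels: direct and indirect, isolated direct, indirect, none. -/
inductive Exposure
  | c11
  | c10
  | c01
  | c00
  deriving DecidableEq

instance : Fintype Exposure where
  elems := {Exposure.c11, Exposure.c10, Exposure.c01, Exposure.c00}
  complete := by intro c; cases c <;> simp

open scoped Classical in
/-- The exposure mapping. `T` is the set of treated vertices; the level of vertex `i` records
whether `i` is treated and whether `i` has a treated neighbour in the graph `H`. -/
noncomputable def exposure {n : ℕ} (T : Finset (Fin n)) (H : SimpleGraph (Fin n))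
    (i : Fin n) : Exposure :=
  if i ∈ T then
    (if ∃ j ∈ T, H.Adj j i then Exposure.c11 else Exposure.c10)
  else
    (if ∃ j ∈ T, H.Adj j i then Exposure.c01 else Exposure.c00)

/-- Probability that the treated set is exactly `T` under Bernoulli(`p`) assignment. -/
noncomputable def assignmentProb {n : ℕ} (p : ℝ) (T : Finset (Fin n)) : ℝ :=
  p ^ T.card * (1 - p) ^ Tᶜ.card

/-- Exposure probability of level `c` at vertex `i` computed in the graph `H`. -/
noncomputable def exposureProb {n : ℕ} (p : ℝ) (H : SimpleGraph (Fin n)) (i : Fin n)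
    (c : Exposure) : ℝ :=
  ∑ T : Finset (Fin n), assignmentProb p T * (if exposure T H i = c then 1 else 0)

open scoped Classical in
/-- Degree of `i` in `H`. -/
noncomputable def deg {n : ℕ} (H : SimpleGraph (Fin n)) (i : Fin n) : ℕ :=
  (Finset.univ.filter fun j => H.Adj i j).card

/-! Probabilistic model -/

/-- On one probability space: a treated set `Z` drawn by Bernoulli(`p`) assignment, and an observed
graph `H` obtained from the true graph `G` by turning each non-edge into an edge with probability
`α` and each edge into a non-edge with probability `β`, all treatment indicators and all
edge indicators (one for each pair `i < j`) being mutually independent. -/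
structure IsNoisyExperiment {n : ℕ} {Ω : Type*} [MeasurableSpace Ω] (μ : Measure Ω)
    (G : SimpleGraph (Fin n)) (p α β : ℝ) (Z : Ω → Finset (Fin n))
    (H : Ω → SimpleGraph (Fin n)) : Prop where
  p_mem : p ∈ Set.Icc (0 : ℝ) 1
  alpha_mem : α ∈ Set.Icc (0 : ℝ) 1
  beta_mem : β ∈ Set.Icc (0 : ℝ) 1
  measurable_treated : ∀ i, MeasurableSet {ω | i ∈ Z ω}
  measurable_edge : ∀ i j, MeasurableSet {ω | (H ω).Adj i j}
  treated_prob : ∀ i, μ.real {ω | i ∈ Z ω} = p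
  false_edge_prob : ∀ i j, i < j → ¬ G.Adj i j → μ.real {ω | (H ω).Adj i j} = α
  missed_edge_prob : ∀ i j, i < j → G.Adj i j → μ.real {ω | ¬ (H ω).Adj i j} = β
  indep : iIndepSet
    (Sum.elim (fun i : Fin n => {ω | i ∈ Z ω})
      (fun e : {e : Fin n × Fin n // e.1 < e.2} => {ω | (H ω).Adj e.1.1 e.1.2})) μ

/-- The Poisson distribution with rate `r`, conditioned on being nonzero. -/
noncomputable def zeroTruncatedPoisson (r : ℝ≥0) : Measure ℕ :=
  ProbabilityTheory.cond (poissonMeasure r) {0}ᶜ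

/-- Fraction of the vertices of `G` with degree at most `k`. -/
noncomputable def degreeCDF {n : ℕ} (G : SimpleGraph (Fin n)) (k : ℕ) : ℝ :=
  ((Finset.univ.filter fun i => deg G i ≤ k).card : ℝ) / n

/-- Homogeneous network setting: the degree distribution of the `m`-th graph is, asymptotically
and uniformly in the distribution functions, zero-truncated Poisson with mean `dbar m`. -/
def IsHomogeneous (N : ℕ → ℕ) (G : ∀ m, SimpleGraph (Fin (N m))) (dbar : ℕ → ℝ) : Prop :=
  ∃ rate : ℕ → ℝ≥0,
    (∀ m, 0 < rate m ∧ dbar m = ∫ k, (k : ℝ) ∂(zeroTruncatedPoisson (rate m))) ∧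
    ∀ ε > 0, ∀ᶠ m in atTop, ∀ k : ℕ,
      |degreeCDF (G m) k - (zeroTruncatedPoisson (rate m)).real (Set.Iic k)| ≤ ε

open scoped Classical in
/-- Number of ordered pairs of distinct vertices without a common neighbour. -/
noncomputable def pairsWithoutCommonNeighbor {n : ℕ} (G : SimpleGraph (Fin n)) : ℕ :=
  ((Finset.univ : Finset (Fin n × Fin n)).filter fun e =>
    e.1 ≠ e.2 ∧ ¬ ∃ v, G.Adj e.1 v ∧ G.Adj e.2 v).card

/-! Method-of-moments estimator -/

/-- The expected confusion matrix `P(d, α, β)` of a vertex of degree `d` among `n` vertices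
(rows: observed exposure, columns: true exposure), as a function of a real degree `d`.
Here `u`, `v` and `w` are the probabilities of having no treated neighbour in the true
graph, in the observed graph, and in both. -/
noncomputable def confusion (n : ℕ) (p d α β : ℝ) : Matrix Exposure Exposure ℝ :=
  let u := (1 - p) ^ d
  let v := (1 - α * p) ^ ((n : ℝ) - 1 - d) * (1 - (1 - β) * p) ^ d
  let w := (1 - p) ^ d * (1 - α * p) ^ ((n : ℝ) - 1 - d)
  Matrix.of fun obs tru =>
    match obs, tru with
    | .c11, .c11 => p * (1 - u - v + w)
    | .c11, .c10 => p * (u - w)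
    | .c10, .c11 => p * (v - w)
    | .c10, .c10 => p * w
    | .c01, .c01 => (1 - p) * (1 - u - v + w)
    | .c01, .c00 => (1 - p) * (u - w)
    | .c00, .c01 => (1 - p) * (v - w)
    | .c00, .c00 => (1 - p) * w
    | _, _ => 0

/-- The observed outcome of vertex `i`: its potential outcome at its true exposure level. -/
noncomputable def observedOutcome {n : ℕ} (G : SimpleGraph (Fin n)) (y : Fin n → Exposure → ℝ)
    (T : Finset (Fin n)) (i : Fin n) : ℝ :=
  y i (exposure T G i)

/-- The observed outcome of `i`, placed at the coordinate of the observed exposure level. -/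
noncomputable def observedVector {n : ℕ} (G H : SimpleGraph (Fin n))
    (y : Fin n → Exposure → ℝ) (T : Finset (Fin n)) (i : Fin n) : Exposure → ℝ :=
  fun c => (if exposure T H i = c then 1 else 0) * observedOutcome G y T i

/-- The degree estimator `(d̃ - (n - 1) a) / (1 - a - b)` for estimated error rates `a`, `b`. -/
noncomputable def degreeEst {n : ℕ} (H : SimpleGraph (Fin n)) (a b : ℝ) (i : Fin n) : ℝ :=
  ((deg H i : ℝ) - ((n : ℝ) - 1) * a) / (1 - a - b)

/-- Nodewise method-of-moments estimator. -/
noncomputable def nodeMME {n : ℕ} (G H : SimpleGraph (Fin n)) (y : Fin n → Exposure → ℝ)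
    (T : Finset (Fin n)) (p a b : ℝ) (i : Fin n) : Exposure → ℝ :=
  (confusion n p (degreeEst H a b i) a b)⁻¹.mulVec (observedVector G H y T i)

/-- Nodewise Aronow–Samii estimator in the noisy network. -/
noncomputable def nodeAS {n : ℕ} (G H : SimpleGraph (Fin n)) (y : Fin n → Exposure → ℝ)
    (T : Finset (Fin n)) (p : ℝ) (i : Fin n) : Exposure → ℝ :=
  fun c => (if 0 < exposureProb p H i c then 1 else 0) *
    ((if exposure T H i = c then 1 else 0) * (1 / exposureProb p H i c) *
      observedOutcome G y T i)

/-- The method-of-moments estimator of the average potential outcomes: the nodewise estimator is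
`nodeMME` if the estimated degree lies in `[C₁, C₂)`, and `nodeAS` otherwise. -/
noncomputable def mme {n : ℕ} (G H : SimpleGraph (Fin n)) (y : Fin n → Exposure → ℝ)
    (T : Finset (Fin n)) (p a b C₁ C₂ : ℝ) (c : Exposure) : ℝ :=
  (1 / (n : ℝ)) * ∑ i, if C₁ ≤ degreeEst H a b i ∧ degreeEst H a b i < C₂
    then nodeMME G H y T p a b i c else nodeAS G H y T p i c

/-- The average potential outcome at level `c`. -/
noncomputable def ybar {n : ℕ} (y : Fin n → Exposure → ℝ) (c : Exposure) : ℝ :=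
  (1 / (n : ℝ)) * ∑ i, y i c

/-- `[C₁ m, C₂ m)` is a window of degrees of order `1 / p` that contains a neighbourhood, of
fixed relative size, of the mean degree. -/
def IsDegreeWindow (p dbar C₁ C₂ : ℕ → ℝ) : Prop :=
  ∃ a > 0, ∃ b > 0, ∃ ε > 0, ∀ᶠ m in atTop,
    a / p m ≤ C₁ m ∧ C₁ m ≤ (1 - ε) * dbar m ∧ (1 + ε) * dbar m ≤ C₂ m ∧ C₂ m ≤ b / p m

/-- `X m - θ m` tends to `0` in probability; the `m`-th variable lives on its own space. -/
def ErrorTendstoZeroInProb {Ω : ℕ → Type*} [∀ m, MeasurableSpace (Ω m)] (μ : ∀ m, Measure (Ω m))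
    (X : ∀ m, Ω m → ℝ) (θ : ℕ → ℝ) : Prop :=
  ∀ ε > 0, Tendsto (fun m => μ m {ω | ε ≤ |X m ω - θ m|}) atTop (𝓝 0)

end NoisyInterference

/-!
The matrix `P(d, α, β)` is the exact expected confusion matrix of a vertex of degree `d`: given the
treatment status, the expectations of the indicators of "no treated neighbour in `G`", "no treated
neighbour in the observed graph" and of both are the quantities `u`, `v`, `w`
(`integral_isoInd_eq`). Hence the estimator of a vertex that uses its true degree and the true error
rates (`oracleMME`) is unbiased, and its error is a combination, with bounded coefficients, of
centred isolation indicators divided by the probability of the treatment status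
(`nodeMME_sub_eq`).

*Averaging.* The isolation indicators of two vertices that are distinct, not adjacent and without
common neighbour in `G` depend on each other only through false edges, so that their covariance is
at most the squared treatment probability times `O(α)` (`abs_cov_isoInd_le`). Almost all pairs are
of this kind, and the weighted averages of centred indicators vanish in mean square
(`integral_sq_sum_isoInd_le`, `integral_abs_oracleError_le`).

*From the oracle to the estimator.* The mean degree tends to infinity, so by Chebyshev's inequality
for the zero-truncated Poisson law all but a vanishing fraction of the vertices have a degree close
to it (`tendsto_card_far`), and by Chebyshev's inequality for the observed degree most of
these also have an observed degree close to its expectation (`sum_atypical_le`). At such typical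
vertices the estimated degree lies in the window and is close to the true degree on the scale `1 / p`
(`abs_degreeEst_sub_le`). On the range `RatesInRange` of degrees and error rates the determinant
`w - u * v` is bounded away from `0`, and the inverse block is bounded and Lipschitz
(`abs_invCoef_sub_le`), so the estimator differs little from the oracle
(`abs_nodeEst_sub_oracleMME_le`). The remaining vertices are identified by the observed graph alone.
Since the assignment is independent of that graph, the inverse probability weights, large as they
may be, contribute a bounded amount in mean for each such vertex
(`sum_assignmentProb_abs_nodeAS_le`, `integral_atypicalSum_le`). This proves consistency.

*Unbiasedness.* When the estimated error rates respect their ranges, the inverse block is bounded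
wherever it is used, and the estimator is dominated by a constant multiple of the treated (or
untreated) fraction divided by its expectation, plus the contribution of the atypical vertices
(`abs_mme_le`). The first is uniformly integrable by its variance (`avg_armInd_le`), the second
vanishes in mean, so convergence in probability implies convergence in mean
(`integral_abs_le_of_dominated`, `integral_abs_mme_sub_le`).
-/


namespace NoisyInterference

/-! ### The joint law of the treated set and the observed graph -/

section Law

variable {n : ℕ} {Ω : Type*} [MeasurableSpace Ω] {μ : Measure Ω} {G : SimpleGraph (Fin n)}
  {p α β : ℝ} {Z : Ω → Finset (Fin n)} {H : Ω → SimpleGraph (Fin n)}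

/-- The probability of a finite intersection of independent events or their complements; `b` selects
the events that are not complemented. -/
theorem measureReal_iInter_signs {ι : Type*} [DecidableEq ι] {f : ι → Set Ω}
    [IsProbabilityMeasure μ]
    (hf : ∀ x, MeasurableSet (f x)) (hi : iIndepSet f μ) (S : Finset ι) (b : ι → Prop)
    [DecidablePred b] :
    μ.real (⋂ x ∈ S, if b x then f x else (f x)ᶜ)
      = ∏ x ∈ S, if b x then μ.real (f x) else 1 - μ.real (f x) := by
  have h := (iIndepSet_iff_iIndep f μ).1 hi
  have := h.meas_biInter (S := S) (s := fun x => if b x then f x else (f x)ᶜ) (by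
    intro x _
    have h1 : MeasurableSet[MeasurableSpace.generateFrom {f x}] (f x) :=
      MeasurableSpace.measurableSet_generateFrom (Set.mem_singleton _)
    by_cases hb : b x
    · simpa [hb] using h1
    · simpa [hb] using h1)
  rw [measureReal_def, this, ENNReal.toReal_prod]
  refine Finset.prod_congr rfl fun x _ => ?_
  by_cases hb : b x
  · simp [hb, measureReal_def]
  · simp only [hb, if_false]
    rw [← probReal_compl_eq_one_sub (hf x), measureReal_def]

open scoped Classical in
/-- The probability that `{i, j}` is an edge of the observed graph, for `i ≠ j`. -/
noncomputable def edgeProb (G : SimpleGraph (Fin n)) (α β : ℝ) (i j : Fin n) : ℝ :=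
  if G.Adj i j then 1 - β else α

theorem edgeProb_comm (i j : Fin n) : edgeProb G α β i j = edgeProb G α β j i := by
  classical
  unfold edgeProb
  exact if_congr (G.adj_comm i j) rfl rfl

theorem assignmentProb_eq_prod_ite (p : ℝ) (T : Finset (Fin n)) :
    assignmentProb p T = ∏ i, if i ∈ T then p else 1 - p := by
  classical
  rw [assignmentProb, Finset.prod_ite]
  simp [Finset.filter_not, Finset.compl_eq_univ_sdiff]

theorem graph_eq_iff (g g' : SimpleGraph (Fin n)) :
    g = g' ↔ ∀ e : {e : Fin n × Fin n // e.1 < e.2}, g.Adj e.1.1 e.1.2 ↔ g'.Adj e.1.1 e.1.2 := by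
  refine ⟨by rintro rfl; simp, fun h => ?_⟩
  ext i j
  rcases lt_trichotomy i j with hl | rfl | hl
  · exact h ⟨(i, j), hl⟩
  · simp
  · rw [g.adj_comm, g'.adj_comm]; exact h ⟨(j, i), hl⟩

theorem exists_bound (F : Finset (Fin n) → SimpleGraph (Fin n) → ℝ) :
    ∃ C, ∀ T g, |F T g| ≤ C := by
  obtain ⟨C, hC⟩ := (Set.finite_range fun x : Finset (Fin n) × SimpleGraph (Fin n) =>
    |F x.1 x.2|).bddAbove
  exact ⟨C, fun T g => hC ⟨(T, g), rfl⟩⟩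

namespace IsNoisyExperiment

theorem isProbabilityMeasure (h : IsNoisyExperiment μ G p α β Z H) : IsProbabilityMeasure μ :=
  h.indep.isProbabilityMeasure

theorem edgeProb_mem (h : IsNoisyExperiment μ G p α β Z H) (i j : Fin n) :
    edgeProb G α β i j ∈ Set.Icc (0 : ℝ) 1 := by
  have h1 := h.alpha_mem
  have h2 := h.beta_mem
  simp only [Set.mem_Icc] at *
  unfold edgeProb
  split_ifs
  · constructor <;> linarith
  · exact h1

theorem edge_prob_of_lt (h : IsNoisyExperiment μ G p α β Z H) {i j : Fin n} (hij : i < j) :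
    μ.real {ω | (H ω).Adj i j} = edgeProb G α β i j := by
  have := h.isProbabilityMeasure
  by_cases hG : G.Adj i j
  · have h1 := h.missed_edge_prob i j hij hG
    have h2 := probReal_compl_eq_one_sub (μ := μ) (h.measurable_edge i j)
    have h3 : {ω | (H ω).Adj i j}ᶜ = {ω | ¬ (H ω).Adj i j} := rfl
    rw [h3, h1] at h2
    simp only [edgeProb, hG, if_true]
    linarith
  · simpa [edgeProb, hG] using h.false_edge_prob i j hij hG

theorem edge_prob (h : IsNoisyExperiment μ G p α β Z H) {i j : Fin n} (hij : i ≠ j) :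
    μ.real {ω | (H ω).Adj i j} = edgeProb G α β i j := by
  rcases lt_or_gt_of_ne hij with hl | hl
  · exact h.edge_prob_of_lt hl
  · rw [edgeProb_comm, ← h.edge_prob_of_lt hl]
    simp [SimpleGraph.adj_comm]

/-- The probability of prescribed values for the edge indicators in `E` and for the treatment
indicators in `S`. -/
theorem measureReal_prescribed (h : IsNoisyExperiment μ G p α β Z H) (S T : Finset (Fin n))
    (E : Finset {e : Fin n × Fin n // e.1 < e.2}) (b : {e : Fin n × Fin n // e.1 < e.2} → Prop)
    [DecidablePred b] :
    μ.real {ω | (∀ i ∈ S, i ∈ Z ω ↔ i ∈ T) ∧ ∀ e ∈ E, (H ω).Adj e.1.1 e.1.2 ↔ b e}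
      = (∏ i ∈ S, if i ∈ T then p else 1 - p) *
        ∏ e ∈ E, if b e then edgeProb G α β e.1.1 e.1.2 else 1 - edgeProb G α β e.1.1 e.1.2 := by
  classical
  have := h.isProbabilityMeasure
  have key := measureReal_iInter_signs (μ := μ) (by
      rintro (i | e)
      · exact h.measurable_treated i
      · exact h.measurable_edge _ _) h.indep (S.disjSum E) (Sum.elim (fun i => i ∈ T) b)
  rw [Finset.prod_disjSum] at key
  simp only [Sum.elim_inl, Sum.elim_inr, h.treated_prob] at key
  have e1 : (∏ e ∈ E, if b e then μ.real {ω | (H ω).Adj e.1.1 e.1.2}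
        else 1 - μ.real {ω | (H ω).Adj e.1.1 e.1.2})
      = ∏ e ∈ E, if b e then edgeProb G α β e.1.1 e.1.2 else 1 - edgeProb G α β e.1.1 e.1.2 :=
    Finset.prod_congr rfl fun e _ => by rw [h.edge_prob_of_lt e.2]
  rw [← e1]
  refine Eq.trans ?_ (key.trans (congrArg₂ _
    (Finset.prod_congr rfl fun e _ => by split_ifs <;> rfl)
    (Finset.prod_congr rfl fun e _ => by by_cases hb : b e <;> simp [hb])))
  congr 1
  ext ω
  simp only [Set.mem_ofPred_eq, Set.mem_iInter, Finset.mem_disjSum]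
  constructor
  · rintro ⟨h1, h2⟩ x (⟨i, hi, rfl⟩ | ⟨e, he, rfl⟩)
    · have := h1 i hi
      by_cases hT : i ∈ T <;> simp [hT] at this ⊢ <;> exact this
    · have := h2 e he
      by_cases hT : b e <;> simp [hT] at this ⊢ <;> exact this
  · intro h1
    refine ⟨fun i hi => ?_, fun e he => ?_⟩
    · have := h1 (Sum.inl i) (Or.inl ⟨i, hi, rfl⟩)
      by_cases hT : i ∈ T <;> simp [hT] at this ⊢ <;> exact this
    · have := h1 (Sum.inr e) (Or.inr ⟨e, he, rfl⟩)
      by_cases hT : b e <;> simp [hT] at this ⊢ <;> exact this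

theorem measurableSet_treated_eq (h : IsNoisyExperiment μ G p α β Z H) (T : Finset (Fin n)) :
    MeasurableSet {ω | Z ω = T} := by
  have : {ω | Z ω = T} = ⋂ i, {ω | i ∈ Z ω ↔ i ∈ T} := by
    ext ω; simp [Finset.ext_iff]
  rw [this]
  exact MeasurableSet.iInter fun i => (h.measurable_treated i).iff (MeasurableSet.const _)

theorem measurableSet_graph_eq (h : IsNoisyExperiment μ G p α β Z H) (g : SimpleGraph (Fin n)) :
    MeasurableSet {ω | H ω = g} := by
  have : {ω | H ω = g} = ⋂ i, ⋂ j, {ω | (H ω).Adj i j ↔ g.Adj i j} := by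
    ext ω; simp [SimpleGraph.ext_iff, funext_iff]
  rw [this]
  exact MeasurableSet.iInter fun i => MeasurableSet.iInter fun j =>
    (h.measurable_edge i j).iff (MeasurableSet.const _)

/-- The treated set and the observed graph are independent. -/
theorem measureReal_treated_graph (h : IsNoisyExperiment μ G p α β Z H) (T : Finset (Fin n))
    (g : SimpleGraph (Fin n)) :
    μ.real {ω | Z ω = T ∧ H ω = g} = assignmentProb p T * μ.real {ω | H ω = g} := by
  classical
  have h1 := h.measureReal_prescribed Finset.univ T Finset.univ (fun e => g.Adj e.1.1 e.1.2)
  have h2 := h.measureReal_prescribed ∅ T Finset.univ (fun e => g.Adj e.1.1 e.1.2)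
  simp only [Finset.notMem_empty, false_imp_iff, implies_true, true_and, Finset.prod_empty,
    one_mul, Finset.mem_univ, true_imp_iff, ← graph_eq_iff, ← Finset.ext_iff] at h1 h2
  rw [h1, h2, assignmentProb_eq_prod_ite]

theorem measurable_comp (h : IsNoisyExperiment μ G p α β Z H)
    {γ : Type*} [MeasurableSpace γ] (F : Finset (Fin n) → SimpleGraph (Fin n) → γ) :
    Measurable fun ω => F (Z ω) (H ω) := by
  intro s _
  have : (fun ω => F (Z ω) (H ω)) ⁻¹' s =
      ⋃ T : Finset (Fin n), ⋃ g : SimpleGraph (Fin n),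
        {ω | Z ω = T} ∩ {ω | H ω = g} ∩ {_ω | F T g ∈ s} := by
    ext ω; simp
  rw [this]
  exact MeasurableSet.iUnion fun T => MeasurableSet.iUnion fun g =>
    ((h.measurableSet_treated_eq T).inter (h.measurableSet_graph_eq g)).inter
      (MeasurableSet.const _)

/-- Every function of the data is integrable, since the data take finitely many values. -/
theorem integrable_comp (h : IsNoisyExperiment μ G p α β Z H)
    (F : Finset (Fin n) → SimpleGraph (Fin n) → ℝ) :
    Integrable (fun ω => F (Z ω) (H ω)) μ := by
  have := h.isProbabilityMeasure
  obtain ⟨C, hC⟩ := exists_bound F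
  exact Integrable.of_bound (h.measurable_comp F).aestronglyMeasurable C
    (Eventually.of_forall fun ω => hC _ _)

/-- Integration over the treated set first, the observed graph being independent of it. -/
theorem integral_eq_sum (h : IsNoisyExperiment μ G p α β Z H)
    (F : Finset (Fin n) → SimpleGraph (Fin n) → ℝ) :
    ∫ ω, F (Z ω) (H ω) ∂μ = ∑ T, assignmentProb p T * ∫ ω, F T (H ω) ∂μ := by
  classical
  have := h.isProbabilityMeasure
  have hs : ∀ (T : Finset (Fin n)) (g : SimpleGraph (Fin n)),
      MeasurableSet {ω | Z ω = T ∧ H ω = g} := fun T g =>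
    (h.measurableSet_treated_eq T).inter (h.measurableSet_graph_eq g)
  have e1 : ∀ ω, F (Z ω) (H ω) = ∑ T, ∑ g, {ω | Z ω = T ∧ H ω = g}.indicator
      (fun _ => F T g) ω := by
    intro ω
    rw [Finset.sum_eq_single (Z ω), Finset.sum_eq_single (H ω)]
    · simp
    · intro g _ hg; simp [Ne.symm hg]
    · simp
    · intro T _ hT; simp [Ne.symm hT]
    · simp
  have e2 : ∀ (T : Finset (Fin n)), ∀ ω, F T (H ω) = ∑ g, {ω | H ω = g}.indicator
      (fun _ => F T g) ω := by
    intro T ω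
    rw [Finset.sum_eq_single (H ω)]
    · simp
    · intro g _ hg; simp [Ne.symm hg]
    · simp
  simp_rw [e1]
  rw [integral_finsetSum]
  · refine Finset.sum_congr rfl fun T _ => ?_
    simp_rw [e2]
    rw [integral_finsetSum, integral_finsetSum, Finset.mul_sum]
    · refine Finset.sum_congr rfl fun g _ => ?_
      rw [integral_indicator_const _ (hs T g),
        integral_indicator_const _ (h.measurableSet_graph_eq g), h.measureReal_treated_graph]
      simp [mul_assoc]
    · exact fun g _ => (integrable_const _).indicator (h.measurableSet_graph_eq g)
    · exact fun g _ => (integrable_const _).indicator (hs T g)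
  · exact fun T _ => integrable_finsetSum _ fun g _ => (integrable_const _).indicator (hs T g)

/-- The probability that none of the pairs in `Q` is an edge of the observed graph. Since `Q` contains
no pair together with its reverse, the edge indicators involved are independent. -/
theorem measureReal_noEdge (h : IsNoisyExperiment μ G p α β Z H) (Q : Finset (Fin n × Fin n))
    (hne : ∀ q ∈ Q, q.1 ≠ q.2) (hrev : ∀ q ∈ Q, q.swap ∉ Q) :
    μ.real {ω | ∀ q ∈ Q, ¬ (H ω).Adj q.1 q.2} = ∏ q ∈ Q, (1 - edgeProb G α β q.1 q.2) := by
  classical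
  -- `o` orders a pair increasingly, as the indices of the edge indicators are
  let o : ∀ q ∈ Q, {e : Fin n × Fin n // e.1 < e.2} := fun q hq =>
    if hl : q.1 < q.2 then ⟨q, hl⟩ else ⟨q.swap, lt_of_le_of_ne (not_lt.1 hl) (hne q hq).symm⟩
  have ho : ∀ q hq, ((o q hq : Fin n × Fin n) = q) ∨ ((o q hq : Fin n × Fin n) = q.swap) := by
    intro q hq
    by_cases hl : q.1 < q.2
    · left; simp [o, hl]
    · right; simp [o, hl]
  have hadj : ∀ q hq, ∀ g : SimpleGraph (Fin n),
      g.Adj (o q hq).1.1 (o q hq).1.2 ↔ g.Adj q.1 q.2 := by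
    intro q hq g
    rcases ho q hq with h1 | h1 <;> rw [h1]
    exact g.adj_comm _ _
  have hprob : ∀ q hq, edgeProb G α β (o q hq).1.1 (o q hq).1.2 = edgeProb G α β q.1 q.2 := by
    intro q hq
    rcases ho q hq with h1 | h1 <;> rw [h1]
    exact edgeProb_comm _ _
  let E : Finset {e : Fin n × Fin n // e.1 < e.2} := Q.attach.image fun q => o q.1 q.2
  have key := h.measureReal_prescribed ∅ ∅ E (fun _ => False)
  simp only [Finset.notMem_empty, false_imp_iff, implies_true, true_and, Finset.prod_empty,
    one_mul, iff_false, if_false] at key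
  have e1 : {ω | ∀ e ∈ E, ¬ (H ω).Adj e.1.1 e.1.2} = {ω | ∀ q ∈ Q, ¬ (H ω).Adj q.1 q.2} := by
    ext ω
    simp only [Set.mem_ofPred_eq, E, Finset.mem_image, Finset.mem_attach, true_and]
    constructor
    · intro h1 q hq
      rw [← hadj q hq]
      exact h1 _ ⟨⟨q, hq⟩, rfl⟩
    · rintro h1 e ⟨⟨q, hq⟩, rfl⟩
      rw [hadj q hq]
      exact h1 q hq
  rw [← e1, key, Finset.prod_image]
  · rw [← Finset.prod_attach Q]
    exact Finset.prod_congr rfl fun q _ => by rw [hprob q.1 q.2]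
  · rintro ⟨q, hq⟩ _ ⟨q', hq'⟩ _ (heq : o q hq = o q' hq')
    have h0 : (o q hq : Fin n × Fin n) = o q' hq' := by rw [heq]
    rw [Subtype.mk.injEq]
    rcases ho q hq with h1 | h1 <;> rcases ho q' hq' with h2 | h2
    · rw [← h1, ← h2, h0]
    · exact absurd hq (by rw [← h1, h0, h2]; exact hrev q' hq')
    · exact absurd hq' (by rw [← h2, ← h0, h1]; exact hrev q hq)
    · rw [h0, h2] at h1
      exact (Prod.swap_injective h1).symm

end IsNoisyExperiment

end Law

/-! ### Probabilities of isolation events -/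

theorem abs_prod_sub_prod_le {ι : Type*} (s : Finset ι) (f g : ι → ℝ)
    (hf : ∀ k ∈ s, f k ∈ Set.Icc (0 : ℝ) 1) (hg : ∀ k ∈ s, g k ∈ Set.Icc (0 : ℝ) 1) :
    |∏ k ∈ s, f k - ∏ k ∈ s, g k| ≤ ∑ k ∈ s, |f k - g k| := by
  classical
  induction s using Finset.induction_on with
  | empty => simp
  | insert a s ha ih =>
    rw [Finset.prod_insert ha, Finset.prod_insert ha, Finset.sum_insert ha]
    have h1 := ih (fun k hk => hf k (Finset.mem_insert_of_mem hk))
      (fun k hk => hg k (Finset.mem_insert_of_mem hk))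
    have ha1 := hf a (Finset.mem_insert_self _ _)
    have h2 : 0 ≤ ∏ k ∈ s, g k :=
      Finset.prod_nonneg fun k hk => (hg k (Finset.mem_insert_of_mem hk)).1
    have h3 : ∏ k ∈ s, g k ≤ 1 :=
      Finset.prod_le_one (fun k hk => (hg k (Finset.mem_insert_of_mem hk)).1)
        fun k hk => (hg k (Finset.mem_insert_of_mem hk)).2
    calc |f a * ∏ k ∈ s, f k - g a * ∏ k ∈ s, g k|
        = |f a * (∏ k ∈ s, f k - ∏ k ∈ s, g k) + (f a - g a) * ∏ k ∈ s, g k| := by ring_nf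
      _ ≤ |f a| * |∏ k ∈ s, f k - ∏ k ∈ s, g k| + |f a - g a| * |∏ k ∈ s, g k| := by
          rw [← abs_mul, ← abs_mul]; exact abs_add_le _ _
      _ ≤ 1 * |∏ k ∈ s, f k - ∏ k ∈ s, g k| + |f a - g a| * 1 := by
          rw [abs_of_nonneg ha1.1, abs_of_nonneg h2]
          gcongr
          exact ha1.2
      _ ≤ _ := by linarith

/-- The probability of receiving treatment (`τ = true`) or of not receiving it. -/
noncomputable def armProb (p : ℝ) (τ : Bool) : ℝ := if τ then p else 1 - p

open scoped Classical in
/-- The indicator that the treatment status of `i` is `τ`. -/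
noncomputable def armInd {n : ℕ} (T : Finset (Fin n)) (i : Fin n) (τ : Bool) : ℝ :=
  if i ∈ T ↔ τ = true then 1 else 0

theorem armInd_nonneg {n : ℕ} (T : Finset (Fin n)) (i : Fin n) (τ : Bool) :
    0 ≤ armInd T i τ := by unfold armInd; split_ifs <;> norm_num

theorem armInd_le_one {n : ℕ} (T : Finset (Fin n)) (i : Fin n) (τ : Bool) :
    armInd T i τ ≤ 1 := by unfold armInd; split_ifs <;> norm_num

theorem armInd_mul_self {n : ℕ} (T : Finset (Fin n)) (i : Fin n) (τ : Bool) :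
    armInd T i τ * armInd T i τ = armInd T i τ := by unfold armInd; split_ifs <;> norm_num

theorem armProb_nonneg {p : ℝ} (hp : p ∈ Set.Icc (0 : ℝ) 1) (τ : Bool) : 0 ≤ armProb p τ := by
  obtain ⟨h1, h2⟩ := hp
  unfold armProb; split_ifs <;> linarith

theorem armProb_le_one {p : ℝ} (hp : p ∈ Set.Icc (0 : ℝ) 1) (τ : Bool) : armProb p τ ≤ 1 := by
  obtain ⟨h1, h2⟩ := hp
  unfold armProb; split_ifs <;> linarith

/-- The generating function of the treatment indicators. -/
theorem sum_assignmentProb_mul_prod {n : ℕ} (p : ℝ) (a b : Fin n → ℝ) :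
    ∑ T : Finset (Fin n), assignmentProb p T * ∏ k, (if k ∈ T then a k else b k)
      = ∏ k, (p * a k + (1 - p) * b k) := by
  classical
  rw [Finset.prod_add, Finset.powerset_univ]
  refine Finset.sum_congr rfl fun T _ => ?_
  rw [assignmentProb_eq_prod_ite, ← Finset.prod_mul_distrib,
    ← Finset.prod_mul_prod_compl T, Finset.compl_eq_univ_sdiff]
  congr 1
  · exact Finset.prod_congr rfl fun k hk => by simp [hk]
  · exact Finset.prod_congr rfl fun k hk => by simp [(Finset.mem_sdiff.1 hk).2]

theorem assignmentProb_nonneg {n : ℕ} {p : ℝ} (hp : p ∈ Set.Icc (0 : ℝ) 1)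
    (T : Finset (Fin n)) : 0 ≤ assignmentProb p T :=
  mul_nonneg (pow_nonneg hp.1 _) (pow_nonneg (sub_nonneg.2 hp.2) _)

theorem prod_armInd_eq {n : ℕ} (J T : Finset (Fin n)) (τ : Bool) :
    ∏ i ∈ J, armInd T i τ = ∏ k, (if k ∈ T then (if k ∈ J ∧ τ = false then 0 else 1)
      else (if k ∈ J ∧ τ = true then 0 else 1)) := by
  classical
  rw [← Finset.prod_subset (Finset.subset_univ J)]
  · refine Finset.prod_congr rfl fun i hi => ?_
    by_cases h : i ∈ T <;> cases τ <;> simp [armInd, h, hi]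
  · intro i _ hi; simp [hi]

theorem sum_assignmentProb_mul_prod_armInd {n : ℕ} (p : ℝ) (J : Finset (Fin n)) (τ : Bool) :
    ∑ T : Finset (Fin n), assignmentProb p T * ∏ i ∈ J, armInd T i τ
      = armProb p τ ^ J.card := by
  classical
  simp_rw [prod_armInd_eq]
  rw [sum_assignmentProb_mul_prod, ← Finset.prod_subset (Finset.subset_univ J)]
  · rw [← Finset.prod_const]
    refine Finset.prod_congr rfl fun i hi => ?_
    cases τ <;> simp [hi, armProb]
  · intro i _ hi; simp [hi]

/-- None of the treated vertices is a neighbour of `i` in `g`. -/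
def IsolatedIn {n : ℕ} (T : Finset (Fin n)) (g : SimpleGraph (Fin n)) (i : Fin n) : Prop :=
  ∀ k ∈ T, ¬ g.Adj k i

open scoped Classical in
/-- The indicator that `i` has treatment status `τ`, has no treated neighbour in `G` (if `s`), and
has no treated neighbour in `g` (if `t`). The joint distribution of the two exposures of `i` is
determined by the expectations of these four indicators. -/
noncomputable def isoInd {n : ℕ} (G : SimpleGraph (Fin n)) (τ s t : Bool) (i : Fin n)
    (T : Finset (Fin n)) (g : SimpleGraph (Fin n)) : ℝ :=
  armInd T i τ * (if s = true → IsolatedIn T G i then 1 else 0)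
    * (if t = true → IsolatedIn T g i then 1 else 0)

open scoped Classical in
/-- The product over `i ∈ J` of the indicators `isoInd`, with treated neighbours that belong to `J`
left out of account. -/
noncomputable def isoIndOff {n : ℕ} (G : SimpleGraph (Fin n)) (τ s t : Bool)
    (J : Finset (Fin n)) (T : Finset (Fin n)) (g : SimpleGraph (Fin n)) : ℝ :=
  (∏ i ∈ J, armInd T i τ)
    * (∏ k, if k ∈ T ∧ k ∉ J then (∏ i ∈ J, if s = true ∧ G.Adj k i then (0 : ℝ) else 1) else 1)
    * (if t = true → ∀ k ∈ T, k ∉ J → ∀ i ∈ J, ¬ g.Adj k i then 1 else 0)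

theorem isoInd_nonneg {n : ℕ} (G : SimpleGraph (Fin n)) (τ s t : Bool) (i : Fin n)
    (T : Finset (Fin n)) (g : SimpleGraph (Fin n)) : 0 ≤ isoInd G τ s t i T g := by
  unfold isoInd
  have := armInd_nonneg T i τ
  split_ifs <;> simp [this]

theorem isoInd_le_armInd {n : ℕ} (G : SimpleGraph (Fin n)) (τ s t : Bool) (i : Fin n)
    (T : Finset (Fin n)) (g : SimpleGraph (Fin n)) : isoInd G τ s t i T g ≤ armInd T i τ := by
  unfold isoInd
  have := armInd_nonneg T i τ
  split_ifs <;> simp [this]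

open scoped Classical in
theorem isoIndOff_eq {n : ℕ} (G : SimpleGraph (Fin n)) (τ s t : Bool)
    (J : Finset (Fin n)) (T : Finset (Fin n)) (g : SimpleGraph (Fin n)) :
    isoIndOff G τ s t J T g = (∏ i ∈ J, armInd T i τ)
      * (if s = true → ∀ k ∈ T, k ∉ J → ∀ i ∈ J, ¬ G.Adj k i then 1 else 0)
      * (if t = true → ∀ k ∈ T, k ∉ J → ∀ i ∈ J, ¬ g.Adj k i then 1 else 0) := by
  unfold isoIndOff
  congr 2
  split_ifs with h
  · refine Finset.prod_eq_one fun k _ => ?_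
    split_ifs with hk
    · refine Finset.prod_eq_one fun i hi => ?_
      rw [if_neg]
      rintro ⟨hs, ha⟩
      exact h hs k hk.1 hk.2 i hi ha
    · rfl
  · push Not at h
    obtain ⟨hs, k, hk, hkJ, i, hi, ha⟩ := h
    refine Finset.prod_eq_zero (Finset.mem_univ k) ?_
    rw [if_pos ⟨hk, hkJ⟩]
    exact Finset.prod_eq_zero hi (by simp [hs, ha])

theorem isoIndOff_singleton {n : ℕ} (G : SimpleGraph (Fin n)) (τ s t : Bool) (i : Fin n)
    (T : Finset (Fin n)) (g : SimpleGraph (Fin n)) :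
    isoIndOff G τ s t {i} T g = isoInd G τ s t i T g := by
  classical
  have h : ∀ g : SimpleGraph (Fin n),
      (∀ k ∈ T, k ∉ ({i} : Finset (Fin n)) → ∀ i' ∈ ({i} : Finset (Fin n)), ¬ g.Adj k i')
        ↔ IsolatedIn T g i := by
    intro g
    simp only [Finset.mem_singleton, forall_eq, IsolatedIn]
    refine forall₂_congr fun k _ => ⟨fun h1 ha => h1 ha.ne ha, fun h1 _ => h1⟩
  rw [isoIndOff_eq]
  simp only [h, Finset.prod_singleton, isoInd]

section Law

variable {n : ℕ} {Ω : Type*} [MeasurableSpace Ω] {μ : Measure Ω} {G : SimpleGraph (Fin n)}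
  {p α β : ℝ} {Z : Ω → Finset (Fin n)} {H : Ω → SimpleGraph (Fin n)}

open scoped Classical in
/-- The probability that a treated vertex `k` does not violate the isolation of `i` that is required
by `s` (in `G`) and `t` (in the observed graph). -/
noncomputable def keepProb (G : SimpleGraph (Fin n)) (α β : ℝ) (s t : Bool) (k i : Fin n) : ℝ :=
  (if s = true ∧ G.Adj k i then 0 else 1) * (if t = true then 1 - edgeProb G α β k i else 1)

namespace IsNoisyExperiment

theorem keepProb_mem (h : IsNoisyExperiment μ G p α β Z H) (s t : Bool) (k i : Fin n) :
    keepProb G α β s t k i ∈ Set.Icc (0 : ℝ) 1 := by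
  have h1 := h.edgeProb_mem k i
  simp only [Set.mem_Icc] at *
  unfold keepProb
  split_ifs <;> constructor <;> linarith

theorem integral_treated_mul_graph (h : IsNoisyExperiment μ G p α β Z H)
    (a : Finset (Fin n) → ℝ) (b : SimpleGraph (Fin n) → ℝ) :
    ∫ ω, a (Z ω) * b (H ω) ∂μ = (∑ T, assignmentProb p T * a T) * ∫ ω, b (H ω) ∂μ := by
  rw [h.integral_eq_sum fun T g => a T * b g, Finset.sum_mul]
  refine Finset.sum_congr rfl fun T _ => ?_
  rw [integral_const_mul, mul_assoc]

theorem integral_graph_ite (h : IsNoisyExperiment μ G p α β Z H)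
    (P : SimpleGraph (Fin n) → Prop) [DecidablePred P] :
    ∫ ω, (if P (H ω) then (1 : ℝ) else 0) ∂μ = μ.real {ω | P (H ω)} := by
  have hm : MeasurableSet {ω | P (H ω)} := by
    have := h.measurable_comp (γ := Prop) (fun _ g => P g)
    exact measurableSet_setOfPred.2 this
  rw [← integral_indicator_one hm]
  exact integral_congr_ae (Eventually.of_forall fun ω => by simp [Set.indicator_apply])

/-- The expectation of `isoIndOff`: the contributions of the vertices outside `J` are
independent. -/
theorem integral_isoIndOff (h : IsNoisyExperiment μ G p α β Z H) (τ s t : Bool)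
    (J : Finset (Fin n)) :
    ∫ ω, isoIndOff G τ s t J (Z ω) (H ω) ∂μ
      = armProb p τ ^ J.card *
        ∏ k ∈ Jᶜ, (1 - p + p * ∏ i ∈ J, keepProb G α β s t k i) := by
  classical
  have := h.isProbabilityMeasure
  have hcond : ∀ T : Finset (Fin n), ∫ ω, isoIndOff G τ s t J T (H ω) ∂μ
      = ∏ k, (if k ∈ T then (if k ∈ J then (if τ = false then 0 else 1)
          else ∏ i ∈ J, keepProb G α β s t k i)
        else (if k ∈ J ∧ τ = true then 0 else 1)) := by
    intro T
    have hH : ∫ ω, (if t = true → ∀ k ∈ T, k ∉ J → ∀ i ∈ J, ¬ (H ω).Adj k i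
        then (1 : ℝ) else 0) ∂μ
        = ∏ k, if k ∈ T ∧ k ∉ J then
            (∏ i ∈ J, if t = true then 1 - edgeProb G α β k i else 1) else 1 := by
      refine (h.integral_graph_ite
        fun g => t = true → ∀ k ∈ T, k ∉ J → ∀ i ∈ J, ¬ g.Adj k i).trans ?_
      cases t with
      | false => simp
      | true =>
        have hq := h.measureReal_noEdge ((T \ J) ×ˢ J) (by
            rintro ⟨k, i⟩ hq
            simp only [Finset.mem_product, Finset.mem_sdiff] at hq
            intro (e : k = i)
            exact hq.1.2 (e ▸ hq.2)) (by
            rintro ⟨k, i⟩ hq hq'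
            simp only [Prod.swap_prod_mk, Finset.mem_product, Finset.mem_sdiff] at hq hq'
            exact hq.1.2 hq'.2)
        rw [Finset.prod_product] at hq
        simp only [true_imp_iff, if_true]
        rw [← Finset.prod_filter, show Finset.univ.filter (fun k => k ∈ T ∧ k ∉ J) = T \ J by
          ext k; simp, ← hq]
        congr 1
        ext ω
        simp only [Set.mem_ofPred_eq, Prod.forall, Finset.mem_product, Finset.mem_sdiff]
        exact ⟨fun h1 k i hk => h1 k hk.1.1 hk.1.2 i hk.2,
          fun h1 k hk hkJ i hi => h1 k i ⟨⟨hk, hkJ⟩, hi⟩⟩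
    unfold isoIndOff
    rw [integral_const_mul, hH, prod_armInd_eq, ← Finset.prod_mul_distrib,
      ← Finset.prod_mul_distrib]
    refine Finset.prod_congr rfl fun k _ => ?_
    by_cases hT : k ∈ T <;> by_cases hJ : k ∈ J
    · simp [hT, hJ]
    · simp only [hT, hJ, keepProb, Finset.prod_mul_distrib]
      simp
    · simp [hT, hJ]
    · simp [hT, hJ]
  rw [h.integral_eq_sum]
  simp_rw [hcond]
  rw [sum_assignmentProb_mul_prod, ← Finset.prod_mul_prod_compl J]
  congr 1
  · rw [← Finset.prod_const]
    refine Finset.prod_congr rfl fun i hi => ?_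
    cases τ <;> simp [hi, armProb]
  · refine Finset.prod_congr rfl fun i hi => ?_
    rw [Finset.mem_compl] at hi
    simp [hi]
    ring

theorem integral_isoInd (h : IsNoisyExperiment μ G p α β Z H) (τ s t : Bool) (i : Fin n) :
    ∫ ω, isoInd G τ s t i (Z ω) (H ω) ∂μ
      = armProb p τ * ∏ k ∈ {i}ᶜ, (1 - p + p * keepProb G α β s t k i) := by
  have := h.integral_isoIndOff τ s t {i}
  simpa [isoIndOff_singleton] using this

theorem integral_armInd_mul_armInd_mul (h : IsNoisyExperiment μ G p α β Z H) (τ : Bool)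
    {i j : Fin n} (hij : i ≠ j) (b : SimpleGraph (Fin n) → ℝ) :
    ∫ ω, armInd (Z ω) i τ * armInd (Z ω) j τ * b (H ω) ∂μ
      = armProb p τ ^ 2 * ∫ ω, b (H ω) ∂μ := by
  rw [h.integral_treated_mul_graph (fun T => armInd T i τ * armInd T j τ)]
  have := sum_assignmentProb_mul_prod_armInd p {i, j} τ
  simp only [Finset.prod_pair hij, Finset.card_pair hij] at this
  rw [this]

theorem integral_armInd_mul (h : IsNoisyExperiment μ G p α β Z H) (τ : Bool)
    (i : Fin n) (b : SimpleGraph (Fin n) → ℝ) :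
    ∫ ω, armInd (Z ω) i τ * b (H ω) ∂μ = armProb p τ * ∫ ω, b (H ω) ∂μ := by
  rw [h.integral_treated_mul_graph (fun T => armInd T i τ)]
  have := sum_assignmentProb_mul_prod_armInd p {i} τ
  simp only [Finset.prod_singleton, Finset.card_singleton, pow_one] at this
  rw [this]

theorem integral_armInd (h : IsNoisyExperiment μ G p α β Z H) (τ : Bool) (i : Fin n) :
    ∫ ω, armInd (Z ω) i τ ∂μ = armProb p τ := by
  have := h.isProbabilityMeasure
  simpa using h.integral_armInd_mul τ i fun _ => 1

theorem integral_armInd_mul_armInd (h : IsNoisyExperiment μ G p α β Z H) (τ : Bool)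
    {i j : Fin n} (hij : i ≠ j) :
    ∫ ω, armInd (Z ω) i τ * armInd (Z ω) j τ ∂μ = armProb p τ ^ 2 := by
  have := h.isProbabilityMeasure
  simpa using h.integral_armInd_mul_armInd_mul τ hij fun _ => 1

theorem integral_isoInd_nonneg (_h : IsNoisyExperiment μ G p α β Z H) (τ s t : Bool) (i : Fin n) :
    0 ≤ ∫ ω, isoInd G τ s t i (Z ω) (H ω) ∂μ :=
  integral_nonneg fun _ => isoInd_nonneg _ _ _ _ _ _ _

theorem integral_isoInd_le (h : IsNoisyExperiment μ G p α β Z H) (τ s t : Bool) (i : Fin n) :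
    ∫ ω, isoInd G τ s t i (Z ω) (H ω) ∂μ ≤ armProb p τ := by
  rw [← h.integral_armInd τ i]
  exact integral_mono (h.integrable_comp _) (h.integrable_comp fun T _ => armInd T i τ)
    fun ω => isoInd_le_armInd _ _ _ _ _ _ _

/-- Outside the pairs `i`, `j` that are adjacent or have a common neighbour, dependence between the
isolation indicators of `i` and `j` comes only from false edges, which are rare. -/
theorem abs_cov_isoInd_le (h : IsNoisyExperiment μ G p α β Z H) (τ s t : Bool)
    {i j : Fin n} (hij : i ≠ j) (hadj : ¬ G.Adj i j)
    (hcn : ¬ ∃ v, G.Adj i v ∧ G.Adj j v) :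
    |∫ ω, isoInd G τ s t i (Z ω) (H ω) * isoInd G τ s t j (Z ω) (H ω) ∂μ
      - (∫ ω, isoInd G τ s t i (Z ω) (H ω) ∂μ) * ∫ ω, isoInd G τ s t j (Z ω) (H ω) ∂μ|
      ≤ armProb p τ ^ 2 * (α * (3 + p * (deg G i + deg G j) + n * p * α)) := by
  classical
  have := h.isProbabilityMeasure
  have hp := h.p_mem
  have hα := h.alpha_mem
  simp only [Set.mem_Icc] at hp hα
  have hπ := armProb_nonneg h.p_mem τ
  -- the pair indicator that ignores `i` and `j` as neighbours of each other
  have step1 : |∫ ω, isoInd G τ s t i (Z ω) (H ω) * isoInd G τ s t j (Z ω) (H ω) ∂μ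
      - ∫ ω, isoIndOff G τ s t {i, j} (Z ω) (H ω) ∂μ| ≤ armProb p τ ^ 2 * α := by
    have hpt : ∀ (T : Finset (Fin n)) (g : SimpleGraph (Fin n)),
        |isoInd G τ s t i T g * isoInd G τ s t j T g - isoIndOff G τ s t {i, j} T g|
          ≤ armInd T i τ * armInd T j τ * (if g.Adj i j then 1 else 0) := by
      intro T g
      have hprod : isoInd G τ s t i T g * isoInd G τ s t j T g
          = (armInd T i τ * armInd T j τ)
            * (if s = true → IsolatedIn T G i ∧ IsolatedIn T G j then 1 else 0)
            * (if t = true → IsolatedIn T g i ∧ IsolatedIn T g j then 1 else 0) := by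
        unfold isoInd
        by_cases h1 : IsolatedIn T G i <;> by_cases h2 : IsolatedIn T G j <;>
        by_cases h3 : IsolatedIn T g i <;> by_cases h4 : IsolatedIn T g j <;>
        cases s <;> cases t <;> simp [h1, h2, h3, h4]
      have hoff : ∀ g' : SimpleGraph (Fin n), ¬ g'.Adj i j →
          ((∀ k ∈ T, k ∉ ({i, j} : Finset (Fin n)) → ∀ i' ∈ ({i, j} : Finset (Fin n)),
            ¬ g'.Adj k i') ↔ IsolatedIn T g' i ∧ IsolatedIn T g' j) := by
        intro g' hg'
        simp only [Finset.mem_insert, Finset.mem_singleton, forall_eq_or_imp, forall_eq,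
          IsolatedIn, not_or]
        constructor
        · intro h1
          refine ⟨fun k hk ha => ?_, fun k hk ha => ?_⟩
          · exact (h1 k hk ⟨ha.ne, fun e => hg' (e ▸ ha.symm)⟩).1 ha
          · exact (h1 k hk ⟨fun e => hg' (e ▸ ha), ha.ne⟩).2 ha
        · exact fun h1 k hk _ => ⟨h1.1 k hk, h1.2 k hk⟩
      have ha1 : 0 ≤ armInd T i τ * armInd T j τ :=
        mul_nonneg (armInd_nonneg _ _ _) (armInd_nonneg _ _ _)
      rw [hprod, isoIndOff_eq, Finset.prod_pair hij]
      simp only [hoff G hadj]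
      by_cases hg : g.Adj i j
      · simp only [hg, if_true, mul_one]
        split_ifs <;> simp [abs_of_nonneg, ha1]
      · simp only [hoff g hg, sub_self, abs_zero, hg, if_false, mul_zero, le_refl]
    rw [← integral_sub (h.integrable_comp fun T g => isoInd G τ s t i T g * isoInd G τ s t j T g)
      (h.integrable_comp fun T g => isoIndOff G τ s t {i, j} T g)]
    refine (abs_integral_le_integral_abs).trans ?_
    have hα' : ∫ ω, (if (H ω).Adj i j then (1 : ℝ) else 0) ∂μ = α := by
      rw [h.integral_graph_ite fun g => g.Adj i j, h.edge_prob hij]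
      simp [edgeProb, hadj]
    calc _ ≤ ∫ ω, armInd (Z ω) i τ * armInd (Z ω) j τ * (if (H ω).Adj i j then 1 else 0) ∂μ :=
          integral_mono (h.integrable_comp fun T g =>
            |isoInd G τ s t i T g * isoInd G τ s t j T g - isoIndOff G τ s t {i, j} T g|)
            (h.integrable_comp fun T g => armInd T i τ * armInd T j τ *
              (if g.Adj i j then 1 else 0)) fun ω => hpt _ _
      _ = armProb p τ ^ 2 * α := by
          rw [h.integral_armInd_mul_armInd_mul τ hij fun g => if g.Adj i j then 1 else 0, hα']
  set x : Fin n → ℝ := fun k => keepProb G α β s t k i with hx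
  set w : Fin n → ℝ := fun k => keepProb G α β s t k j with hw
  have hxm : ∀ k, 0 ≤ x k ∧ x k ≤ 1 := fun k => h.keepProb_mem s t k i
  have hwm : ∀ k, 0 ≤ w k ∧ w k ≤ 1 := fun k => h.keepProb_mem s t k j
  have hσ : ∀ k i, 1 - keepProb G α β s t k i ≤ (if G.Adj k i then 1 else 0) + α := by
    intro k i
    have h1 := h.keepProb_mem s t k i
    simp only [Set.mem_Icc] at h1
    by_cases ha : G.Adj k i
    · simp only [ha, if_true]; linarith [h1.1]
    · have : keepProb G α β s t k i = if t = true then 1 - α else 1 := by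
        simp [keepProb, ha, edgeProb]
      rw [this]
      simp only [ha, if_false]
      split_ifs <;> linarith
  have hcompl : ∀ a b : Fin n, a ≠ b → ∀ f : Fin n → ℝ,
      ∏ k ∈ {a}ᶜ, f k = f b * ∏ k ∈ {a, b}ᶜ, f k := by
    intro a b hab f
    have : ({a}ᶜ : Finset (Fin n)) = insert b ({a, b}ᶜ) := by
      ext k
      simp only [Finset.mem_compl, Finset.mem_singleton, Finset.mem_insert, not_or]
      constructor
      · intro h1
        by_cases hk : k = b
        · exact Or.inl hk
        · exact Or.inr ⟨h1, hk⟩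
      · rintro (rfl | ⟨h1, _⟩)
        · exact hab.symm
        · exact h1
    rw [this, Finset.prod_insert (by simp)]
  set R : Finset (Fin n) := {i, j}ᶜ with hR
  set X := ∏ k ∈ R, (1 - p + p * x k) with hX
  set W := ∏ k ∈ R, (1 - p + p * w k) with hW
  set V := ∏ k ∈ R, (1 - p + p * (x k * w k)) with hV
  have hoffint : ∫ ω, isoIndOff G τ s t {i, j} (Z ω) (H ω) ∂μ = armProb p τ ^ 2 * V := by
    rw [h.integral_isoIndOff, Finset.card_pair hij]
    simp only [Finset.prod_pair hij]
    rfl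
  have hi : ∫ ω, isoInd G τ s t i (Z ω) (H ω) ∂μ = armProb p τ * ((1 - p + p * x j) * X) := by
    rw [h.integral_isoInd, hcompl i j hij]
  have hj : ∫ ω, isoInd G τ s t j (Z ω) (H ω) ∂μ = armProb p τ * ((1 - p + p * w i) * W) := by
    rw [h.integral_isoInd, hcompl j i hij.symm, Finset.pair_comm j i]
  have hmem : ∀ z : ℝ, 0 ≤ z → z ≤ 1 → 1 - p + p * z ∈ Set.Icc (0 : ℝ) 1 := by
    intro z h0 h1
    constructor <;> nlinarith
  have hXm : 0 ≤ X ∧ X ≤ 1 :=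
    ⟨Finset.prod_nonneg fun k _ => (hmem _ (hxm k).1 (hxm k).2).1,
      Finset.prod_le_one (fun k _ => (hmem _ (hxm k).1 (hxm k).2).1)
        fun k _ => (hmem _ (hxm k).1 (hxm k).2).2⟩
  have hWm : 0 ≤ W ∧ W ≤ 1 :=
    ⟨Finset.prod_nonneg fun k _ => (hmem _ (hwm k).1 (hwm k).2).1,
      Finset.prod_le_one (fun k _ => (hmem _ (hwm k).1 (hwm k).2).1)
        fun k _ => (hmem _ (hwm k).1 (hwm k).2).2⟩
  -- the two products over `R` differ only through common (possibly false) neighbours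
  have step2 : |V - X * W| ≤ p * (α * (deg G i + deg G j) + n * α ^ 2) := by
    rw [hX, hW, ← Finset.prod_mul_distrib]
    refine (abs_prod_sub_prod_le R _ _ (fun k _ => hmem _ ?_ ?_) (fun k _ => ?_)).trans ?_
    · exact mul_nonneg (hxm k).1 (hwm k).1
    · exact mul_le_one₀ (hxm k).2 (hwm k).1 (hwm k).2
    · have h1 := hmem _ (hxm k).1 (hxm k).2
      have h2 := hmem _ (hwm k).1 (hwm k).2
      exact ⟨mul_nonneg h1.1 h2.1, mul_le_one₀ h1.2 h2.1 h2.2⟩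
    · have hterm : ∀ k ∈ R, |1 - p + p * (x k * w k) - (1 - p + p * x k) * (1 - p + p * w k)|
          ≤ p * (α * ((if G.Adj k i then 1 else 0) + (if G.Adj k j then 1 else 0)) + α ^ 2) := by
        intro k _
        have e : 1 - p + p * (x k * w k) - (1 - p + p * x k) * (1 - p + p * w k)
            = p * ((1 - p) * ((1 - x k) * (1 - w k))) := by ring
        have hx0 : 0 ≤ 1 - x k := by linarith [(hxm k).2]
        have hw0 : 0 ≤ 1 - w k := by linarith [(hwm k).2]
        have hp1 : 0 ≤ 1 - p := by linarith
        rw [e, abs_of_nonneg (mul_nonneg hp.1 (mul_nonneg hp1 (mul_nonneg hx0 hw0)))]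
        refine mul_le_mul_of_nonneg_left ?_ hp.1
        have h1 := hσ k i
        have h2 := hσ k j
        have h3 : (1 - x k) * (1 - w k)
            ≤ ((if G.Adj k i then 1 else 0) + α) * ((if G.Adj k j then 1 else 0) + α) :=
          mul_le_mul h1 h2 hw0 (hx0.trans h1)
        have h4 : ((if G.Adj k i then 1 else 0) + α) * ((if G.Adj k j then 1 else 0) + α)
            = α * ((if G.Adj k i then 1 else 0) + (if G.Adj k j then 1 else 0)) + α ^ 2 := by
          by_cases ha : G.Adj k i <;> by_cases hb : G.Adj k j
          · exact absurd ⟨k, ha.symm, hb.symm⟩ hcn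
          all_goals simp [ha, hb]; ring
        rw [← h4]
        refine le_trans ?_ h3
        exact mul_le_of_le_one_left (mul_nonneg hx0 hw0) (by linarith)
      refine (Finset.sum_le_sum hterm).trans ?_
      rw [← Finset.mul_sum]
      refine mul_le_mul_of_nonneg_left ?_ hp.1
      have hdeg : ∀ a : Fin n, ∑ k, (if G.Adj k a then (1 : ℝ) else 0) = deg G a := by
        intro a
        simp [deg, G.adj_comm]
      calc _ ≤ ∑ k, (α * ((if G.Adj k i then 1 else 0) + (if G.Adj k j then 1 else 0)) + α ^ 2) :=
            Finset.sum_le_sum_of_subset_of_nonneg (Finset.subset_univ _) fun k _ _ => by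
              have := hα.1
              split_ifs <;> positivity
        _ = _ := by
            rw [Finset.sum_add_distrib, ← Finset.mul_sum, Finset.sum_add_distrib, hdeg, hdeg]
            simp
  have hα1 : ∀ z : ℝ, 0 ≤ z → z ≤ 1 → 1 - z ≤ α →
      0 ≤ 1 - p + p * z ∧ 1 - p + p * z ≤ 1 ∧ 1 - α ≤ 1 - p + p * z := by
    intro z h0 h1 h2
    have := hmem z h0 h1
    refine ⟨this.1, this.2, ?_⟩
    nlinarith
  have hxj := hα1 (x j) (hxm j).1 (hxm j).2 (by
    have := hσ j i; rwa [if_neg (fun ha => hadj ha.symm), zero_add] at this)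
  have hwi := hα1 (w i) (hwm i).1 (hwm i).2 (by
    have := hσ i j; rwa [if_neg hadj, zero_add] at this)
  have step3 : |X * W - (1 - p + p * x j) * X * ((1 - p + p * w i) * W)| ≤ 2 * α := by
    set A := 1 - p + p * x j
    set B := 1 - p + p * w i
    have e : X * W - A * X * (B * W) = (X * W) * (1 - A * B) := by ring
    have h1 : 0 ≤ 1 - A * B := by nlinarith
    have h2 : 1 - A * B ≤ 2 * α := by nlinarith
    have h3 : X * W ≤ 1 := mul_le_one₀ hXm.2 hWm.1 hWm.2
    rw [e, abs_of_nonneg (mul_nonneg (mul_nonneg hXm.1 hWm.1) h1)]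
    exact (mul_le_of_le_one_left h1 h3).trans h2
  rw [hi, hj]
  rw [hoffint] at step1
  set A := 1 - p + p * x j
  set B := 1 - p + p * w i
  have e : ∀ I : ℝ, I - armProb p τ * (A * X) * (armProb p τ * (B * W))
      = (I - armProb p τ ^ 2 * V) + armProb p τ ^ 2 * ((V - X * W) + (X * W - A * X * (B * W))) := by
    intro I; ring
  rw [e]
  refine (abs_add_le _ _).trans ?_
  rw [abs_mul, abs_of_nonneg (sq_nonneg (armProb p τ))]
  have h5 := mul_le_mul_of_nonneg_left ((abs_add_le _ _).trans (add_le_add step2 step3))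
    (sq_nonneg (armProb p τ))
  refine (add_le_add step1 h5).trans (le_of_eq ?_)
  ring

end IsNoisyExperiment

end Law

/-! ### Weak law of large numbers for the isolation indicators -/

open scoped Classical in
theorem card_commonNeighbor_le {n : ℕ} (G : SimpleGraph (Fin n)) :
    (((Finset.univ : Finset (Fin n × Fin n)).filter fun e =>
      e.1 ≠ e.2 ∧ ∃ v, G.Adj e.1 v ∧ G.Adj e.2 v).card : ℝ)
      ≤ (n : ℝ) ^ 2 - pairsWithoutCommonNeighbor G := by
  have hd : Disjoint ((Finset.univ : Finset (Fin n × Fin n)).filter fun e =>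
      e.1 ≠ e.2 ∧ ∃ v, G.Adj e.1 v ∧ G.Adj e.2 v)
      ((Finset.univ : Finset (Fin n × Fin n)).filter fun e =>
      e.1 ≠ e.2 ∧ ¬ ∃ v, G.Adj e.1 v ∧ G.Adj e.2 v) := by
    rw [Finset.disjoint_filter]
    rintro e _ ⟨_, h1⟩ ⟨_, h2⟩
    exact h2 h1
  have h1 := Finset.card_le_univ (Finset.disjUnion _ _ hd)
  rw [Finset.card_disjUnion, Fintype.card_prod, Fintype.card_fin] at h1
  have h2 : ((((Finset.univ : Finset (Fin n × Fin n)).filter fun e =>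
      e.1 ≠ e.2 ∧ ∃ v, G.Adj e.1 v ∧ G.Adj e.2 v).card : ℕ) : ℝ)
      + (pairsWithoutCommonNeighbor G : ℝ) ≤ (n : ℝ) * n := by
    unfold pairsWithoutCommonNeighbor
    exact_mod_cast h1
  linarith

section Law

variable {n : ℕ} {Ω : Type*} [MeasurableSpace Ω] {μ : Measure Ω} {G : SimpleGraph (Fin n)}
  {p α β : ℝ} {Z : Ω → Finset (Fin n)} {H : Ω → SimpleGraph (Fin n)}

theorem integral_sub_mul_sub [IsProbabilityMeasure μ] {X Y : Ω → ℝ} (hX : Integrable X μ)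
    (hY : Integrable Y μ) (hXY : Integrable (fun ω => X ω * Y ω) μ) (a b : ℝ) :
    ∫ ω, (X ω - a) * (Y ω - b) ∂μ
      = ∫ ω, X ω * Y ω ∂μ - b * ∫ ω, X ω ∂μ - a * ∫ ω, Y ω ∂μ + a * b := by
  have e : ∀ ω, (X ω - a) * (Y ω - b) = X ω * Y ω - b * X ω - a * Y ω + a * b := by
    intro ω; ring
  have h1 : Integrable (fun ω => X ω * Y ω - b * X ω) μ := hXY.sub (hX.const_mul b)
  have h2 : Integrable (fun ω => X ω * Y ω - b * X ω - a * Y ω) μ := h1.sub (hY.const_mul a)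
  simp_rw [e]
  rw [integral_add h2 (integrable_const _), integral_sub h1 (hY.const_mul a),
    integral_sub hXY (hX.const_mul b), integral_const_mul, integral_const_mul]
  simp

namespace IsNoisyExperiment

open scoped Classical in
/-- A weighted sum of centred isolation indicators over vertices of degree at most `D` has small
variance: covariances are bounded by `abs_cov_isoInd_le`, except for the pairs that are equal,
adjacent, or have a common neighbour. -/
theorem integral_sq_sum_isoInd_le (h : IsNoisyExperiment μ G p α β Z H) (τ s t : Bool)
    (S : Finset (Fin n)) (a : Fin n → ℝ) {A D : ℝ} (hA : 0 ≤ A) (hD : 0 ≤ D)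
    (ha : ∀ i ∈ S, |a i| ≤ A) (hS : ∀ i ∈ S, (deg G i : ℝ) ≤ D) :
    ∫ ω, (∑ i ∈ S, a i * (isoInd G τ s t i (Z ω) (H ω)
        - ∫ ω', isoInd G τ s t i (Z ω') (H ω') ∂μ)) ^ 2 ∂μ
      ≤ A ^ 2 * (n * armProb p τ + armProb p τ ^ 2 *
        (2 * (n * D + ((n : ℝ) ^ 2 - pairsWithoutCommonNeighbor G))
          + (n : ℝ) ^ 2 * (α * (3 + 2 * (p * D) + n * p * α)))) := by
  have := h.isProbabilityMeasure
  have hπ := armProb_nonneg h.p_mem τ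
  have hπ1 := armProb_le_one h.p_mem τ
  set π := armProb p τ with hπdef
  set m : Fin n → ℝ := fun i => ∫ ω', isoInd G τ s t i (Z ω') (H ω') ∂μ with hm
  have hm0 : ∀ i, 0 ≤ m i := h.integral_isoInd_nonneg τ s t
  have hm1 : ∀ i, m i ≤ π := h.integral_isoInd_le τ s t
  set K : ℝ := α * (3 + 2 * (p * D) + n * p * α) with hK
  have hp := h.p_mem
  have hα := h.alpha_mem
  simp only [Set.mem_Icc] at hp hα
  have hK0 : 0 ≤ K := by
    have := hp.1; have := hα.1
    positivity
  set I : Fin n → Fin n → ℝ := fun i j =>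
    ∫ ω, isoInd G τ s t i (Z ω) (H ω) * isoInd G τ s t j (Z ω) (H ω) ∂μ with hI
  have hint : ∀ i, Integrable (fun ω => isoInd G τ s t i (Z ω) (H ω)) μ :=
    fun i => h.integrable_comp _
  have hint2 : ∀ i j, Integrable (fun ω => isoInd G τ s t i (Z ω) (H ω)
      * isoInd G τ s t j (Z ω) (H ω)) μ :=
    fun i j => h.integrable_comp fun T g => isoInd G τ s t i T g * isoInd G τ s t j T g
  have hexp : ∫ ω, (∑ i ∈ S, a i * (isoInd G τ s t i (Z ω) (H ω) - m i)) ^ 2 ∂μ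
      = ∑ i ∈ S, ∑ j ∈ S, a i * a j * (I i j - m i * m j) := by
    have e : ∀ ω, (∑ i ∈ S, a i * (isoInd G τ s t i (Z ω) (H ω) - m i)) ^ 2
        = ∑ i ∈ S, ∑ j ∈ S, a i * a j *
          ((isoInd G τ s t i (Z ω) (H ω) - m i) * (isoInd G τ s t j (Z ω) (H ω) - m j)) := by
      intro ω
      rw [sq, Finset.sum_mul_sum]
      exact Finset.sum_congr rfl fun i _ => Finset.sum_congr rfl fun j _ => by ring
    have hterm : ∀ i j, Integrable (fun ω =>
        (isoInd G τ s t i (Z ω) (H ω) - m i) * (isoInd G τ s t j (Z ω) (H ω) - m j)) μ :=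
      fun i j => h.integrable_comp fun T g =>
        (isoInd G τ s t i T g - m i) * (isoInd G τ s t j T g - m j)
    simp_rw [e]
    rw [integral_finsetSum _ fun i _ => integrable_finsetSum _ fun j _ => (hterm i j).const_mul _]
    refine Finset.sum_congr rfl fun i _ => ?_
    rw [integral_finsetSum _ fun j _ => (hterm i j).const_mul _]
    refine Finset.sum_congr rfl fun j _ => ?_
    rw [integral_const_mul, integral_sub_mul_sub (hint i) (hint j) (hint2 i j)]
    change a i * a j * (I i j - m j * m i - m i * m j + m i * m j) = _
    ring
  have hI0 : ∀ i j, 0 ≤ I i j := fun i j => integral_nonneg fun ω =>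
    mul_nonneg (isoInd_nonneg _ _ _ _ _ _ _) (isoInd_nonneg _ _ _ _ _ _ _)
  have hIle : ∀ i j, i ≠ j → I i j ≤ π ^ 2 := by
    intro i j hij
    rw [hπdef, ← h.integral_armInd_mul_armInd τ hij]
    refine integral_mono (hint2 i j) (h.integrable_comp fun T _ => armInd T i τ * armInd T j τ)
      fun ω => mul_le_mul (isoInd_le_armInd _ _ _ _ _ _ _) (isoInd_le_armInd _ _ _ _ _ _ _)
        (isoInd_nonneg _ _ _ _ _ _ _) (armInd_nonneg _ _ _)
  have hIdiag : ∀ i, I i i ≤ π := by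
    intro i
    rw [hπdef, ← h.integral_armInd τ i]
    refine integral_mono (hint2 i i) (h.integrable_comp fun T _ => armInd T i τ) fun ω => ?_
    have h1 := isoInd_le_armInd G τ s t i (Z ω) (H ω)
    have h2 := isoInd_nonneg G τ s t i (Z ω) (H ω)
    have h3 := armInd_le_one (Z ω) i τ
    exact (mul_le_of_le_one_left h2 (h1.trans h3)).trans h1
  have hcov : ∀ i ∈ S, ∀ j ∈ S, |I i j - m i * m j| ≤ (if i = j then π else 0)
      + π ^ 2 * (2 * ((if G.Adj i j then 1 else 0)
        + (if i ≠ j ∧ ∃ v, G.Adj i v ∧ G.Adj j v then 1 else 0)) + K) := by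
    intro i hi j hj
    have hmm0 : 0 ≤ m i * m j := mul_nonneg (hm0 i) (hm0 j)
    have hmm1 : m i * m j ≤ π ^ 2 := by
      rw [sq]; exact mul_le_mul (hm1 i) (hm1 j) (hm0 j) hπ
    have hπ2 : π ^ 2 ≤ π := by nlinarith
    have hrest : ∀ x : ℝ, 0 ≤ x → 0 ≤ π ^ 2 * (2 * x + K) := fun x hx => by positivity
    by_cases hij : i = j
    · subst hij
      have h1 := hrest ((if G.Adj i i then 1 else 0)
        + (if i ≠ i ∧ ∃ v, G.Adj i v ∧ G.Adj i v then 1 else 0)) (by split_ifs <;> norm_num)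
      simp only [if_true]
      refine le_trans ?_ (le_add_of_nonneg_right h1)
      rw [abs_le]
      constructor <;> linarith [hI0 i i, hIdiag i]
    · rw [if_neg hij, zero_add]
      by_cases hbad : G.Adj i j ∨ ∃ v, G.Adj i v ∧ G.Adj j v
      · have h1 : (1 : ℝ) ≤ (if G.Adj i j then 1 else 0)
            + (if i ≠ j ∧ ∃ v, G.Adj i v ∧ G.Adj j v then 1 else 0) := by
          rcases hbad with hb | hb
          · rw [if_pos hb]
            split_ifs <;> norm_num
          · rw [if_pos (c := i ≠ j ∧ _) ⟨hij, hb⟩]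
            split_ifs <;> norm_num
        have h2 : π ^ 2 * 1 ≤ π ^ 2 * (2 * ((if G.Adj i j then 1 else 0)
            + (if i ≠ j ∧ ∃ v, G.Adj i v ∧ G.Adj j v then 1 else 0)) + K) :=
          mul_le_mul_of_nonneg_left (by linarith) (sq_nonneg _)
        rw [abs_le]
        constructor <;> linarith [hI0 i j, hIle i j hij]
      · push Not at hbad
        have h1 := h.abs_cov_isoInd_le τ s t hij hbad.1 (by
          rintro ⟨v, hv1, hv2⟩; exact hbad.2 v hv1 hv2)
        refine h1.trans ?_
        refine mul_le_mul_of_nonneg_left ?_ (sq_nonneg _)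
        have h2 : α * (3 + p * (deg G i + deg G j) + n * p * α) ≤ K := by
          rw [hK]
          refine mul_le_mul_of_nonneg_left ?_ hα.1
          have h3 : p * ((deg G i : ℝ) + deg G j) ≤ p * (D + D) :=
            mul_le_mul_of_nonneg_left (add_le_add (hS i hi) (hS j hj)) hp.1
          linarith
        refine h2.trans (le_add_of_nonneg_left ?_)
        split_ifs <;> norm_num
  rw [hexp]
  have hterm : ∀ i ∈ S, ∀ j ∈ S, a i * a j * (I i j - m i * m j) ≤ A ^ 2 *
      ((if i = j then π else 0)
      + π ^ 2 * (2 * ((if G.Adj i j then 1 else 0)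
        + (if i ≠ j ∧ ∃ v, G.Adj i v ∧ G.Adj j v then 1 else 0)) + K)) := by
    intro i hi j hj
    refine (le_abs_self _).trans ?_
    rw [abs_mul, abs_mul, sq]
    exact mul_le_mul (mul_le_mul (ha i hi) (ha j hj) (abs_nonneg _) hA) (hcov i hi j hj)
      (abs_nonneg _) (mul_nonneg hA hA)
  refine (Finset.sum_le_sum fun i hi => Finset.sum_le_sum fun j hj => hterm i hi j hj).trans ?_
  simp_rw [← Finset.mul_sum]
  refine mul_le_mul_of_nonneg_left ?_ (sq_nonneg A)
  simp_rw [Finset.sum_add_distrib, ← Finset.mul_sum, Finset.sum_add_distrib, ← Finset.mul_sum,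
    Finset.sum_add_distrib]
  have hScard : (S.card : ℝ) ≤ n := by
    have := Finset.card_le_univ S
    rw [Fintype.card_fin] at this
    exact_mod_cast this
  have s1 : ∑ i ∈ S, ∑ j ∈ S, (if i = j then π else 0) ≤ n * π := by
    have : ∀ i ∈ S, ∑ j ∈ S, (if i = j then π else 0) = π := fun i hi => by simp [hi]
    rw [Finset.sum_congr rfl this, Finset.sum_const, nsmul_eq_mul]
    exact mul_le_mul_of_nonneg_right hScard hπ
  have s2 : ∑ i ∈ S, ∑ j ∈ S, (if G.Adj i j then (1 : ℝ) else 0) ≤ n * D := by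
    have : ∀ i ∈ S, ∑ j ∈ S, (if G.Adj i j then (1 : ℝ) else 0) ≤ D := by
      intro i hi
      refine le_trans ?_ (hS i hi)
      refine (Finset.sum_le_sum_of_subset_of_nonneg (Finset.subset_univ S)
        fun j _ _ => by split_ifs <;> norm_num).trans (le_of_eq ?_)
      simp [deg]
    refine (Finset.sum_le_sum this).trans ?_
    rw [Finset.sum_const, nsmul_eq_mul]
    exact mul_le_mul_of_nonneg_right hScard hD
  have s3 : ∑ i ∈ S, ∑ j ∈ S, (if i ≠ j ∧ ∃ v, G.Adj i v ∧ G.Adj j v then (1 : ℝ) else 0)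
      ≤ (n : ℝ) ^ 2 - pairsWithoutCommonNeighbor G := by
    refine le_trans ?_ (card_commonNeighbor_le G)
    rw [← Finset.sum_product']
    refine (Finset.sum_le_sum_of_subset_of_nonneg (Finset.subset_univ _)
        fun j _ _ => by split_ifs <;> norm_num).trans (le_of_eq ?_)
    simp
  have s4 : ∑ _i ∈ S, ∑ _j ∈ S, K ≤ (n : ℝ) ^ 2 * K := by
    simp only [Finset.sum_const, nsmul_eq_mul]
    rw [← mul_assoc, sq]
    exact mul_le_mul_of_nonneg_right (mul_le_mul hScard hScard (Nat.cast_nonneg _)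
      (Nat.cast_nonneg _)) hK0
  refine add_le_add s1 (mul_le_mul_of_nonneg_left ?_ (sq_nonneg π))
  linarith

/-- The fraction of vertices with treatment status `τ` concentrates. -/
theorem integral_sq_sum_armInd_le (h : IsNoisyExperiment μ G p α β Z H) (τ : Bool) :
    ∫ ω, (∑ i, (armInd (Z ω) i τ - armProb p τ)) ^ 2 ∂μ ≤ n * armProb p τ := by
  have := h.isProbabilityMeasure
  set π := armProb p τ with hπdef
  have hint : ∀ i, Integrable (fun ω => armInd (Z ω) i τ) μ :=
    fun i => h.integrable_comp fun T _ => armInd T i τ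
  have hint2 : ∀ i j, Integrable (fun ω => (armInd (Z ω) i τ - π) * (armInd (Z ω) j τ - π)) μ :=
    fun i j => h.integrable_comp fun T _ => (armInd T i τ - π) * (armInd T j τ - π)
  have e : ∀ ω, (∑ i, (armInd (Z ω) i τ - π)) ^ 2
      = ∑ i, ∑ j, (armInd (Z ω) i τ - π) * (armInd (Z ω) j τ - π) := by
    intro ω; rw [sq, Finset.sum_mul_sum]
  simp_rw [e]
  rw [integral_finsetSum _ fun i _ => integrable_finsetSum _ fun j _ => hint2 i j]
  have hterm : ∀ i j, ∫ ω, (armInd (Z ω) i τ - π) * (armInd (Z ω) j τ - π) ∂μ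
      ≤ if i = j then π else 0 := by
    intro i j
    have hij : Integrable (fun ω => armInd (Z ω) i τ * armInd (Z ω) j τ) μ :=
      h.integrable_comp fun T _ => armInd T i τ * armInd T j τ
    rw [integral_sub_mul_sub (hint i) (hint j) hij, h.integral_armInd, h.integral_armInd]
    rw [← hπdef]
    split_ifs with hh
    · subst hh
      simp_rw [armInd_mul_self]
      rw [h.integral_armInd, ← hπdef]
      nlinarith [sq_nonneg π]
    · rw [h.integral_armInd_mul_armInd τ hh, ← hπdef]
      nlinarith
  calc _ ≤ ∑ i : Fin n, ∑ j : Fin n, if i = j then π else 0 := by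
        refine Finset.sum_le_sum fun i _ => ?_
        rw [integral_finsetSum _ fun j _ => hint2 i j]
        exact Finset.sum_le_sum fun j _ => hterm i j
    _ = _ := by simp

end IsNoisyExperiment

/-! ### Concentration of the observed degrees -/

open scoped Classical in
theorem deg_eq_sum {n : ℕ} (g : SimpleGraph (Fin n)) (i : Fin n) :
    (deg g i : ℝ) = ∑ j ∈ {i}ᶜ, if g.Adj i j then 1 else 0 := by
  rw [deg, Finset.card_filter, Nat.cast_sum]
  symm
  refine (Finset.sum_subset (Finset.subset_univ _) ?_).trans ?_
  · intro j _ hj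
    have : j = i := by simpa using hj
    simp [this]
  · exact Finset.sum_congr rfl fun j _ => by split_ifs <;> simp

/-- The expectation of the observed degree of `i`. -/
noncomputable def meanDeg (G : SimpleGraph (Fin n)) (α β : ℝ) (i : Fin n) : ℝ :=
  ((n : ℝ) - 1 - deg G i) * α + deg G i * (1 - β)

theorem sum_edgeProb (G : SimpleGraph (Fin n)) (α β : ℝ) (i : Fin n) :
    ∑ j ∈ {i}ᶜ, edgeProb G α β i j = meanDeg G α β i := by
  classical
  have e : ∀ j, edgeProb G α β i j = α + (if G.Adj i j then 1 else 0) * (1 - β - α) := by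
    intro j; unfold edgeProb; split_ifs <;> ring
  simp_rw [e]
  rw [Finset.sum_add_distrib, ← Finset.sum_mul, ← deg_eq_sum, Finset.sum_const, nsmul_eq_mul,
    Finset.card_compl, Finset.card_singleton, Fintype.card_fin,
    Nat.cast_sub (Nat.succ_le_of_lt (Fin.pos i)), meanDeg]
  push_cast
  ring

namespace IsNoisyExperiment

theorem integral_sq_deg_sub_le (h : IsNoisyExperiment μ G p α β Z H) (i : Fin n) :
    ∫ ω, ((deg (H ω) i : ℝ) - meanDeg G α β i) ^ 2 ∂μ ≤ meanDeg G α β i := by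
  classical
  have := h.isProbabilityMeasure
  let W : Fin n → SimpleGraph (Fin n) → ℝ := fun j g => if ¬ g.Adj i j then 1 else 0
  set w : Fin n → ℝ := fun j => 1 - edgeProb G α β i j with hw
  have hwm : ∀ j, 0 ≤ w j ∧ w j ≤ 1 := by
    intro j
    have := h.edgeProb_mem i j
    simp only [Set.mem_Icc] at this
    constructor <;> simp only [hw] <;> linarith
  have hW1 : ∀ j ∈ ({i}ᶜ : Finset (Fin n)), ∫ ω, W j (H ω) ∂μ = w j := by
    intro j hj
    have hji : i ≠ j := by simpa [eq_comm] using hj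
    have := h.measureReal_noEdge {(i, j)} (by simpa using hji) (by
      simp only [Finset.mem_singleton, forall_eq, Prod.swap_prod_mk, Prod.mk.injEq, not_and]
      exact fun h1 => absurd h1.symm hji)
    simp only [Finset.mem_singleton, forall_eq, Finset.prod_singleton] at this
    exact (h.integral_graph_ite fun g => ¬ g.Adj i j).trans this
  have hW2 : ∀ j ∈ ({i}ᶜ : Finset (Fin n)), ∀ k ∈ ({i}ᶜ : Finset (Fin n)), j ≠ k →
      ∫ ω, W j (H ω) * W k (H ω) ∂μ = w j * w k := by
    intro j hj k hk hjk
    have hji : i ≠ j := by simpa [eq_comm] using hj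
    have hki : i ≠ k := by simpa [eq_comm] using hk
    have := h.measureReal_noEdge {(i, j), (i, k)} (by
      simp only [Finset.mem_insert, Finset.mem_singleton, forall_eq_or_imp, forall_eq]
      exact ⟨hji, hki⟩) (by
      simp only [Finset.mem_insert, Finset.mem_singleton, forall_eq_or_imp, forall_eq,
        Prod.swap_prod_mk, Prod.mk.injEq, not_or, not_and]
      exact ⟨⟨fun h1 => absurd h1.symm hji, fun h1 => absurd h1.symm hji⟩,
        ⟨fun h1 => absurd h1.symm hki, fun h1 => absurd h1.symm hki⟩⟩)
    rw [Finset.prod_pair (by simpa using hjk)] at this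
    simp only [Finset.mem_insert, Finset.mem_singleton, forall_eq_or_imp, forall_eq] at this
    change _ = (1 - edgeProb G α β i j) * (1 - edgeProb G α β i k)
    rw [← this, ← h.integral_graph_ite fun g => ¬ g.Adj i j ∧ ¬ g.Adj i k]
    refine integral_congr_ae (Eventually.of_forall fun ω => ?_)
    by_cases h1 : (H ω).Adj i j <;> by_cases h2 : (H ω).Adj i k <;> simp [W, h1, h2]
  have e : ∀ ω, ((deg (H ω) i : ℝ) - meanDeg G α β i) ^ 2
      = ∑ j ∈ {i}ᶜ, ∑ k ∈ {i}ᶜ, (W j (H ω) - w j) * (W k (H ω) - w k) := by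
    intro ω
    rw [deg_eq_sum, ← sum_edgeProb, ← Finset.sum_sub_distrib, ← Finset.sum_mul_sum, ← sq,
      ← neg_sq, ← Finset.sum_neg_distrib]
    congr 1
    refine Finset.sum_congr rfl fun j _ => ?_
    by_cases h1 : (H ω).Adj i j <;> simp [W, w, h1]
  have hint2 : ∀ j k, Integrable (fun ω => (W j (H ω) - w j) * (W k (H ω) - w k)) μ :=
    fun j k => h.integrable_comp fun _ g => (W j g - w j) * (W k g - w k)
  have hintW : ∀ j, Integrable (fun ω => W j (H ω)) μ := fun j => h.integrable_comp fun _ g => W j g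
  have hintWW : ∀ j k, Integrable (fun ω => W j (H ω) * W k (H ω)) μ :=
    fun j k => h.integrable_comp fun _ g => W j g * W k g
  simp_rw [e]
  rw [integral_finsetSum _ fun i _ => integrable_finsetSum _ fun j _ => hint2 i j, ← sum_edgeProb]
  refine Finset.sum_le_sum fun j hj => ?_
  rw [integral_finsetSum _ fun k _ => hint2 j k]
  have hterm : ∀ k ∈ ({i}ᶜ : Finset (Fin n)), ∫ ω, (W j (H ω) - w j) * (W k (H ω) - w k) ∂μ
      ≤ if j = k then edgeProb G α β i j else 0 := by
    intro k hk
    rw [integral_sub_mul_sub (hintW j) (hintW k) (hintWW j k), hW1 j hj, hW1 k hk]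
    split_ifs with hh
    · subst hh
      have e3 : ∀ ω, W j (H ω) * W j (H ω) = W j (H ω) := by
        intro ω; by_cases h1 : (H ω).Adj i j <;> simp [W, h1]
      simp_rw [e3]
      rw [hW1 j hj]
      have := hwm j
      have e4 : edgeProb G α β i j = 1 - w j := by simp [hw]
      rw [e4]
      nlinarith
    · rw [hW2 j hj k hk hh]
      linarith
  refine (Finset.sum_le_sum hterm).trans (le_of_eq ?_)
  rw [Finset.sum_ite_eq, if_pos hj]

theorem measureReal_deg_far_le (h : IsNoisyExperiment μ G p α β Z H) (i : Fin n) {t : ℝ}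
    (ht : 0 < t) :
    μ.real {ω | t ≤ |(deg (H ω) i : ℝ) - meanDeg G α β i|} ≤ meanDeg G α β i / t ^ 2 := by
  classical
  rw [← h.integral_graph_ite fun g => t ≤ |(deg g i : ℝ) - meanDeg G α β i|,
    le_div_iff₀ (by positivity),
    ← integral_mul_const]
  refine le_trans ?_ (h.integral_sq_deg_sub_le i)
  refine integral_mono
    (h.integrable_comp fun _ g => (if t ≤ |(deg g i : ℝ) - meanDeg G α β i| then 1 else 0) * t ^ 2)
    (h.integrable_comp fun _ g => ((deg g i : ℝ) - meanDeg G α β i) ^ 2) fun ω => ?_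
  dsimp only
  split_ifs with h1
  · rw [one_mul, ← sq_abs ((deg (H ω) i : ℝ) - _)]
    exact pow_le_pow_left₀ ht.le h1 2
  · rw [zero_mul]; positivity

end IsNoisyExperiment

end Law

/-! ### Exposure levels and the Aronow–Samii estimator -/

/-- Whether the exposure level is one of treated vertices. -/
def Exposure.treated : Exposure → Bool
  | .c11 | .c10 => true
  | .c01 | .c00 => false

/-- Whether the exposure level is one of vertices with a treated neighbour. -/
def Exposure.exposed : Exposure → Bool
  | .c11 | .c01 => true
  | .c10 | .c00 => false

/-- The exposure level with given treatment status `τ` and given presence `e` of treated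
neighbours. -/
def Exposure.ofBits : Bool → Bool → Exposure
  | true, true => .c11
  | true, false => .c10
  | false, true => .c01
  | false, false => .c00

theorem Exposure.ofBits_treated_exposed (c : Exposure) :
    Exposure.ofBits c.treated c.exposed = c := by cases c <;> rfl

theorem Exposure.ofBits_eq_iff (τ e : Bool) (c : Exposure) :
    Exposure.ofBits τ e = c ↔ τ = c.treated ∧ e = c.exposed := by
  cases τ <;> cases e <;> cases c <;> decide

theorem Exposure.sum_univ (f : Exposure → ℝ) :
    ∑ c, f c = f .c11 + f .c10 + f .c01 + f .c00 := by
  change ∑ c ∈ ({.c11, .c10, .c01, .c00} : Finset Exposure), f c = _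
  rw [Finset.sum_insert (by decide), Finset.sum_insert (by decide), Finset.sum_insert (by decide),
    Finset.sum_singleton]
  ring

open scoped Classical in
/-- Whether `i` has a treated neighbour in `g`. -/
noncomputable def exposedIn {n : ℕ} (T : Finset (Fin n)) (g : SimpleGraph (Fin n))
    (i : Fin n) : Bool := decide (¬ IsolatedIn T g i)

open scoped Classical in
theorem exposure_eq {n : ℕ} (T : Finset (Fin n)) (g : SimpleGraph (Fin n)) (i : Fin n) :
    exposure T g i = Exposure.ofBits (decide (i ∈ T)) (exposedIn T g i) := by
  have h : (∃ j ∈ T, g.Adj j i) ↔ ¬ IsolatedIn T g i := by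
    simp [IsolatedIn]
  unfold exposure exposedIn
  simp only [h]
  by_cases h1 : i ∈ T <;> by_cases h2 : IsolatedIn T g i <;> simp [h1, h2, Exposure.ofBits]

theorem armInd_eq {n : ℕ} (T : Finset (Fin n)) (i : Fin n) (τ : Bool) :
    armInd T i τ = if decide (i ∈ T) = τ then 1 else 0 := by
  unfold armInd
  by_cases h : i ∈ T <;> cases τ <;> simp [h]

theorem ite_exposure_eq {n : ℕ} (T : Finset (Fin n)) (g : SimpleGraph (Fin n)) (i : Fin n)
    (c : Exposure) : (if exposure T g i = c then (1 : ℝ) else 0)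
      = armInd T i c.treated * (if exposedIn T g i = c.exposed then 1 else 0) := by
  classical
  have h : exposure T g i = c ↔ decide (i ∈ T) = c.treated ∧ exposedIn T g i = c.exposed := by
    rw [exposure_eq, Exposure.ofBits_eq_iff]
  rw [armInd_eq, if_congr h rfl rfl]
  by_cases h1 : decide (i ∈ T) = c.treated <;> by_cases h2 : exposedIn T g i = c.exposed <;>
    simp [h1, h2]

/-- A vertex of `g` has status `τ` and no treated neighbour with probability
`armProb p τ * (1 - p) ^ deg`. -/
theorem sum_assignmentProb_isolated {n : ℕ} (p : ℝ) (g : SimpleGraph (Fin n)) (i : Fin n)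
    (τ : Bool) :
    ∑ T, assignmentProb p T * (armInd T i τ * (if exposedIn T g i = false then 1 else 0))
      = armProb p τ * (1 - p) ^ deg g i := by
  classical
  have e : ∀ T : Finset (Fin n), armInd T i τ * (if exposedIn T g i = false then 1 else 0)
      = ∏ k, if k ∈ T then (if k = i ∧ τ = false then 0 else 1) * (if g.Adj k i then 0 else 1)
          else (if k = i ∧ τ = true then 0 else 1) := by
    intro T
    have h1 := prod_armInd_eq {i} T τ
    simp only [Finset.prod_singleton, Finset.mem_singleton] at h1
    have h2 : (if exposedIn T g i = false then (1 : ℝ) else 0)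
        = ∏ k, if k ∈ T then (if g.Adj k i then 0 else 1) else 1 := by
      by_cases hiso : IsolatedIn T g i
      · rw [if_pos (by simp [exposedIn, hiso]), Finset.prod_eq_one]
        intro k _
        split_ifs with hk ha
        · exact absurd ha (hiso k hk)
        · rfl
        · rfl
      · rw [if_neg (by simp [exposedIn, hiso])]
        unfold IsolatedIn at hiso
        push Not at hiso
        obtain ⟨k, hk, ha⟩ := hiso
        exact (Finset.prod_eq_zero (Finset.mem_univ k) (by simp [hk, ha])).symm
    rw [h1, h2, ← Finset.prod_mul_distrib]
    refine Finset.prod_congr rfl fun k _ => ?_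
    split_ifs <;> simp
  simp_rw [e]
  rw [sum_assignmentProb_mul_prod]
  have h3 : ∀ k, p * ((if k = i ∧ τ = false then 0 else 1) * (if g.Adj k i then 0 else 1))
      + (1 - p) * (if k = i ∧ τ = true then 0 else 1)
      = (if k = i then armProb p τ else 1) * (if g.Adj i k then 1 - p else 1) := by
    intro k
    by_cases hk : k = i
    · subst hk
      cases τ <;> simp [armProb]
    · by_cases ha : g.Adj k i
      · simp [hk, ha, ha.symm]
      · have hb : ¬ g.Adj i k := fun hb => ha hb.symm
        simp [hk, ha, hb]
  rw [Finset.prod_congr rfl fun k _ => h3 k, Finset.prod_mul_distrib, Finset.prod_ite_eq']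
  simp [deg, Finset.prod_ite]

theorem exposureProb_eq {n : ℕ} (p : ℝ) (g : SimpleGraph (Fin n)) (i : Fin n) (c : Exposure) :
    exposureProb p g i c = armProb p c.treated *
      (if c.exposed = true then 1 - (1 - p) ^ deg g i else (1 - p) ^ deg g i) := by
  have h0 := sum_assignmentProb_isolated p g i c.treated
  have h1 : ∑ T : Finset (Fin n), assignmentProb p T * armInd T i c.treated
      = armProb p c.treated := by
    have := sum_assignmentProb_mul_prod_armInd p {i} c.treated
    simpa using this
  unfold exposureProb
  simp_rw [ite_exposure_eq]
  cases hc : c.exposed with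
  | false => simpa [hc] using h0
  | true =>
    simp only [if_true]
    have e : ∀ T : Finset (Fin n), assignmentProb p T *
        (armInd T i c.treated * (if exposedIn T g i = true then 1 else 0))
        = assignmentProb p T * armInd T i c.treated - assignmentProb p T *
        (armInd T i c.treated * (if exposedIn T g i = false then 1 else 0)) := by
      intro T
      cases exposedIn T g i <;> simp
    simp_rw [e]
    rw [Finset.sum_sub_distrib, h0, h1]
    ring

theorem nodeAS_eq_ite {n : ℕ} (G g : SimpleGraph (Fin n)) (y : Fin n → Exposure → ℝ)
    (T : Finset (Fin n)) (p : ℝ) (i : Fin n) (c : Exposure) :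
    nodeAS G g y T p i c = (if 0 < exposureProb p g i c then 1 else 0) *
      ((if exposure T g i = c then 1 else 0) * (1 / exposureProb p g i c) *
      y i (exposure T G i)) := rfl

/-- With the graph fixed, the inverse probability weights have total mass at most one. -/
theorem sum_assignmentProb_abs_nodeAS_le {n : ℕ} (G g : SimpleGraph (Fin n))
    (y : Fin n → Exposure → ℝ) {p M : ℝ} (hp : p ∈ Set.Icc (0 : ℝ) 1) (hM : 0 ≤ M)
    (hy : ∀ i c, |y i c| ≤ M) (i : Fin n) (c : Exposure) :
    ∑ T, assignmentProb p T * |nodeAS G g y T p i c| ≤ M := by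
  by_cases h0 : 0 < exposureProb p g i c
  · have e : ∀ T : Finset (Fin n), assignmentProb p T * |nodeAS G g y T p i c|
        ≤ assignmentProb p T * (if exposure T g i = c then 1 else 0) *
          (M / exposureProb p g i c) := by
      intro T
      rw [nodeAS_eq_ite, if_pos h0, one_mul,
        mul_assoc (assignmentProb p T) _ (M / exposureProb p g i c)]
      refine mul_le_mul_of_nonneg_left ?_ (assignmentProb_nonneg hp T)
      split_ifs
      · rw [one_mul, one_mul, abs_mul, abs_of_pos (by positivity), div_mul_eq_mul_div, one_mul]
        gcongr
        exact hy _ _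
      · simp
    refine (Finset.sum_le_sum fun T _ => e T).trans ?_
    rw [← Finset.sum_mul]
    change exposureProb p g i c * (M / exposureProb p g i c) ≤ M
    rw [mul_div_cancel₀ _ h0.ne']
  · simp [nodeAS_eq_ite, h0, hM]

/-- A vertex whose exposure probability is at least `κ` times that of its treatment status has an
Aronow–Samii weight of the order of the inverse treatment probability. -/
theorem abs_nodeAS_le {n : ℕ} (G g : SimpleGraph (Fin n))
    (y : Fin n → Exposure → ℝ) {p M κ : ℝ} (hκ : 0 < κ)
    (hy : ∀ i c, |y i c| ≤ M) (T : Finset (Fin n)) (i : Fin n) (c : Exposure)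
    (hπ : 0 < armProb p c.treated)
    (he : armProb p c.treated * κ ≤ exposureProb p g i c) :
    |nodeAS G g y T p i c| ≤ M / κ * (armInd T i c.treated / armProb p c.treated) := by
  have h0 : 0 < exposureProb p g i c := lt_of_lt_of_le (by positivity) he
  rw [nodeAS_eq_ite, if_pos h0, one_mul, ite_exposure_eq, abs_mul, abs_mul, abs_mul,
    abs_of_nonneg (armInd_nonneg _ _ _), abs_of_pos (show 0 < 1 / exposureProb p g i c by positivity)]
  have h1 : |if exposedIn T g i = c.exposed then (1 : ℝ) else 0| ≤ 1 := by split_ifs <;> simp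
  have h2 : 1 / exposureProb p g i c ≤ 1 / (armProb p c.treated * κ) :=
    one_div_le_one_div_of_le (by positivity) he
  have ha := armInd_nonneg T i c.treated
  calc _ ≤ armInd T i c.treated * 1 * (1 / (armProb p c.treated * κ)) * M := by
        gcongr
        exact hy _ _
    _ = _ := by field_simp

/-! ### The inverse of the confusion matrix -/

/-- The probability of having no treated neighbour in the true graph, at degree `d`. -/
noncomputable def trueIso (p d : ℝ) : ℝ := (1 - p) ^ d

/-- The probability of having no treated neighbour in the observed graph, at degree `d`. -/
noncomputable def obsIso (n : ℕ) (p d α β : ℝ) : ℝ :=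
  (1 - α * p) ^ ((n : ℝ) - 1 - d) * (1 - (1 - β) * p) ^ d

/-- The probability of having no treated neighbour in either graph, at degree `d`. -/
noncomputable def bothIso (n : ℕ) (p d α : ℝ) : ℝ :=
  (1 - p) ^ d * (1 - α * p) ^ ((n : ℝ) - 1 - d)

/-- The entries of the adjugate of the `2 × 2` block `B` of the confusion matrix, in terms of
`u`, `v`, `w`. The index `e` stands for the presence of a treated neighbour in the true graph, `o`
for that in the observed graph. -/
noncomputable def adjCoef (e o : Bool) (u v w : ℝ) : ℝ :=
  match e, o with
  | true, true => w
  | true, false => w - u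
  | false, true => w - v
  | false, false => 1 - u - v + w

/-- The entries of the inverse of the block `B`, whose determinant is `w - u * v`. -/
noncomputable def invCoef (e o : Bool) (u v w : ℝ) : ℝ := adjCoef e o u v w / (w - u * v)

theorem confusion_inv {n : ℕ} {p d α β : ℝ} (hp0 : p ≠ 0) (hp1 : 1 - p ≠ 0)
    (hD : bothIso n p d α - trueIso p d * obsIso n p d α β ≠ 0) :
    (confusion n p d α β)⁻¹ = Matrix.of fun c o : Exposure =>
      if c.treated = o.treated then
        invCoef c.exposed o.exposed (trueIso p d) (obsIso n p d α β) (bothIso n p d α)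
          / armProb p c.treated
      else 0 := by
  apply Matrix.inv_eq_left_inv
  set u := trueIso p d with hu
  set v := obsIso n p d α β with hv
  set w := bothIso n p d α with hw
  have hconf : ∀ o t, confusion n p d α β o t =
      if o.treated = t.treated then armProb p t.treated * (match o.exposed, t.exposed with
        | true, true => 1 - u - v + w
        | true, false => u - w
        | false, true => v - w
        | false, false => w) else 0 := by
    intro o t
    cases o <;> cases t <;> rfl
  clear_value u v w
  obtain ⟨D, hDe⟩ : ∃ D, w = D + u * v := ⟨w - u * v, by ring⟩
  have hD0 : D ≠ 0 := by rwa [hDe, add_sub_cancel_right] at hD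
  ext c t
  rw [Matrix.mul_apply, Exposure.sum_univ]
  simp only [hconf, Matrix.of_apply, invCoef, hDe, add_sub_cancel_right]
  cases c <;> cases t <;>
    simp [Exposure.treated, Exposure.exposed, adjCoef, armProb] <;> field_simp <;> ring

/-- The method-of-moments estimator of a vertex, written with the treatment indicator and the entry
of the inverse block that its two exposures select. -/
theorem nodeMME_eq {n : ℕ} (G g : SimpleGraph (Fin n)) (y : Fin n → Exposure → ℝ)
    (T : Finset (Fin n)) {p a b : ℝ} (i : Fin n) (c : Exposure) (hp0 : p ≠ 0) (hp1 : 1 - p ≠ 0)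
    (d : ℝ) (hd : degreeEst g a b i = d)
    (hD : bothIso n p d a - trueIso p d * obsIso n p d a b ≠ 0) :
    nodeMME G g y T p a b i c = armInd T i c.treated / armProb p c.treated *
      (invCoef c.exposed (exposedIn T g i) (trueIso p d) (obsIso n p d a b) (bothIso n p d a)
        * y i (Exposure.ofBits c.treated (exposedIn T G i))) := by
  classical
  rw [nodeMME, hd, confusion_inv hp0 hp1 hD, Matrix.mulVec, dotProduct, Exposure.sum_univ]
  simp only [observedVector, observedOutcome, ite_exposure_eq, Matrix.of_apply]
  rw [exposure_eq T G]
  simp only [armInd_eq]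
  cases hT : decide (i ∈ T) <;> cases he : exposedIn T g i <;> cases c <;>
    simp [Exposure.treated, Exposure.exposed] <;> ring

/-- The coefficients of the expansion of a function of two bits in the products of the complemented
bits. -/
def isoCoef (F : Bool → Bool → ℝ) (s t : Bool) : ℝ :=
  match s, t with
  | false, false => F true true
  | true, false => F false true - F true true
  | false, true => F true false - F true true
  | true, true => F false false - F false true - F true false + F true true

theorem abs_isoCoef_le {F : Bool → Bool → ℝ} {A : ℝ} (hF : ∀ e o, |F e o| ≤ A) (s t : Bool) :
    |isoCoef F s t| ≤ 4 * A := by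
  have h1 := abs_le.1 (hF true true)
  have h2 := abs_le.1 (hF true false)
  have h3 := abs_le.1 (hF false true)
  have h4 := abs_le.1 (hF false false)
  rw [abs_le]
  cases s <;> cases t <;> simp only [isoCoef] <;> constructor <;> linarith

/-- A function of the treatment status and the two exposures of `i` is a combination of the four
indicators `isoInd`. -/
theorem armInd_mul_eq_sum {n : ℕ} (G g : SimpleGraph (Fin n)) (T : Finset (Fin n)) (i : Fin n)
    (τ : Bool) (F : Bool → Bool → ℝ) :
    armInd T i τ * F (exposedIn T G i) (exposedIn T g i)
      = ∑ s, ∑ t, isoCoef F s t * isoInd G τ s t i T g := by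
  classical
  simp only [Fintype.sum_bool, isoInd, isoCoef, exposedIn]
  by_cases h1 : IsolatedIn T G i <;> by_cases h2 : IsolatedIn T g i <;>
    simp [h1, h2] <;> ring

section Law

variable {n : ℕ} {Ω : Type*} [MeasurableSpace Ω] {μ : Measure Ω} {G : SimpleGraph (Fin n)}
  {p α β : ℝ} {Z : Ω → Finset (Fin n)} {H : Ω → SimpleGraph (Fin n)}

open scoped Classical in
theorem prod_compl_singleton_ite (G : SimpleGraph (Fin n)) (i : Fin n) (x z : ℝ) :
    ∏ k ∈ {i}ᶜ, (if G.Adj k i then x else z) = x ^ deg G i * z ^ (n - 1 - deg G i) := by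
  rw [Finset.prod_ite, Finset.prod_const, Finset.prod_const]
  have h1 : (({i}ᶜ : Finset (Fin n)).filter fun k => G.Adj k i).card = deg G i := by
    unfold deg
    congr 1
    ext k
    simp only [Finset.mem_filter, Finset.mem_compl, Finset.mem_singleton, Finset.mem_univ,
      true_and, G.adj_comm k i]
    exact ⟨fun h => h.2, fun h => ⟨h.ne', h⟩⟩
  have h2 := Finset.card_filter_add_card_filter_not (s := ({i}ᶜ : Finset (Fin n)))
    (fun k => G.Adj k i)
  rw [h1, Finset.card_compl, Finset.card_singleton, Fintype.card_fin] at h2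
  rw [h1]
  congr 2
  omega

theorem deg_le (G : SimpleGraph (Fin n)) (i : Fin n) : deg G i + 1 ≤ n := by
  classical
  have h : (Finset.univ.filter fun j => G.Adj i j) ⊆ {i}ᶜ := by
    intro j hj
    simp only [Finset.mem_filter, Finset.mem_univ, true_and] at hj
    simpa using hj.ne'
  have h1 := Finset.card_le_card h
  rw [Finset.card_compl, Finset.card_singleton, Fintype.card_fin] at h1
  have h2 : 0 < n := Fin.pos i
  unfold deg
  omega

theorem pow_sub_deg_eq_rpow (G : SimpleGraph (Fin n)) (i : Fin n) (x : ℝ) :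
    x ^ (n - 1 - deg G i) = x ^ ((n : ℝ) - 1 - (deg G i : ℝ)) := by
  have h1 := deg_le G i
  rw [← Real.rpow_natCast, Nat.cast_sub (by omega), Nat.cast_sub (by omega)]
  simp

namespace IsNoisyExperiment

/-- Up to the factor `armProb p τ`, the expectations of the four indicators `isoInd` are `1` and the
quantities `u`, `v`, `w` of which the confusion matrix consists. -/
theorem integral_isoInd_eq (h : IsNoisyExperiment μ G p α β Z H) (τ s t : Bool) (i : Fin n) :
    ∫ ω, isoInd G τ s t i (Z ω) (H ω) ∂μ = armProb p τ *
      (match s, t with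
      | false, false => 1
      | true, false => trueIso p (deg G i)
      | false, true => obsIso n p (deg G i) α β
      | true, true => bothIso n p (deg G i) α) := by
  classical
  rw [h.integral_isoInd]
  congr 1
  have key : ∀ x z : ℝ, (∀ k, 1 - p + p * keepProb G α β s t k i = if G.Adj k i then x else z) →
      ∏ k ∈ {i}ᶜ, (1 - p + p * keepProb G α β s t k i)
        = x ^ (deg G i : ℝ) * z ^ ((n : ℝ) - 1 - (deg G i : ℝ)) := by
    intro x z hxz
    rw [Finset.prod_congr rfl fun k _ => hxz k, prod_compl_singleton_ite, pow_sub_deg_eq_rpow,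
      Real.rpow_natCast]
  cases s <;> cases t
  · rw [key 1 1 (fun k => by simp [keepProb])]
    simp
  · rw [key (1 - (1 - β) * p) (1 - α * p) (fun k => by
      simp only [keepProb, edgeProb]; split_ifs <;> simp_all <;> ring)]
    rw [obsIso, mul_comm]
  · rw [key (1 - p) 1 (fun k => by simp only [keepProb]; split_ifs <;> simp_all)]
    simp [trueIso]
  · rw [key (1 - p) (1 - α * p) (fun k => by
      simp only [keepProb, edgeProb]; split_ifs <;> simp_all <;> ring)]
    rfl

/-- Applying the inverse confusion matrix at the true degree and error rates to the observed
outcome produces an unbiased estimator of the potential outcome: its error is a combination of centred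
isolation indicators. -/
theorem nodeMME_sub_eq (h : IsNoisyExperiment μ G p α β Z H) (y : Fin n → Exposure → ℝ)
    (i : Fin n) (c : Exposure) (hπ : armProb p c.treated ≠ 0)
    (hD : bothIso n p (deg G i) α - trueIso p (deg G i) * obsIso n p (deg G i) α β ≠ 0)
    (F : Bool → Bool → ℝ)
    (hF : F = fun e o => invCoef c.exposed o (trueIso p (deg G i)) (obsIso n p (deg G i) α β)
      (bothIso n p (deg G i) α) * y i (Exposure.ofBits c.treated e))
    (T : Finset (Fin n)) (g : SimpleGraph (Fin n)) :
    armInd T i c.treated / armProb p c.treated * F (exposedIn T G i) (exposedIn T g i) - y i c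
      = ∑ s, ∑ t, isoCoef F s t / armProb p c.treated * (isoInd G c.treated s t i T g
          - ∫ ω, isoInd G c.treated s t i (Z ω) (H ω) ∂μ) := by
  rw [div_mul_eq_mul_div, armInd_mul_eq_sum]
  simp only [h.integral_isoInd_eq]
  set u := trueIso p (deg G i)
  set v := obsIso n p (deg G i) α β
  set w := bothIso n p (deg G i) α
  set π := armProb p c.treated
  have hy : y i c = F true true + isoCoef F true false * u + isoCoef F false true * v
      + isoCoef F true true * w := by
    conv_lhs => rw [← Exposure.ofBits_treated_exposed c]
    clear_value u v w
    obtain ⟨D, hDe⟩ : ∃ D, w = D + u * v := ⟨w - u * v, by ring⟩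
    have hD0 : D ≠ 0 := by rwa [hDe, add_sub_cancel_right] at hD
    simp only [isoCoef, hF]
    cases c.exposed <;> simp only [invCoef, adjCoef, hDe, add_sub_cancel_right] <;> field_simp <;> ring
  rw [hy]
  simp only [Fintype.sum_bool]
  field_simp
  simp only [isoCoef]
  ring

/-- The Aronow–Samii estimator is bounded in mean under any weight `b` that depends on the observed
graph only, however small the exposure probabilities are. -/
theorem integral_mul_abs_nodeAS_le (h : IsNoisyExperiment μ G p α β Z H)
    (y : Fin n → Exposure → ℝ) {M : ℝ} (hM : 0 ≤ M)
    (hy : ∀ i c, |y i c| ≤ M) (i : Fin n) (c : Exposure) (b : SimpleGraph (Fin n) → ℝ)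
    (hb : ∀ g, 0 ≤ b g) :
    ∫ ω, b (H ω) * |nodeAS G (H ω) y (Z ω) p i c| ∂μ ≤ M * ∫ ω, b (H ω) ∂μ := by
  rw [h.integral_eq_sum fun T g => b g * |nodeAS G g y T p i c|]
  have hint : ∀ T : Finset (Fin n), Integrable (fun ω => b (H ω) * |nodeAS G (H ω) y T p i c|) μ :=
    fun T => h.integrable_comp fun _ g => b g * |nodeAS G g y T p i c|
  simp_rw [← integral_const_mul]
  rw [← integral_finsetSum _ fun T _ => (hint T).const_mul _]
  refine integral_mono (integrable_finsetSum _ fun T _ => (hint T).const_mul _)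
    (h.integrable_comp fun _ g => M * b g) fun ω => ?_
  have := sum_assignmentProb_abs_nodeAS_le G (H ω) y h.p_mem hM hy i c
  calc ∑ T, assignmentProb p T * (b (H ω) * |nodeAS G (H ω) y T p i c|)
      = b (H ω) * ∑ T, assignmentProb p T * |nodeAS G (H ω) y T p i c| := by
        rw [Finset.mul_sum]
        exact Finset.sum_congr rfl fun T _ => by ring
    _ ≤ b (H ω) * M := mul_le_mul_of_nonneg_left this (hb _)
    _ = M * b (H ω) := mul_comm _ _

end IsNoisyExperiment

end Law

/-! ### Conditioning of the confusion matrix -/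

theorem log_one_sub_mem {x : ℝ} (h0 : 0 ≤ x) (h1 : x ≤ 1 / 2) :
    -(2 * x) ≤ Real.log (1 - x) ∧ Real.log (1 - x) ≤ -x := by
  constructor
  · refine le_trans ?_ (Real.one_sub_inv_le_log_of_pos (by linarith))
    rw [inv_eq_one_div, le_sub_comm, div_le_iff₀ (by linarith)]
    nlinarith
  · have := Real.log_le_sub_one_of_pos (show (0 : ℝ) < 1 - x by linarith)
    linarith

theorem abs_log_one_sub_le {x : ℝ} (h0 : 0 ≤ x) (h1 : x ≤ 1 / 2) :
    |Real.log (1 - x)| ≤ 2 * x := by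
  have := log_one_sub_mem h0 h1
  rw [abs_le]
  constructor <;> linarith

theorem log_one_sub_sub_le {x z : ℝ} (hx : x ≤ 1 / 2) (hz : z ≤ 1 / 2) :
    Real.log (1 - x) - Real.log (1 - z) ≤ 2 * |x - z| := by
  have hx' : 0 < 1 - x := by linarith
  have hz' : 0 < 1 - z := by linarith
  rw [← Real.log_div hx'.ne' hz'.ne']
  refine (Real.log_le_sub_one_of_pos (div_pos hx' hz')).trans ?_
  rw [div_sub_one hz'.ne', div_le_iff₀ hz']
  have h1 := neg_abs_le (x - z)
  have h2 := abs_nonneg (x - z)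
  nlinarith

theorem abs_log_one_sub_sub_le {x z : ℝ} (hx : x ≤ 1 / 2) (hz : z ≤ 1 / 2) :
    |Real.log (1 - x) - Real.log (1 - z)| ≤ 2 * |x - z| := by
  rw [abs_le]
  have h1 := log_one_sub_sub_le hx hz
  have h2 := log_one_sub_sub_le hz hx
  rw [abs_sub_comm] at h2
  constructor <;> linarith

theorem abs_exp_sub_exp_le {a b : ℝ} (ha : a ≤ 0) (hb : b ≤ 0) :
    |Real.exp a - Real.exp b| ≤ |a - b| := by
  have key : ∀ a b : ℝ, a ≤ 0 → b ≤ a → |Real.exp a - Real.exp b| ≤ |a - b| := by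
    intro a b ha hba
    rw [abs_of_nonneg (sub_nonneg.2 (Real.exp_le_exp.2 hba)), abs_of_nonneg (sub_nonneg.2 hba)]
    have h1 : Real.exp b = Real.exp a * Real.exp (b - a) := by rw [← Real.exp_add]; ring_nf
    have h2 := Real.add_one_le_exp (b - a)
    have h3 := Real.exp_le_one_iff.2 ha
    have h4 := Real.exp_pos a
    rw [h1]
    nlinarith
  rcases le_total b a with h | h
  · exact key a b ha h
  · rw [abs_sub_comm, abs_sub_comm a b]; exact key b a hb h

/-- The range of degrees and error rates over which the confusion matrix is uniformly well
conditioned: `p * d` lies in a compact subset of `(0, ∞)`, `n * α * p` is bounded, and `1 - β` is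
bounded away from `0`. -/
structure RatesInRange (n : ℕ) (p lo hi η d α β : ℝ) : Prop where
  p_pos : 0 < p
  p_le : p ≤ 1 / 4
  lo_pos : 0 < lo
  eta_pos : 0 < η
  lo_le : lo ≤ p * d
  le_hi : p * d ≤ hi
  d_le : d ≤ n - 1
  alpha_nonneg : 0 ≤ α
  alpha_le : α ≤ 1
  nap_le : n * α * p ≤ hi
  eta_le : η ≤ 1 - β
  beta_le : 1 - β ≤ 2

/-- A lower bound of the determinant of the block `B` over `RatesInRange`. -/
noncomputable def detBound (lo hi η : ℝ) : ℝ :=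
  Real.exp (-(2 * hi)) * Real.exp (-(2 * hi)) * (1 - Real.exp (-(η * lo)))

theorem detBound_pos {lo hi η : ℝ} (h1 : 0 < lo) (h2 : 0 < η) : 0 < detBound lo hi η := by
  have : Real.exp (-(η * lo)) < 1 := by
    rw [← Real.exp_zero, Real.exp_lt_exp]; nlinarith
  unfold detBound
  have := sub_pos.2 this
  positivity

namespace RatesInRange

variable {n : ℕ} {p lo hi η d α β d' α' β' : ℝ}

theorem d_pos (h : RatesInRange n p lo hi η d α β) : 0 < d :=
  pos_of_mul_pos_right (h.lo_pos.trans_le h.lo_le) h.p_pos.le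

theorem hi_pos (h : RatesInRange n p lo hi η d α β) : 0 < hi :=
  h.lo_pos.trans_le (h.lo_le.trans h.le_hi)

theorem alpha_mul_le (h : RatesInRange n p lo hi η d α β) : α * p ≤ 1 / 4 := by
  have := mul_le_mul h.alpha_le h.p_le h.p_pos.le zero_le_one
  linarith

theorem beta_mul_le (h : RatesInRange n p lo hi η d α β) : (1 - β) * p ≤ 1 / 2 := by
  have := mul_le_mul h.beta_le h.p_le h.p_pos.le zero_le_two
  linarith

theorem beta_mul_nonneg (h : RatesInRange n p lo hi η d α β) : 0 ≤ (1 - β) * p :=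
  mul_nonneg (h.eta_pos.le.trans h.eta_le) h.p_pos.le

theorem trueIso_eq (h : RatesInRange n p lo hi η d α β) :
    trueIso p d = Real.exp (Real.log (1 - p) * d) :=
  Real.rpow_def_of_pos (by linarith [h.p_le]) _

theorem obsIso_eq (h : RatesInRange n p lo hi η d α β) :
    obsIso n p d α β = Real.exp (Real.log (1 - α * p) * (n - 1 - d)
      + Real.log (1 - (1 - β) * p) * d) := by
  rw [obsIso, Real.exp_add, Real.rpow_def_of_pos (by linarith [h.alpha_mul_le]),
    Real.rpow_def_of_pos (by linarith [h.beta_mul_le])]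

theorem bothIso_eq (h : RatesInRange n p lo hi η d α β) :
    bothIso n p d α = Real.exp (Real.log (1 - p) * d + Real.log (1 - α * p) * (n - 1 - d)) := by
  rw [bothIso, Real.exp_add, Real.rpow_def_of_pos (by linarith [h.p_le]),
    Real.rpow_def_of_pos (by linarith [h.alpha_mul_le])]

theorem exponents_nonpos (h : RatesInRange n p lo hi η d α β) :
    Real.log (1 - p) * d ≤ 0 ∧ Real.log (1 - α * p) * (n - 1 - d) ≤ 0 ∧
      Real.log (1 - (1 - β) * p) * d ≤ 0 := by
  have hp := h.p_pos
  have hα := mul_nonneg h.alpha_nonneg hp.le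
  have hβ := h.beta_mul_nonneg
  refine ⟨?_, ?_, ?_⟩
  · exact mul_nonpos_of_nonpos_of_nonneg
      (by linarith [(log_one_sub_mem hp.le (by linarith [h.p_le])).2]) h.d_pos.le
  · exact mul_nonpos_of_nonpos_of_nonneg
      (by linarith [(log_one_sub_mem hα (by linarith [h.alpha_mul_le])).2]) (by linarith [h.d_le])
  · exact mul_nonpos_of_nonpos_of_nonneg
      (by linarith [(log_one_sub_mem hβ (by linarith [h.beta_mul_le])).2]) h.d_pos.le

theorem trueIso_mem (h : RatesInRange n p lo hi η d α β) : trueIso p d ∈ Set.Icc (0 : ℝ) 1 := by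
  rw [h.trueIso_eq]
  exact ⟨(Real.exp_pos _).le, Real.exp_le_one_iff.2 h.exponents_nonpos.1⟩

theorem obsIso_mem (h : RatesInRange n p lo hi η d α β) :
    obsIso n p d α β ∈ Set.Icc (0 : ℝ) 1 := by
  rw [h.obsIso_eq]
  exact ⟨(Real.exp_pos _).le, Real.exp_le_one_iff.2
    (add_nonpos h.exponents_nonpos.2.1 h.exponents_nonpos.2.2)⟩

theorem bothIso_mem (h : RatesInRange n p lo hi η d α β) :
    bothIso n p d α ∈ Set.Icc (0 : ℝ) 1 := by
  rw [h.bothIso_eq]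
  exact ⟨(Real.exp_pos _).le, Real.exp_le_one_iff.2
    (add_nonpos h.exponents_nonpos.1 h.exponents_nonpos.2.1)⟩

/-- The determinant is `w - u * v = w * (1 - (1 - (1 - β) * p) ^ d)`, and both factors are bounded
away from `0`. -/
theorem detBound_le (h : RatesInRange n p lo hi η d α β) :
    detBound lo hi η ≤ bothIso n p d α - trueIso p d * obsIso n p d α β := by
  have hp := h.p_pos
  have hα := mul_nonneg h.alpha_nonneg hp.le
  have hd := h.d_pos
  have hβ := h.beta_mul_nonneg
  have l1 := log_one_sub_mem hp.le (by linarith [h.p_le])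
  have l2 := log_one_sub_mem hα (by linarith [h.alpha_mul_le])
  have l3 := log_one_sub_mem hβ (by linarith [h.beta_mul_le])
  rw [h.trueIso_eq, h.obsIso_eq, h.bothIso_eq, Real.exp_add, Real.exp_add, ← mul_assoc,
    ← mul_one_sub, detBound]
  have hr : 0 ≤ (n : ℝ) - 1 - d := by linarith [h.d_le]
  refine mul_le_mul (mul_le_mul ?_ ?_ (Real.exp_pos _).le (Real.exp_pos _).le) ?_ ?_ (by positivity)
  · rw [Real.exp_le_exp]
    have := h.le_hi
    nlinarith
  · rw [Real.exp_le_exp]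
    have h1 := h.nap_le
    have h2 : -(2 * (α * p)) * (n - 1 - d) ≤ Real.log (1 - α * p) * (n - 1 - d) :=
      mul_le_mul_of_nonneg_right l2.1 hr
    nlinarith
  · refine sub_le_sub_left (Real.exp_le_exp.2 ?_) _
    have h1 : Real.log (1 - (1 - β) * p) * d ≤ -((1 - β) * p) * d :=
      mul_le_mul_of_nonneg_right l3.2 hd.le
    have h2 : η * lo ≤ (1 - β) * (p * d) :=
      mul_le_mul h.eta_le h.lo_le h.lo_pos.le (h.eta_pos.le.trans h.eta_le)
    linarith
  · rw [sub_nonneg, Real.exp_le_one_iff]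
    nlinarith [h.lo_pos, h.eta_pos]

theorem det_ne_zero (h : RatesInRange n p lo hi η d α β) :
    bothIso n p d α - trueIso p d * obsIso n p d α β ≠ 0 :=
  ((detBound_pos h.lo_pos h.eta_pos).trans_le h.detBound_le).ne'

/-- The logarithms of `u`, `v`, `w` are Lipschitz on the scales `1 / p` of `d`, `1 / (n * p)` of `α`
and `1` of `β`, and so are `u`, `v`, `w`, since the logarithms are nonpositive. -/
theorem abs_sub_le (h : RatesInRange n p lo hi η d α β) (h' : RatesInRange n p lo hi η d' α' β') :
    |trueIso p d - trueIso p d'|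
        ≤ (2 * hi + 6) * (p * |d - d'| + n * p * |α - α'| + |β - β'|) ∧
      |obsIso n p d α β - obsIso n p d' α' β'|
        ≤ (2 * hi + 6) * (p * |d - d'| + n * p * |α - α'| + |β - β'|) ∧
      |bothIso n p d α - bothIso n p d' α'|
        ≤ (2 * hi + 6) * (p * |d - d'| + n * p * |α - α'| + |β - β'|) := by
  have hp := h.p_pos
  have hd := h.d_pos
  have hhi := h.hi_pos
  set a := p * |d - d'| with ha
  set b := n * p * |α - α'| with hb
  set c := |β - β'| with hc
  have ha0 : 0 ≤ a := by positivity
  have hb0 : 0 ≤ b := by positivity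
  have hc0 : 0 ≤ c := abs_nonneg _
  have l1 := abs_log_one_sub_le hp.le (show p ≤ 1 / 2 by linarith [h.p_le])
  have e1 : |Real.log (1 - p) * d - Real.log (1 - p) * d'| ≤ 2 * a := by
    rw [← mul_sub, abs_mul]
    calc _ ≤ 2 * p * |d - d'| := mul_le_mul_of_nonneg_right l1 (abs_nonneg _)
      _ = _ := by ring
  have e2 : |Real.log (1 - α * p) * (n - 1 - d) - Real.log (1 - α' * p) * (n - 1 - d')|
      ≤ 2 * a + 2 * b := by
    have l2 := abs_log_one_sub_sub_le (show α * p ≤ 1 / 2 by linarith [h.alpha_mul_le])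
      (show α' * p ≤ 1 / 2 by linarith [h'.alpha_mul_le])
    have l3 := abs_log_one_sub_le (mul_nonneg h'.alpha_nonneg hp.le)
      (show α' * p ≤ 1 / 2 by linarith [h'.alpha_mul_le])
    have e : Real.log (1 - α * p) * (n - 1 - d) - Real.log (1 - α' * p) * (n - 1 - d')
        = (Real.log (1 - α * p) - Real.log (1 - α' * p)) * (n - 1 - d)
          + Real.log (1 - α' * p) * (d' - d) := by ring
    rw [e]
    refine (abs_add_le _ _).trans ?_
    rw [abs_mul, abs_mul, abs_sub_comm d' d, abs_of_nonneg (show 0 ≤ (n : ℝ) - 1 - d by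
      linarith [h.d_le])]
    have e3 : |α * p - α' * p| = |α - α'| * p := by rw [← sub_mul, abs_mul, abs_of_pos hp]
    rw [e3] at l2
    have t1 : |Real.log (1 - α * p) - Real.log (1 - α' * p)| * (n - 1 - d)
        ≤ 2 * (|α - α'| * p) * n :=
      mul_le_mul l2 (by linarith) (by linarith [h.d_le]) (by positivity)
    have t2 : |Real.log (1 - α' * p)| * |d - d'| ≤ 2 * p * |d - d'| := by
      refine mul_le_mul_of_nonneg_right (l3.trans ?_) (abs_nonneg _)
      nlinarith [h'.alpha_le]
    rw [ha, hb]
    linarith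
  have e3 : |Real.log (1 - (1 - β) * p) * d - Real.log (1 - (1 - β') * p) * d'|
      ≤ 4 * a + 2 * hi * c := by
    have l2 := abs_log_one_sub_sub_le h.beta_mul_le h'.beta_mul_le
    have l3 := abs_log_one_sub_le h'.beta_mul_nonneg h'.beta_mul_le
    have e : Real.log (1 - (1 - β) * p) * d - Real.log (1 - (1 - β') * p) * d'
        = (Real.log (1 - (1 - β) * p) - Real.log (1 - (1 - β') * p)) * d
          + Real.log (1 - (1 - β') * p) * (d - d') := by ring
    rw [e]
    refine (abs_add_le _ _).trans ?_
    rw [abs_mul, abs_mul, abs_of_pos hd]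
    have e3 : |(1 - β) * p - (1 - β') * p| = c * p := by
      rw [← sub_mul, abs_mul, abs_of_pos hp, sub_sub_sub_cancel_left, abs_sub_comm]
    rw [e3] at l2
    have t1 : |Real.log (1 - (1 - β) * p) - Real.log (1 - (1 - β') * p)| * d
        ≤ 2 * (c * p) * d := mul_le_mul_of_nonneg_right l2 hd.le
    have t1' : c * (p * d) ≤ c * hi := mul_le_mul_of_nonneg_left h.le_hi hc0
    have t2 : |Real.log (1 - (1 - β') * p)| * |d - d'| ≤ 4 * p * |d - d'| := by
      refine mul_le_mul_of_nonneg_right (l3.trans ?_) (abs_nonneg _)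
      nlinarith [h'.beta_le]
    rw [ha]
    linarith
  have n1 := h.exponents_nonpos
  have n2 := h'.exponents_nonpos
  have hca : 0 ≤ hi * a := by positivity
  have hcb : 0 ≤ hi * b := by positivity
  have hcc : 0 ≤ hi * c := by positivity
  refine ⟨?_, ?_, ?_⟩
  · rw [h.trueIso_eq, h'.trueIso_eq]
    refine ((abs_exp_sub_exp_le n1.1 n2.1).trans e1).trans ?_
    linarith
  · rw [h.obsIso_eq, h'.obsIso_eq]
    refine (abs_exp_sub_exp_le (add_nonpos n1.2.1 n1.2.2) (add_nonpos n2.2.1 n2.2.2)).trans ?_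
    rw [add_sub_add_comm]
    refine ((abs_add_le _ _).trans (add_le_add e2 e3)).trans ?_
    linarith
  · rw [h.bothIso_eq, h'.bothIso_eq]
    refine (abs_exp_sub_exp_le (add_nonpos n1.1 n1.2.1) (add_nonpos n2.1 n2.2.1)).trans ?_
    rw [add_sub_add_comm]
    refine ((abs_add_le _ _).trans (add_le_add e1 e2)).trans ?_
    linarith

theorem abs_invCoef_le (h : RatesInRange n p lo hi η d α β) (e o : Bool) :
    |invCoef e o (trueIso p d) (obsIso n p d α β) (bothIso n p d α)|
      ≤ 2 / detBound lo hi η := by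
  have hκ := detBound_pos (hi := hi) h.lo_pos h.eta_pos
  have hD := h.detBound_le
  obtain ⟨u0, u1⟩ := h.trueIso_mem
  obtain ⟨v0, v1⟩ := h.obsIso_mem
  obtain ⟨w0, w1⟩ := h.bothIso_mem
  unfold invCoef
  rw [abs_div, abs_of_pos (hκ.trans_le hD)]
  refine div_le_div₀ zero_le_two ?_ hκ hD
  rw [abs_le]
  cases e <;> cases o <;> simp only [adjCoef] <;> constructor <;> linarith

/-- The entries of the inverse block depend on the degree and the error rates in a uniformly
Lipschitz way. -/
theorem abs_invCoef_sub_le (h : RatesInRange n p lo hi η d α β)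
    (h' : RatesInRange n p lo hi η d' α' β') (e o : Bool) :
    |invCoef e o (trueIso p d) (obsIso n p d α β) (bothIso n p d α)
      - invCoef e o (trueIso p d') (obsIso n p d' α' β') (bothIso n p d' α')|
      ≤ 9 * (2 * hi + 6) / detBound lo hi η ^ 2
        * (p * |d - d'| + n * p * |α - α'| + |β - β'|) := by
  have hκ := detBound_pos (hi := hi) h.lo_pos h.eta_pos
  have hD := h.detBound_le
  have hD' := h'.detBound_le
  have hinv := h'.abs_invCoef_le e o
  obtain ⟨s1, s2, s3⟩ := h.abs_sub_le h'
  set κ := detBound lo hi η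
  obtain ⟨u0, u1⟩ := h.trueIso_mem
  obtain ⟨v0, v1⟩ := h.obsIso_mem
  obtain ⟨w0, w1⟩ := h.bothIso_mem
  obtain ⟨u0', u1'⟩ := h'.trueIso_mem
  obtain ⟨v0', v1'⟩ := h'.obsIso_mem
  obtain ⟨w0', w1'⟩ := h'.bothIso_mem
  set E := (2 * hi + 6) * (p * |d - d'| + n * p * |α - α'| + |β - β'|) with hE
  set u := trueIso p d
  set v := obsIso n p d α β
  set w := bothIso n p d α
  set u' := trueIso p d'
  set v' := obsIso n p d' α' β'
  set w' := bothIso n p d' α'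
  have hE0 : 0 ≤ E := (abs_nonneg _).trans s1
  have hNd : |adjCoef e o u v w - adjCoef e o u' v' w'| ≤ 3 * E := by
    rw [abs_le] at *
    cases e <;> cases o <;> simp only [adjCoef] <;> constructor <;> linarith
  have hDd : |(w' - u' * v') - (w - u * v)| ≤ 3 * E := by
    have e1 : (w' - u' * v') - (w - u * v) = -(w - w') + u * (v - v') + v' * (u - u') := by ring
    rw [e1]
    refine (abs_add_three _ _ _).trans ?_
    rw [abs_neg, abs_mul, abs_mul, abs_of_nonneg u0, abs_of_nonneg v0']
    have t1 : u * |v - v'| ≤ 1 * |v - v'| := mul_le_mul_of_nonneg_right u1 (abs_nonneg _)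
    have t2 : v' * |u - u'| ≤ 1 * |u - u'| := mul_le_mul_of_nonneg_right v1' (abs_nonneg _)
    linarith
  have hDpos := hκ.trans_le hD
  have hDpos' := hκ.trans_le hD'
  have hκ1 : κ ≤ 1 := hD.trans (by nlinarith)
  -- `N / D - N' / D' = (N - N' + (N' / D') * (D' - D)) / D`
  have e2 : invCoef e o u v w - invCoef e o u' v' w'
      = (adjCoef e o u v w - adjCoef e o u' v' w' + invCoef e o u' v' w' * ((w' - u' * v') - (w - u * v)))
        / (w - u * v) := by
    rw [invCoef, invCoef]
    field_simp
    ring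
  rw [e2, abs_div, abs_of_pos hDpos]
  have t3 : |invCoef e o u' v' w' * ((w' - u' * v') - (w - u * v))| ≤ 2 / κ * (3 * E) := by
    rw [abs_mul]
    exact mul_le_mul hinv hDd (abs_nonneg _) (by positivity)
  have t4 : 3 * E ≤ 3 * E / κ := by
    rw [le_div_iff₀ hκ]; nlinarith
  calc _ ≤ (3 * E / κ + 2 / κ * (3 * E)) / κ :=
        div_le_div₀ (by positivity) ((abs_add_le _ _).trans (add_le_add (hNd.trans t4) t3)) hκ hD
    _ = 9 * E / κ ^ 2 := by field_simp; ring
    _ = _ := by rw [hE]; ring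

end RatesInRange

/-! ### Estimated degrees -/

/-- If the observed degree is close to its mean and the estimated error rates are close to the
true ones, then the estimated degree is close to the true degree on the scale `1 / p`. -/
theorem abs_degreeEst_sub_le {n : ℕ} (G g : SimpleGraph (Fin n)) (i : Fin n)
    {p α β a b δ hi η : ℝ} (hp : 0 < p) (hη : 0 < η)
    (hα : α ∈ Set.Icc (0 : ℝ) 1) (hβ : η ≤ 1 - β) (hd : p * deg G i ≤ hi)
    (hna : n * α * p ≤ hi) (hα4 : α ≤ η / 8) (hδ1 : δ ≤ 1) (hδη : δ ≤ η / 4)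
    (hdeg : |(deg g i : ℝ) - meanDeg G α β i| ≤ δ / p) (ha : |a - α| ≤ δ * α) (hb : |b - β| ≤ δ) :
    p * |degreeEst g a b i - deg G i| ≤ 2 / η * (1 + 3 * hi) * δ := by
  have hδ0 : 0 ≤ δ := (abs_nonneg _).trans hb
  obtain ⟨hα0, hα1⟩ := hα
  have hden : η / 2 ≤ 1 - a - b := by
    have h1 := (abs_le.1 ha).2
    have h2 := (abs_le.1 hb).2
    nlinarith
  have hden0 : 0 < 1 - a - b := by linarith
  have hn : deg G i + 1 ≤ n := deg_le G i
  have hn' : (deg G i : ℝ) + 1 ≤ n := by exact_mod_cast hn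
  -- sampling error, error of `a` acting on all vertices, error of the rates acting on neighbours
  have e : degreeEst g a b i - deg G i = (((deg g i : ℝ) - meanDeg G α β i)
      + ((n : ℝ) - 1) * -(a - α) + deg G i * ((a - α) + (b - β))) / (1 - a - b) := by
    rw [degreeEst, meanDeg]
    field_simp
    ring
  have h1 : p * |(deg g i : ℝ) - meanDeg G α β i| ≤ δ := by
    rw [le_div_iff₀ hp] at hdeg; linarith
  have h2 : p * |((n : ℝ) - 1) * -(a - α)| ≤ hi * δ := by
    rw [abs_mul, abs_neg, abs_of_nonneg (show 0 ≤ (n : ℝ) - 1 by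
      linarith [Nat.cast_nonneg (α := ℝ) (deg G i)])]
    calc p * (((n : ℝ) - 1) * |a - α|) ≤ p * (n * (δ * α)) := by
          refine mul_le_mul_of_nonneg_left (mul_le_mul (by linarith) ha (abs_nonneg _)
            (Nat.cast_nonneg _)) hp.le
      _ = n * α * p * δ := by ring
      _ ≤ hi * δ := mul_le_mul_of_nonneg_right hna hδ0
  have h3 : p * |deg G i * ((a - α) + (b - β))| ≤ hi * (2 * δ) := by
    rw [abs_mul, Nat.abs_cast, ← mul_assoc]
    refine mul_le_mul hd ?_ (abs_nonneg _) ((by positivity : (0 : ℝ) ≤ p * deg G i).trans hd)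
    refine (abs_add_le _ _).trans ?_
    nlinarith
  rw [e, abs_div, abs_of_pos hden0, ← mul_div_assoc]
  have h4 : p * |((deg g i : ℝ) - meanDeg G α β i)
      + ((n : ℝ) - 1) * -(a - α) + deg G i * ((a - α) + (b - β))| ≤ (1 + 3 * hi) * δ := by
    have := mul_le_mul_of_nonneg_left (abs_add_three ((deg g i : ℝ) - meanDeg G α β i)
      (((n : ℝ) - 1) * -(a - α)) (deg G i * ((a - α) + (b - β)))) hp.le
    linarith
  have hnn : 0 ≤ (1 + 3 * hi) * δ := le_trans (by positivity) h4
  calc _ ≤ (1 + 3 * hi) * δ / (η / 2) := div_le_div₀ hnn h4 (by positivity) hden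
    _ = _ := by field_simp

/-- A vertex whose observed degree has the order of `1 / p` has all exposure levels with probability
of the order of the probability of their treatment status. -/
theorem le_exposureProb {n : ℕ} (g : SimpleGraph (Fin n)) (i : Fin n) (c : Exposure)
    {p lo hi : ℝ} (hp : 0 < p) (hp4 : p ≤ 1 / 4) (hlo : lo ≤ p * deg g i)
    (hhi : p * deg g i ≤ hi) :
    armProb p c.treated * min (1 - Real.exp (-lo)) (Real.exp (-(2 * hi)))
      ≤ exposureProb p g i c := by
  rw [exposureProb_eq]
  refine mul_le_mul_of_nonneg_left ?_ (armProb_nonneg ⟨hp.le, by linarith⟩ _)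
  have l := log_one_sub_mem hp.le (show p ≤ 1 / 2 by linarith)
  have e : (1 - p) ^ deg g i = Real.exp (Real.log (1 - p) * deg g i) := by
    rw [← Real.rpow_natCast, Real.rpow_def_of_pos (by linarith)]
  have hd : (0 : ℝ) ≤ deg g i := Nat.cast_nonneg _
  split_ifs
  · refine (min_le_left _ _).trans (sub_le_sub_left ?_ _)
    rw [e, Real.exp_le_exp]
    nlinarith
  · refine (min_le_right _ _).trans ?_
    rw [e, Real.exp_le_exp]
    nlinarith

/-! ### Concentration of the zero-truncated Poisson law -/

open Nat in
theorem hasSum_poisson_mul_id (r : ℝ) (h : HasSum (fun k : ℕ => Real.exp (-r) * r ^ k / (k)!) 1) :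
    HasSum (fun k : ℕ => Real.exp (-r) * r ^ k / (k)! * k) r := by
  rw [← hasSum_nat_add_iff' 1]
  simp only [Finset.sum_range_one, Nat.cast_zero, mul_zero, sub_zero]
  have e : (fun k : ℕ => Real.exp (-r) * r ^ (k + 1) / ((k + 1)! : ℕ) * ((k + 1 : ℕ) : ℝ))
      = fun k : ℕ => r * (Real.exp (-r) * r ^ k / (k)!) := by
    funext k
    rw [Nat.factorial_succ]
    push_cast
    have : (k : ℝ) + 1 ≠ 0 := by positivity
    field_simp
    ring
  rw [e]
  simpa using h.mul_left r

open Nat in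
theorem hasSum_poisson_mul_sq (r : ℝ) (h : HasSum (fun k : ℕ => Real.exp (-r) * r ^ k / (k)!) 1) :
    HasSum (fun k : ℕ => Real.exp (-r) * r ^ k / (k)! * (k : ℝ) ^ 2) (r ^ 2 + r) := by
  rw [← hasSum_nat_add_iff' 1]
  simp only [Finset.sum_range_one, Nat.cast_zero, ne_eq, OfNat.ofNat_ne_zero, not_false_eq_true,
    zero_pow, mul_zero, sub_zero]
  have e : (fun k : ℕ => Real.exp (-r) * r ^ (k + 1) / ((k + 1)! : ℕ) * ((k + 1 : ℕ) : ℝ) ^ 2)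
      = fun k : ℕ => r * (Real.exp (-r) * r ^ k / (k)! * k + Real.exp (-r) * r ^ k / (k)!) := by
    funext k
    rw [Nat.factorial_succ]
    push_cast
    have : (k : ℝ) + 1 ≠ 0 := by positivity
    field_simp
    ring
  rw [e]
  have := ((hasSum_poisson_mul_id r h).add h).mul_left r
  rwa [show r * (r + 1) = r ^ 2 + r by ring] at this

theorem integrable_poisson_sq (r : ℝ≥0) :
    Integrable (fun k : ℕ => (k : ℝ) ^ 2) (poissonMeasure r) := by
  rw [integrable_poissonMeasure_iff]
  have := (hasSum_poisson_mul_sq r (hasSum_one_poissonMeasure r)).summable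
  simpa using this

theorem integrable_poisson_id (r : ℝ≥0) :
    Integrable (fun k : ℕ => (k : ℝ)) (poissonMeasure r) := by
  rw [integrable_poissonMeasure_iff]
  have := (hasSum_poisson_mul_id r (hasSum_one_poissonMeasure r)).summable
  simpa using this

theorem integral_poisson_id (r : ℝ≥0) : ∫ k : ℕ, (k : ℝ) ∂(poissonMeasure r) = r := by
  rw [integral_poissonMeasure]
  simpa using (hasSum_poisson_mul_id r (hasSum_one_poissonMeasure r)).tsum_eq

theorem integral_poisson_sq (r : ℝ≥0) :
    ∫ k : ℕ, (k : ℝ) ^ 2 ∂(poissonMeasure r) = (r : ℝ) ^ 2 + r := by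
  rw [integral_poissonMeasure]
  simpa using (hasSum_poisson_mul_sq r (hasSum_one_poissonMeasure r)).tsum_eq

theorem poisson_far_le (r : ℝ≥0) {t : ℝ} (ht : 0 < t) :
    (poissonMeasure r).real {k : ℕ | t ≤ |(k : ℝ) - r|} ≤ r / t ^ 2 := by
  have hint : Integrable (fun k : ℕ => ((k : ℝ) - r) ^ 2) (poissonMeasure r) := by
    have := ((integrable_poisson_sq r).sub ((integrable_poisson_id r).const_mul (2 * r))).add
      (integrable_const ((r : ℝ) ^ 2))
    refine this.congr (Eventually.of_forall fun k => ?_)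
    simp only [Pi.add_apply, Pi.sub_apply]
    ring
  have hvar : ∫ k : ℕ, ((k : ℝ) - r) ^ 2 ∂(poissonMeasure r) = r := by
    have e : ∀ k : ℕ, ((k : ℝ) - r) ^ 2 = (k : ℝ) ^ 2 - 2 * r * k + (r : ℝ) ^ 2 := by
      intro k; ring
    simp_rw [e]
    have h1 : Integrable (fun k : ℕ => 2 * (r : ℝ) * k) (poissonMeasure r) :=
      (integrable_poisson_id r).const_mul _
    have h2 : Integrable (fun k : ℕ => (k : ℝ) ^ 2 - 2 * (r : ℝ) * k) (poissonMeasure r) :=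
      (integrable_poisson_sq r).sub h1
    rw [integral_add h2 (integrable_const _), integral_sub (integrable_poisson_sq r) h1,
      integral_const_mul, integral_poisson_id, integral_poisson_sq]
    simp
    ring
  have h1 := mul_meas_ge_le_integral_of_nonneg (μ := poissonMeasure r)
    (f := fun k : ℕ => ((k : ℝ) - r) ^ 2) (Eventually.of_forall fun k => sq_nonneg _) hint (t ^ 2)
  rw [hvar] at h1
  rw [le_div_iff₀ (by positivity), mul_comm]
  have e : {k : ℕ | t ≤ |(k : ℝ) - r|} = {k : ℕ | t ^ 2 ≤ ((k : ℝ) - r) ^ 2} := by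
    ext k
    simp only [Set.mem_ofPred_eq]
    rw [← sq_abs ((k : ℝ) - r)]
    exact (pow_le_pow_iff_left₀ ht.le (abs_nonneg _) two_ne_zero).symm
  rw [e]
  exact h1

theorem poisson_real_compl_zero (r : ℝ≥0) :
    (poissonMeasure r).real {0}ᶜ = 1 - Real.exp (-r) := by
  rw [probReal_compl_eq_one_sub (measurableSet_singleton 0), poissonMeasure_real_singleton]
  simp

theorem integral_zeroTruncatedPoisson (r : ℝ≥0) :
    ∫ k, (k : ℝ) ∂(zeroTruncatedPoisson r) = r / (1 - Real.exp (-r)) := by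
  rw [zeroTruncatedPoisson, ProbabilityTheory.cond, integral_smul_measure, ← integral_poisson_id r,
    setIntegral_eq_integral_of_forall_compl_eq_zero, integral_poisson_id]
  · rw [ENNReal.toReal_inv, ← measureReal_def, poisson_real_compl_zero, smul_eq_mul, div_eq_inv_mul]
  · intro k hk
    have : k = 0 := by simpa using hk
    simp [this]

theorem zeroTruncatedPoisson_real_le (r : ℝ≥0) (s : Set ℕ) :
    (zeroTruncatedPoisson r).real s ≤ (poissonMeasure r).real s / (1 - Real.exp (-r)) := by
  rw [zeroTruncatedPoisson, measureReal_def, ProbabilityTheory.cond_apply (by measurability),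
    ENNReal.toReal_mul, ENNReal.toReal_inv, ← measureReal_def, poisson_real_compl_zero,
    div_eq_inv_mul]
  refine mul_le_mul_of_nonneg_left ?_ ?_
  · exact measureReal_mono Set.inter_subset_right
  · rw [inv_nonneg, sub_nonneg, Real.exp_le_one_iff]
    simp

theorem isProbabilityMeasure_zeroTruncatedPoisson {r : ℝ≥0} (hr : 0 < r) :
    IsProbabilityMeasure (zeroTruncatedPoisson r) := by
  refine ProbabilityTheory.cond_isProbabilityMeasure fun h0 => ?_
  have h1 := poisson_real_compl_zero r
  rw [measureReal_def, h0, ENNReal.toReal_zero] at h1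
  have h2 : Real.exp (-r) < 1 := by
    rw [← Real.exp_zero, Real.exp_lt_exp]
    simpa using hr
  linarith

/-- Chebyshev's inequality for the zero-truncated Poisson law, whose mean exceeds the rate by at
most `1`. -/
theorem zeroTruncatedPoisson_far_le {r : ℝ≥0} (hr : 0 < r) {D ε : ℝ}
    (hD : D = ∫ k, (k : ℝ) ∂(zeroTruncatedPoisson r)) (hε : 0 < ε) (hDε : 2 ≤ ε * D) :
    (zeroTruncatedPoisson r).real {k : ℕ | ε * D ≤ |(k : ℝ) - D|} ≤ 4 / (ε ^ 2 * D) := by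
  rw [integral_zeroTruncatedPoisson] at hD
  have hr' : (0 : ℝ) < r := hr
  have hq : 0 < 1 - Real.exp (-r) := by
    rw [sub_pos, ← Real.exp_zero, Real.exp_lt_exp]
    simpa using hr
  have hDpos : 0 < D := by rw [hD]; positivity
  have h1 : (r : ℝ) ≤ D := by
    rw [hD, le_div_iff₀ hq]
    nlinarith [Real.exp_pos (-(r : ℝ))]
  have h2 : D ≤ r + 1 := by
    rw [hD, div_le_iff₀ hq]
    have h3 := Real.add_one_le_exp (r : ℝ)
    have h4 : Real.exp r * Real.exp (-r) = 1 := by rw [← Real.exp_add]; simp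
    nlinarith [Real.exp_pos (-(r : ℝ))]
  have hsub : {k : ℕ | ε * D ≤ |(k : ℝ) - D|} ⊆ {k : ℕ | ε * D / 2 ≤ |(k : ℝ) - r|} := by
    intro k hk
    simp only [Set.mem_ofPred_eq] at *
    have h3 : |(k : ℝ) - D| ≤ |(k : ℝ) - r| + |(r : ℝ) - D| := abs_sub_le _ _ _
    have h4 : |(r : ℝ) - D| ≤ 1 := by rw [abs_le]; constructor <;> linarith
    linarith
  have hp := isProbabilityMeasure_zeroTruncatedPoisson hr
  have h5 := poisson_far_le r (t := ε * D / 2) (by positivity)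
  calc _ ≤ (zeroTruncatedPoisson r).real {k : ℕ | ε * D / 2 ≤ |(k : ℝ) - r|} := measureReal_mono hsub
    _ ≤ _ := zeroTruncatedPoisson_real_le r _
    _ ≤ (r / (ε * D / 2) ^ 2) / (1 - Real.exp (-r)) := div_le_div_of_nonneg_right h5 hq.le
    _ = (r / (1 - Real.exp (-r))) / (ε * D / 2) ^ 2 := by field_simp
    _ = 4 / (ε ^ 2 * D) := by
      rw [← hD]
      field_simp
      norm_num

open scoped Classical in
/-- In a homogeneous network with mean degree tending to infinity, all but a vanishing fraction
of the vertices have a degree close to the mean degree. -/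
theorem IsHomogeneous.tendsto_card_far {N : ℕ → ℕ} {G : ∀ m, SimpleGraph (Fin (N m))}
    {dbar : ℕ → ℝ} (h : IsHomogeneous N G dbar) (hN : Tendsto N atTop atTop)
    (hd : Tendsto dbar atTop atTop) {ε : ℝ} (hε : 0 < ε) (hε1 : ε ≤ 1) :
    Tendsto (fun m => ((Finset.univ.filter fun i =>
      ¬ |(deg (G m) i : ℝ) - dbar m| ≤ ε * dbar m).card : ℝ) / N m) atTop (𝓝 0) := by
  obtain ⟨rate, hrate, hcdf⟩ := h
  rw [Metric.tendsto_nhds]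
  intro ξ hξ
  have hbig : ∀ᶠ m in atTop, 16 / (ε ^ 2 * ξ) < dbar m := hd.eventually_gt_atTop _
  have hbig2 : ∀ᶠ m in atTop, 2 / ε ≤ dbar m := hd.eventually_ge_atTop _
  filter_upwards [hcdf (ξ / 8) (by positivity), hbig, hbig2, hN.eventually_gt_atTop 0]
    with m h1 h2 h3 h4
  obtain ⟨hr, hD⟩ := hrate m
  set D := dbar m with hDdef
  set Q := zeroTruncatedPoisson (rate m) with hQ
  have hDpos : 0 < D := lt_of_lt_of_le (by positivity) h3
  have hprob := isProbabilityMeasure_zeroTruncatedPoisson hr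
  have hn : (0 : ℝ) < N m := by exact_mod_cast h4
  have hfar := zeroTruncatedPoisson_far_le hr hD hε (by
    rwa [div_le_iff₀ hε, mul_comm] at h3)
  have hfar2 : 4 / (ε ^ 2 * D) ≤ ξ / 4 := by
    rw [div_lt_iff₀ (by positivity)] at h2
    rw [div_le_div_iff₀ (by positivity) (by norm_num)]
    nlinarith
  -- vertices outside the range are counted by the degree distribution function at `k₁` and `k₂`
  set k₁ := ⌊(1 - ε) * D⌋₊
  set k₂ := ⌊(1 + ε) * D⌋₊
  have hQ1 : Q.real (Set.Iic k₁) ≤ ξ / 4 := by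
    refine (measureReal_mono ?_).trans (hfar.trans hfar2)
    intro k hk
    have hk' : (k : ℝ) ≤ (1 - ε) * D :=
      (Nat.cast_le.2 hk).trans (Nat.floor_le (mul_nonneg (by linarith) hDpos.le))
    change ε * D ≤ |(k : ℝ) - D|
    rw [abs_sub_comm]
    exact le_trans (by linarith) (le_abs_self _)
  have hQ2 : 1 - Q.real (Set.Iic k₂) ≤ ξ / 4 := by
    rw [← probReal_compl_eq_one_sub measurableSet_Iic]
    refine (measureReal_mono ?_).trans (hfar.trans hfar2)
    intro k hk
    have hk1 : k₂ < k := by simpa using hk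
    have hk' : (1 + ε) * D < k := Nat.lt_of_floor_lt hk1
    change ε * D ≤ |(k : ℝ) - D|
    exact le_trans (by linarith) (le_abs_self _)
  have hc1 := abs_le.1 (h1 k₁)
  have hc2 := abs_le.1 (h1 k₂)
  have hcard : ((Finset.univ.filter fun i =>
      ¬ |(deg (G m) i : ℝ) - D| ≤ ε * D).card : ℝ) ≤
      ((Finset.univ.filter fun i => deg (G m) i ≤ k₁).card : ℝ)
        + (N m - ((Finset.univ.filter fun i => deg (G m) i ≤ k₂).card : ℝ)) := by
    have e := Finset.card_filter_add_card_filter_not (s := (Finset.univ : Finset (Fin (N m))))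
      (fun i => deg (G m) i ≤ k₂)
    rw [Finset.card_univ, Fintype.card_fin] at e
    have e' : (N m : ℝ) - ((Finset.univ.filter fun i => deg (G m) i ≤ k₂).card : ℝ)
        = ((Finset.univ.filter fun i => ¬ deg (G m) i ≤ k₂).card : ℝ) := by
      rw [sub_eq_iff_eq_add, add_comm]
      exact_mod_cast e.symm
    rw [e']
    have hsub : (Finset.univ.filter fun i => ¬ |(deg (G m) i : ℝ) - D| ≤ ε * D)
        ⊆ (Finset.univ.filter fun i => deg (G m) i ≤ k₁)
          ∪ (Finset.univ.filter fun i => ¬ deg (G m) i ≤ k₂) := by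
      intro i hi
      simp only [Finset.mem_filter, Finset.mem_univ, true_and, Finset.mem_union, not_le] at *
      rcases lt_abs.1 hi with hlt | hlt
      · right
        rw [Nat.floor_lt (by positivity)]
        linarith
      · left
        exact Nat.le_floor (by linarith)
    exact_mod_cast (Finset.card_le_card hsub).trans (Finset.card_union_le _ _)
  rw [Real.dist_eq, sub_zero, abs_of_nonneg (by positivity), div_lt_iff₀ hn]
  simp only [degreeCDF] at hc1 hc2
  have g1 : ((Finset.univ.filter fun i => deg (G m) i ≤ k₁).card : ℝ) ≤ 3 * ξ / 8 * N m := by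
    rw [← div_le_iff₀ hn]; linarith
  have g2 : (1 - 3 * ξ / 8) * N m ≤ ((Finset.univ.filter fun i => deg (G m) i ≤ k₂).card : ℝ) := by
    rw [← le_div_iff₀ hn]; linarith
  nlinarith

/-! ### Error bounds for a single graph -/

/-- The quantitative content, for a single graph, of the assumptions on the network, the treatment
probability, the error rates, the degree window and the outcomes: `p * d` lies in `[lo, hi]` for the
degrees `d` in the window, `1 - β` is at least `2 * η`, and `K` bounds the relative size of the
estimates of `α` under consideration. -/
structure Regime {n : ℕ} (G : SimpleGraph (Fin n)) (y : Fin n → Exposure → ℝ)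
    (p α β dbar C₁ C₂ lo hi η ε K M : ℝ) : Prop where
  n_pos : 0 < n
  p_pos : 0 < p
  p_le : p ≤ 1 / 4
  alpha_pos : 0 < α
  alpha_le : α ≤ η / 8
  K_alpha_le : K * α ≤ 1
  two_le_K : 2 ≤ K
  nap_le : n * (K * α) * p ≤ hi
  eta_pos : 0 < η
  eta_le : 2 * η ≤ 1 - β
  beta_nonneg : 0 ≤ β
  lo_pos : 0 < lo
  lo_le : lo ≤ p * C₁
  le_hi : p * C₂ ≤ hi
  C₂_le : C₂ ≤ n - 1
  eps_pos : 0 < ε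
  eps_lt : ε < 1
  C₁_le : C₁ ≤ (1 - ε) * dbar
  le_C₂ : (1 + ε) * dbar ≤ C₂
  abs_y_le : ∀ i c, |y i c| ≤ M

/-- The true degree of `i` is close to the mean degree, and the observed degree of `i` is close to
its expectation. -/
def IsTypical {n : ℕ} (G : SimpleGraph (Fin n)) (p α β dbar ε δ : ℝ) (g : SimpleGraph (Fin n))
    (i : Fin n) : Prop :=
  |(deg G i : ℝ) - dbar| ≤ ε / 2 * dbar ∧ |(deg g i : ℝ) - meanDeg G α β i| < δ / p

/-- The entry of the inverse block at the true degree and error rates, times the outcome, as a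
function of the presence of treated neighbours in the true and in the observed graph. -/
noncomputable def oracleCoef {n : ℕ} (G : SimpleGraph (Fin n)) (y : Fin n → Exposure → ℝ)
    (p α β : ℝ) (i : Fin n) (c : Exposure) (e o : Bool) : ℝ :=
  invCoef c.exposed o (trueIso p (deg G i)) (obsIso n p (deg G i) α β) (bothIso n p (deg G i) α)
    * y i (Exposure.ofBits c.treated e)

/-- The method-of-moments estimator of a vertex with known degree and error rates. -/
noncomputable def oracleMME {n : ℕ} (G g : SimpleGraph (Fin n)) (y : Fin n → Exposure → ℝ)
    (T : Finset (Fin n)) (p α β : ℝ) (i : Fin n) (c : Exposure) : ℝ :=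
  armInd T i c.treated / armProb p c.treated
    * oracleCoef G y p α β i c (exposedIn T G i) (exposedIn T g i)

/-- The summand of `mme` that belongs to the vertex `i`. -/
noncomputable def nodeEst {n : ℕ} (G g : SimpleGraph (Fin n)) (y : Fin n → Exposure → ℝ)
    (T : Finset (Fin n)) (p a b C₁ C₂ : ℝ) (c : Exposure) (i : Fin n) : ℝ :=
  if C₁ ≤ degreeEst g a b i ∧ degreeEst g a b i < C₂
    then nodeMME G g y T p a b i c else nodeAS G g y T p i c

/-- A constant such that `lipBound lo hi η * δ` bounds the change of the entries of the inverse block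
when the error rates are estimated with precision `δ` and the degree is estimated accordingly. -/
noncomputable def lipBound (lo hi η : ℝ) : ℝ :=
  9 * (2 * hi + 6) / detBound lo hi η ^ 2 * (2 / η * (1 + 3 * hi) + hi + 1)

namespace Regime

variable {n : ℕ} {G : SimpleGraph (Fin n)} {y : Fin n → Exposure → ℝ}
  {p α β dbar C₁ C₂ lo hi η ε K M : ℝ}

theorem C₁_pos (r : Regime G y p α β dbar C₁ C₂ lo hi η ε K M) : 0 < C₁ :=
  pos_of_mul_pos_right (r.lo_pos.trans_le r.lo_le) r.p_pos.le

theorem dbar_pos (r : Regime G y p α β dbar C₁ C₂ lo hi η ε K M) : 0 < dbar :=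
  pos_of_mul_pos_right (r.C₁_pos.trans_le r.C₁_le) (by linarith [r.eps_lt])

theorem M_nonneg (r : Regime G y p α β dbar C₁ C₂ lo hi η ε K M) : 0 ≤ M :=
  (abs_nonneg _).trans (r.abs_y_le ⟨0, r.n_pos⟩ .c11)

theorem detBound_pos (r : Regime G y p α β dbar C₁ C₂ lo hi η ε K M) : 0 < detBound lo hi η :=
  NoisyInterference.detBound_pos r.lo_pos r.eta_pos

theorem armProb_pos (r : Regime G y p α β dbar C₁ C₂ lo hi η ε K M) (τ : Bool) :
    0 < armProb p τ := by
  have := r.p_pos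
  have := r.p_le
  unfold armProb
  split_ifs <;> linarith

theorem hi_pos (r : Regime G y p α β dbar C₁ C₂ lo hi η ε K M) : 0 < hi := by
  have h1 : C₁ ≤ C₂ := by
    have := r.C₁_le; have := r.le_C₂
    nlinarith [r.dbar_pos, r.eps_pos]
  exact (r.lo_pos.trans_le r.lo_le).trans_le
    ((mul_le_mul_of_nonneg_left h1 r.p_pos.le).trans r.le_hi)

theorem nap_le' (r : Regime G y p α β dbar C₁ C₂ lo hi η ε K M) : n * α * p ≤ hi := by
  refine le_trans ?_ r.nap_le
  have h1 : α ≤ K * α := by nlinarith [r.two_le_K, r.alpha_pos]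
  exact mul_le_mul_of_nonneg_right (mul_le_mul_of_nonneg_left h1 (Nat.cast_nonneg _)) r.p_pos.le

theorem alpha_mem (r : Regime G y p α β dbar C₁ C₂ lo hi η ε K M) :
    α ∈ Set.Icc (0 : ℝ) 1 :=
  ⟨r.alpha_pos.le, by nlinarith [r.two_le_K, r.alpha_pos, r.K_alpha_le]⟩

theorem mem_window_of_close (r : Regime G y p α β dbar C₁ C₂ lo hi η ε K M) {d : ℝ}
    (hd : |d - dbar| < ε * dbar) : C₁ ≤ d ∧ d < C₂ := by
  have h1 := abs_lt.1 hd
  have h2 := r.C₁_le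
  have h3 := r.le_C₂
  constructor <;> linarith

/-- Degrees in the window and error rates in their ranges are in the range where the confusion
matrix is well conditioned. -/
theorem ratesInRange (r : Regime G y p α β dbar C₁ C₂ lo hi η ε K M) {d a b : ℝ}
    (hd : C₁ ≤ d ∧ d < C₂) (ha0 : 0 ≤ a) (haK : a ≤ K * α) (hb : η ≤ 1 - b) (hb2 : 1 - b ≤ 2) :
    RatesInRange n p lo hi η d a b where
  p_pos := r.p_pos
  p_le := r.p_le
  lo_pos := r.lo_pos
  eta_pos := r.eta_pos
  lo_le := r.lo_le.trans (mul_le_mul_of_nonneg_left hd.1 r.p_pos.le)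
  le_hi := (mul_le_mul_of_nonneg_left hd.2.le r.p_pos.le).trans r.le_hi
  d_le := hd.2.le.trans r.C₂_le
  alpha_nonneg := ha0
  alpha_le := haK.trans r.K_alpha_le
  nap_le := le_trans (mul_le_mul_of_nonneg_right
    (mul_le_mul_of_nonneg_left haK (Nat.cast_nonneg _)) r.p_pos.le) r.nap_le
  eta_le := hb
  beta_le := hb2

theorem ratesInRange_true (r : Regime G y p α β dbar C₁ C₂ lo hi η ε K M) {i : Fin n}
    (hi' : |(deg G i : ℝ) - dbar| ≤ ε / 2 * dbar) :
    RatesInRange n p lo hi η (deg G i) α β := by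
  refine r.ratesInRange (r.mem_window_of_close (lt_of_le_of_lt hi' ?_)) r.alpha_pos.le ?_ ?_ ?_
  · nlinarith [r.eps_pos, r.dbar_pos]
  · nlinarith [r.two_le_K, r.alpha_pos]
  · linarith [r.eta_le, r.eta_pos]
  · linarith [r.beta_nonneg]

theorem abs_nodeMME_le (r : Regime G y p α β dbar C₁ C₂ lo hi η ε K M) (g : SimpleGraph (Fin n))
    (T : Finset (Fin n)) {a b : ℝ} (i : Fin n) (c : Exposure)
    (hR : RatesInRange n p lo hi η (degreeEst g a b i) a b) :
    |nodeMME G g y T p a b i c|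
      ≤ 2 * M / detBound lo hi η * (armInd T i c.treated / armProb p c.treated) := by
  have hκ := r.detBound_pos
  have h1 : 0 ≤ armInd T i c.treated / armProb p c.treated :=
    div_nonneg (armInd_nonneg _ _ _) (r.armProb_pos _).le
  rw [nodeMME_eq G g y T i c r.p_pos.ne' (by linarith [r.p_le]) _ rfl hR.det_ne_zero, abs_mul,
    abs_mul, abs_of_nonneg h1, mul_comm]
  refine mul_le_mul_of_nonneg_right ?_ h1
  calc _ ≤ 2 / detBound lo hi η * M := mul_le_mul (hR.abs_invCoef_le _ _) (r.abs_y_le _ _)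
        (abs_nonneg _) (by positivity)
    _ = _ := by ring

theorem abs_oracleCoef_le (r : Regime G y p α β dbar C₁ C₂ lo hi η ε K M) {i : Fin n}
    (hi' : |(deg G i : ℝ) - dbar| ≤ ε / 2 * dbar) (c : Exposure) (e o : Bool) :
    |oracleCoef G y p α β i c e o| ≤ 2 * M / detBound lo hi η := by
  have hκ := r.detBound_pos
  rw [oracleCoef, abs_mul]
  calc _ ≤ 2 / detBound lo hi η * M :=
        mul_le_mul ((r.ratesInRange_true hi').abs_invCoef_le _ _) (r.abs_y_le _ _)
        (abs_nonneg _) (by positivity)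
    _ = _ := by ring

theorem abs_oracleMME_le (r : Regime G y p α β dbar C₁ C₂ lo hi η ε K M) (g : SimpleGraph (Fin n))
    (T : Finset (Fin n)) {i : Fin n} (hi' : |(deg G i : ℝ) - dbar| ≤ ε / 2 * dbar) (c : Exposure) :
    |oracleMME G g y T p α β i c|
      ≤ 2 * M / detBound lo hi η * (armInd T i c.treated / armProb p c.treated) := by
  have h1 : 0 ≤ armInd T i c.treated / armProb p c.treated :=
    div_nonneg (armInd_nonneg _ _ _) (r.armProb_pos _).le
  rw [oracleMME, abs_mul, abs_of_nonneg h1, mul_comm]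
  exact mul_le_mul_of_nonneg_right (r.abs_oracleCoef_le hi' c _ _) h1

/-- At a typical vertex, and for error rates estimated with precision `δ`, the estimated degree lies
in the window, and the estimator differs from the one with known degree and error rates by an amount
proportional to `δ`. -/
theorem abs_nodeEst_sub_oracleMME_le (r : Regime G y p α β dbar C₁ C₂ lo hi η ε K M)
    (g : SimpleGraph (Fin n)) (T : Finset (Fin n)) {a b δ : ℝ} (i : Fin n) (c : Exposure)
    (hδ1 : δ ≤ 1) (hδη : δ ≤ η / 4) (hδε : 2 / η * (1 + 3 * hi) * δ < ε / 2 * lo)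
    (ht : IsTypical G p α β dbar ε δ g i) (ha : |a - α| ≤ δ * α) (hb : |b - β| ≤ δ) :
    |nodeEst G g y T p a b C₁ C₂ c i - oracleMME G g y T p α β i c|
      ≤ lipBound lo hi η * δ * M * (armInd T i c.treated / armProb p c.treated) := by
  have hp := r.p_pos
  have hδ0 : 0 ≤ δ := (abs_nonneg _).trans hb
  have hα := r.alpha_pos
  have hR := r.ratesInRange_true ht.1
  have hclose := abs_degreeEst_sub_le G g i hp r.eta_pos r.alpha_mem
    (by linarith [r.eta_le, r.eta_pos]) hR.le_hi r.nap_le' r.alpha_le hδ1 hδη ht.2.le ha hb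
  have hpd : lo ≤ p * dbar := r.lo_le.trans (mul_le_mul_of_nonneg_left
    (r.C₁_le.trans (by nlinarith [r.eps_pos, r.dbar_pos])) hp.le)
  have hwin : C₁ ≤ degreeEst g a b i ∧ degreeEst g a b i < C₂ := by
    apply r.mem_window_of_close
    have h1 : |degreeEst g a b i - deg G i| < ε / 2 * dbar := by
      have h2 : p * |degreeEst g a b i - deg G i| < p * (ε / 2 * dbar) := by
        have h3 : ε / 2 * lo ≤ ε / 2 * (p * dbar) :=
          mul_le_mul_of_nonneg_left hpd (by linarith [r.eps_pos])
        linarith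
      exact lt_of_mul_lt_mul_left h2 hp.le
    have h2 := abs_sub_le (degreeEst g a b i) (deg G i) dbar
    linarith [ht.1]
  have ha' := abs_le.1 ha
  have hb' := abs_le.1 hb
  have hR' : RatesInRange n p lo hi η (degreeEst g a b i) a b := by
    refine r.ratesInRange hwin ?_ ?_ ?_ ?_
    · nlinarith
    · nlinarith [r.two_le_K]
    · linarith [r.eta_le, r.eta_pos]
    · have := r.beta_nonneg; linarith
  have h1 : 0 ≤ armInd T i c.treated / armProb p c.treated :=
    div_nonneg (armInd_nonneg _ _ _) (r.armProb_pos _).le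
  rw [nodeEst, if_pos hwin,
    nodeMME_eq G g y T i c r.p_pos.ne' (by linarith [r.p_le]) _ rfl hR'.det_ne_zero, oracleMME,
    oracleCoef, ← mul_sub, ← sub_mul, abs_mul, abs_mul, abs_of_nonneg h1,
    mul_comm (lipBound lo hi η * δ * M)]
  refine mul_le_mul_of_nonneg_left ?_ h1
  have hL : 0 ≤ 9 * (2 * hi + 6) / detBound lo hi η ^ 2 := by
    have := r.hi_pos; have := r.detBound_pos
    positivity
  refine mul_le_mul ?_ (r.abs_y_le _ _) (abs_nonneg _) ?_
  · refine (hR'.abs_invCoef_sub_le hR _ _).trans ?_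
    rw [lipBound, mul_assoc (9 * (2 * hi + 6) / detBound lo hi η ^ 2) _ δ]
    refine mul_le_mul_of_nonneg_left ?_ hL
    have h2 : n * p * |a - α| ≤ hi * δ := by
      calc n * p * |a - α| ≤ n * p * (δ * α) := mul_le_mul_of_nonneg_left ha (by positivity)
        _ = n * α * p * δ := by ring
        _ ≤ hi * δ := mul_le_mul_of_nonneg_right r.nap_le' hδ0
    linarith
  · have := r.hi_pos; have := r.detBound_pos; have := r.eta_pos
    unfold lipBound
    positivity

/-- The expected observed degree has the order of `1 / p`, like the true degree. -/
theorem meanDeg_mem (r : Regime G y p α β dbar C₁ C₂ lo hi η ε K M) {i : Fin n}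
    (hi' : |(deg G i : ℝ) - dbar| ≤ ε / 2 * dbar) :
    η * lo ≤ p * meanDeg G α β i ∧ p * meanDeg G α β i ≤ 2 * hi := by
  have hR := r.ratesInRange_true hi'
  have h1 := r.nap_le'
  have h2 : (deg G i : ℝ) + 1 ≤ n := by exact_mod_cast deg_le G i
  have h3 : (0 : ℝ) ≤ deg G i := Nat.cast_nonneg _
  have hp := r.p_pos
  have hα := r.alpha_pos
  have e : p * meanDeg G α β i = ((n : ℝ) - 1 - deg G i) * (α * p) + (1 - β) * (p * deg G i) := by
    rw [meanDeg]; ring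
  have hαp : 0 < α * p := mul_pos hα hp
  rw [e]
  constructor
  · have := mul_le_mul hR.eta_le hR.lo_le r.lo_pos.le (r.eta_pos.le.trans hR.eta_le)
    nlinarith
  · have h4 : (1 - β) * (p * deg G i) ≤ 1 * hi :=
      mul_le_mul (by linarith [r.beta_nonneg]) hR.le_hi (by positivity) zero_le_one
    nlinarith

/-- At a typical vertex the Aronow–Samii weights have the order of the inverse treatment
probability. -/
theorem abs_nodeAS_le (r : Regime G y p α β dbar C₁ C₂ lo hi η ε K M)
    (g : SimpleGraph (Fin n)) (T : Finset (Fin n)) {δ : ℝ} (i : Fin n) (c : Exposure)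
    (hδ : δ ≤ η * lo / 2) (hδ1 : δ ≤ 1) (ht : IsTypical G p α β dbar ε δ g i) :
    |nodeAS G g y T p i c|
      ≤ M / min (1 - Real.exp (-(η * lo / 2))) (Real.exp (-(2 * (2 * hi + 1))))
        * (armInd T i c.treated / armProb p c.treated) := by
  have hp := r.p_pos
  obtain ⟨h1, h2⟩ := r.meanDeg_mem ht.1
  have h3 := abs_lt.1 ht.2
  have h4 : p * (δ / p) = δ := by field_simp
  have h5 : p * (meanDeg G α β i - δ / p) ≤ p * deg g i :=
    mul_le_mul_of_nonneg_left (by linarith) hp.le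
  have h6 : p * deg g i ≤ p * (meanDeg G α β i + δ / p) :=
    mul_le_mul_of_nonneg_left (by linarith) hp.le
  refine NoisyInterference.abs_nodeAS_le G g y ?_ r.abs_y_le T i c (r.armProb_pos _)
    (le_exposureProb g i c hp r.p_le (lo := η * lo / 2) (hi := 2 * hi + 1) ?_ ?_)
  · refine lt_min ?_ (Real.exp_pos _)
    rw [sub_pos, ← Real.exp_zero, Real.exp_lt_exp]
    have := mul_pos r.eta_pos r.lo_pos
    linarith
  · linarith
  · linarith

end Regime

open scoped Classical in
/-- The average over all vertices of `a * ζ / π`, where `ζ` is the indicator of the treatment status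
of the level `c` and `π` its probability, and, at the vertices that are not typical, of the
absolute value of the Aronow–Samii estimator plus `b * ζ / π + e`. -/
noncomputable def atypicalSum {n : ℕ} (G g : SimpleGraph (Fin n)) (y : Fin n → Exposure → ℝ)
    (T : Finset (Fin n)) (p α β dbar ε δ a b e : ℝ) (c : Exposure) : ℝ :=
  (1 / (n : ℝ)) * ∑ i, (a * (armInd T i c.treated / armProb p c.treated)
    + (if IsTypical G p α β dbar ε δ g i then 0 else 1)
      * (b * (armInd T i c.treated / armProb p c.treated) + |nodeAS G g y T p i c| + e))

open scoped Classical in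
/-- The average estimation error of the oracle estimator over the vertices whose degree is close
to the mean degree. -/
noncomputable def oracleError {n : ℕ} (G g : SimpleGraph (Fin n)) (y : Fin n → Exposure → ℝ)
    (T : Finset (Fin n)) (p α β dbar ε : ℝ) (c : Exposure) : ℝ :=
  (1 / (n : ℝ)) * ∑ i with |(deg G i : ℝ) - dbar| ≤ ε / 2 * dbar,
    (oracleMME G g y T p α β i c - y i c)

theorem mme_eq {n : ℕ} (G g : SimpleGraph (Fin n)) (y : Fin n → Exposure → ℝ)
    (T : Finset (Fin n)) (p a b C₁ C₂ : ℝ) (c : Exposure) :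
    mme G g y T p a b C₁ C₂ c = (1 / (n : ℝ)) * ∑ i, nodeEst G g y T p a b C₁ C₂ c i := rfl

namespace Regime

variable {n : ℕ} {G : SimpleGraph (Fin n)} {y : Fin n → Exposure → ℝ}
  {p α β dbar C₁ C₂ lo hi η ε K M : ℝ}

/-- For precise estimates of the error rates, the estimation error splits into the error of the
oracle estimator, a small multiple of the treated fraction, and the contribution of the vertices
that are not typical. -/
theorem abs_mme_sub_ybar_le (r : Regime G y p α β dbar C₁ C₂ lo hi η ε K M)
    (g : SimpleGraph (Fin n)) (T : Finset (Fin n)) {a b δ : ℝ} (c : Exposure)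
    (hδ1 : δ ≤ 1) (hδη : δ ≤ η / 4) (hδε : 2 / η * (1 + 3 * hi) * δ < ε / 2 * lo)
    (ha : |a - α| ≤ δ * α) (hb : |b - β| ≤ δ) :
    |mme G g y T p a b C₁ C₂ c - ybar y c| ≤ |oracleError G g y T p α β dbar ε c|
      + atypicalSum G g y T p α β dbar ε δ (lipBound lo hi η * δ * M)
          (2 * (2 * M / detBound lo hi η)) M c := by
  classical
  have hδ0 : 0 ≤ δ := (abs_nonneg _).trans hb
  have hn : (0 : ℝ) < 1 / n := by have := r.n_pos; positivity
  have hα := r.alpha_pos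
  have ha' := abs_le.1 ha
  have hb' := abs_le.1 hb
  have hwin : ∀ i, C₁ ≤ degreeEst g a b i ∧ degreeEst g a b i < C₂ →
      RatesInRange n p lo hi η (degreeEst g a b i) a b := fun i hw => by
    refine r.ratesInRange hw ?_ ?_ ?_ ?_
    · nlinarith
    · nlinarith [r.two_le_K]
    · linarith [r.eta_le, r.eta_pos]
    · have := r.beta_nonneg; linarith
  have hL : 0 ≤ lipBound lo hi η * δ * M := by
    have := r.hi_pos; have := r.detBound_pos; have := r.eta_pos; have := r.M_nonneg
    unfold lipBound
    positivity
  have hκ : 0 ≤ 2 * M / detBound lo hi η := by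
    have := r.detBound_pos; have := r.M_nonneg
    positivity
  set A := 2 * M / detBound lo hi η
  set L := lipBound lo hi η * δ * M
  set ζ : Fin n → ℝ := fun i => armInd T i c.treated / armProb p c.treated with hζ
  have hζ0 : ∀ i, 0 ≤ ζ i := fun i => div_nonneg (armInd_nonneg _ _ _) (r.armProb_pos _).le
  have hest : ∀ i, |nodeEst G g y T p a b C₁ C₂ c i| ≤ A * ζ i + |nodeAS G g y T p i c| := by
    intro i
    have h1 : 0 ≤ A * ζ i := mul_nonneg hκ (hζ0 i)
    unfold nodeEst
    split_ifs with hw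
    · have := r.abs_nodeMME_le g T i c (hwin i hw)
      linarith [abs_nonneg (nodeAS G g y T p i c)]
    · linarith
  have hterm : ∀ i, |nodeEst G g y T p a b C₁ C₂ c i - y i c
      - (if |(deg G i : ℝ) - dbar| ≤ ε / 2 * dbar then oracleMME G g y T p α β i c - y i c else 0)|
      ≤ L * ζ i + (if IsTypical G p α β dbar ε δ g i then 0 else 1)
          * (2 * A * ζ i + |nodeAS G g y T p i c| + M) := by
    intro i
    have h1 : 0 ≤ A * ζ i := mul_nonneg hκ (hζ0 i)
    have h2 : 0 ≤ L * ζ i := mul_nonneg hL (hζ0 i)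
    have h3 := r.M_nonneg
    by_cases ht : IsTypical G p α β dbar ε δ g i
    · rw [if_pos ht.1, if_pos ht, zero_mul, add_zero, sub_sub_sub_cancel_right]
      exact r.abs_nodeEst_sub_oracleMME_le g T i c hδ1 hδη hδε ht ha hb
    · rw [if_neg ht, one_mul]
      split_ifs with hS
      · rw [sub_sub_sub_cancel_right]
        have h4 := r.abs_oracleMME_le g T hS c
        have h5 := abs_sub (nodeEst G g y T p a b C₁ C₂ c i) (oracleMME G g y T p α β i c)
        linarith [hest i]
      · rw [sub_zero]
        have h4 := r.abs_y_le i c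
        have h5 := abs_sub (nodeEst G g y T p a b C₁ C₂ c i) (y i c)
        linarith [hest i]
  -- subtract the oracle error on the vertices whose true degree is close to the mean degree
  have e : mme G g y T p a b C₁ C₂ c - ybar y c = oracleError G g y T p α β dbar ε c
      + (1 / (n : ℝ)) * ∑ i, (nodeEst G g y T p a b C₁ C₂ c i - y i c
      - (if |(deg G i : ℝ) - dbar| ≤ ε / 2 * dbar
          then oracleMME G g y T p α β i c - y i c else 0)) := by
    rw [mme_eq, ybar, oracleError, Finset.sum_filter, ← mul_add, ← mul_sub,
      ← Finset.sum_sub_distrib, ← Finset.sum_add_distrib]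
    congr 1
    exact Finset.sum_congr rfl fun i _ => by ring
  rw [e]
  refine (abs_add_le _ _).trans (add_le_add_right ?_ _)
  rw [abs_mul, abs_of_pos hn]
  refine mul_le_mul_of_nonneg_left ?_ hn.le
  exact (Finset.abs_sum_le_sum_abs _ _).trans (Finset.sum_le_sum fun i _ => hterm i)

/-- For estimates of the error rates that respect their ranges, the estimator is dominated by a
multiple of the treated fraction plus the contribution of the vertices that are not typical. -/
theorem abs_mme_le (r : Regime G y p α β dbar C₁ C₂ lo hi η ε K M)
    (g : SimpleGraph (Fin n)) (T : Finset (Fin n)) {a b δ : ℝ} (c : Exposure)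
    (hδ : δ ≤ η * lo / 2) (hδ1 : δ ≤ 1)
    (ha0 : 0 ≤ a) (haK : a ≤ K * α) (hb0 : 0 ≤ b) (hb : b ≤ 1 - η) :
    |mme G g y T p a b C₁ C₂ c| ≤ atypicalSum G g y T p α β dbar ε δ
      (2 * M / detBound lo hi η
        + M / min (1 - Real.exp (-(η * lo / 2))) (Real.exp (-(2 * (2 * hi + 1))))) 0 0 c := by
  classical
  have hn : (0 : ℝ) < 1 / n := by have := r.n_pos; positivity
  have hM := r.M_nonneg
  have hκ : 0 ≤ 2 * M / detBound lo hi η := by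
    have := r.detBound_pos
    positivity
  have hκ2 : 0 ≤ M / min (1 - Real.exp (-(η * lo / 2))) (Real.exp (-(2 * (2 * hi + 1)))) := by
    refine div_nonneg hM (le_min ?_ (Real.exp_pos _).le)
    rw [sub_nonneg, Real.exp_le_one_iff]
    have := mul_pos r.eta_pos r.lo_pos
    linarith
  set A := 2 * M / detBound lo hi η
  set B := M / min (1 - Real.exp (-(η * lo / 2))) (Real.exp (-(2 * (2 * hi + 1))))
  rw [mme_eq, abs_mul, abs_of_pos hn]
  refine mul_le_mul_of_nonneg_left ?_ hn.le
  refine (Finset.abs_sum_le_sum_abs _ _).trans (Finset.sum_le_sum fun i _ => ?_)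
  have hζ0 : 0 ≤ armInd T i c.treated / armProb p c.treated :=
    div_nonneg (armInd_nonneg _ _ _) (r.armProb_pos _).le
  rw [zero_mul, zero_add, add_zero, add_mul]
  have h1 := mul_nonneg hκ hζ0
  have h2 := mul_nonneg hκ2 hζ0
  have hAS : |nodeAS G g y T p i c| ≤ B * (armInd T i c.treated / armProb p c.treated)
      + (if IsTypical G p α β dbar ε δ g i then 0 else 1) * |nodeAS G g y T p i c| := by
    split_ifs with ht
    · rw [zero_mul, add_zero]
      exact r.abs_nodeAS_le g T i c hδ hδ1 ht
    · linarith
  have h3 : 0 ≤ (if IsTypical G p α β dbar ε δ g i then (0 : ℝ) else 1)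
      * |nodeAS G g y T p i c| := mul_nonneg (by split_ifs <;> norm_num) (abs_nonneg _)
  unfold nodeEst
  split_ifs with hw
  all_goals first
    | (have h4 := r.abs_nodeMME_le g T i c
        (r.ratesInRange hw ha0 haK (by linarith) (by linarith))
       simp_all only [if_true, if_false]
       linarith)
    | (simp_all only [if_true, if_false]; linarith)

end Regime

section Law

variable {n : ℕ} {Ω : Type*} [MeasurableSpace Ω] {μ : Measure Ω} {G : SimpleGraph (Fin n)}
  {y : Fin n → Exposure → ℝ} {p α β dbar C₁ C₂ lo hi η ε K M : ℝ}
  {Z : Ω → Finset (Fin n)} {H : Ω → SimpleGraph (Fin n)}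

/-- The mean fraction of vertices that are not typical is at most this bound. -/
theorem IsNoisyExperiment.sum_atypical_le (h : IsNoisyExperiment μ G p α β Z H)
    (r : Regime G y p α β dbar C₁ C₂ lo hi η ε K M) {δ : ℝ} (hδ : 0 < δ) [DecidablePred fun i =>
      ¬ |(deg G i : ℝ) - dbar| ≤ ε / 2 * dbar] :
    (1 / (n : ℝ)) * ∑ i, μ.real {ω | ¬ IsTypical G p α β dbar ε δ (H ω) i}
      ≤ ((Finset.univ.filter fun i => ¬ |(deg G i : ℝ) - dbar| ≤ ε / 2 * dbar).card : ℝ) / n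
        + 2 * hi * p / δ ^ 2 := by
  classical
  have := h.isProbabilityMeasure
  have hn : (0 : ℝ) < n := by exact_mod_cast r.n_pos
  have hp := r.p_pos
  have hhi := r.hi_pos
  have hterm : ∀ i, μ.real {ω | ¬ IsTypical G p α β dbar ε δ (H ω) i}
      ≤ (if ¬ |(deg G i : ℝ) - dbar| ≤ ε / 2 * dbar then 1 else 0) + 2 * hi * p / δ ^ 2 := by
    intro i
    by_cases hS : |(deg G i : ℝ) - dbar| ≤ ε / 2 * dbar
    swap
    · rw [if_pos hS]
      exact measureReal_le_one.trans (le_add_of_nonneg_right (by positivity))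
    · rw [if_neg (not_not.2 hS), zero_add]
      have e : {ω | ¬ IsTypical G p α β dbar ε δ (H ω) i}
          = {ω | δ / p ≤ |(deg (H ω) i : ℝ) - meanDeg G α β i|} := by
        ext ω
        simp [IsTypical, hS]
      rw [e]
      refine (h.measureReal_deg_far_le i (div_pos hδ hp)).trans ?_
      have h1 := (r.meanDeg_mem hS).2
      calc meanDeg G α β i / (δ / p) ^ 2 = p * (p * meanDeg G α β i) / δ ^ 2 := by
            field_simp
        _ ≤ p * (2 * hi) / δ ^ 2 := by gcongr
        _ = _ := by ring
  calc _ ≤ (1 / (n : ℝ)) * ∑ i, ((if ¬ |(deg G i : ℝ) - dbar| ≤ ε / 2 * dbar then 1 else 0)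
          + 2 * hi * p / δ ^ 2) :=
        mul_le_mul_of_nonneg_left (Finset.sum_le_sum fun i _ => hterm i) (by positivity)
    _ = _ := by
        rw [Finset.sum_add_distrib, Finset.sum_const, Finset.card_univ, Fintype.card_fin,
          nsmul_eq_mul, Finset.sum_boole, mul_add, one_div_mul_eq_div, one_div,
          inv_mul_cancel_left₀ hn.ne']

/-- The expectation of `atypicalSum`, where the independence of the treated set from the observed
graph makes up for the size of the inverse probability weights. -/
theorem IsNoisyExperiment.integral_atypicalSum_le (h : IsNoisyExperiment μ G p α β Z H)
    (r : Regime G y p α β dbar C₁ C₂ lo hi η ε K M) {δ a b e : ℝ} (c : Exposure) :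
    ∫ ω, atypicalSum G (H ω) y (Z ω) p α β dbar ε δ a b e c ∂μ
      ≤ a + (b + M + e) *
        ((1 / (n : ℝ)) * ∑ i, μ.real {ω | ¬ IsTypical G p α β dbar ε δ (H ω) i}) := by
  classical
  have := h.isProbabilityMeasure
  have hn : (0 : ℝ) < n := by exact_mod_cast r.n_pos
  have hπ := r.armProb_pos c.treated
  set π := armProb p c.treated with hπd
  set t : SimpleGraph (Fin n) → Fin n → ℝ := fun g i =>
    if IsTypical G p α β dbar ε δ g i then 0 else 1 with ht
  have hterm : ∀ i, ∫ ω, (a * (armInd (Z ω) i c.treated / π) + t (H ω) i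
      * (b * (armInd (Z ω) i c.treated / π) + |nodeAS G (H ω) y (Z ω) p i c| + e)) ∂μ
      ≤ a + (b + M + e) * μ.real {ω | ¬ IsTypical G p α β dbar ε δ (H ω) i} := by
    intro i
    have e1 : ∀ ω, a * (armInd (Z ω) i c.treated / π) + t (H ω) i
        * (b * (armInd (Z ω) i c.treated / π) + |nodeAS G (H ω) y (Z ω) p i c| + e)
        = a / π * armInd (Z ω) i c.treated + b / π * (armInd (Z ω) i c.treated * t (H ω) i)
          + t (H ω) i * |nodeAS G (H ω) y (Z ω) p i c| + e * t (H ω) i := by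
      intro ω; ring
    have htint : ∫ ω, t (H ω) i ∂μ = μ.real {ω | ¬ IsTypical G p α β dbar ε δ (H ω) i} := by
      rw [← h.integral_graph_ite fun g => ¬ IsTypical G p α β dbar ε δ g i]
      exact integral_congr_ae (Eventually.of_forall fun ω => by simp only [ht, ite_not])
    have i1 : Integrable (fun ω => a / π * armInd (Z ω) i c.treated) μ :=
      h.integrable_comp fun T _ => a / π * armInd T i c.treated
    have i2 : Integrable (fun ω => b / π * (armInd (Z ω) i c.treated * t (H ω) i)) μ :=
      h.integrable_comp fun T g => b / π * (armInd T i c.treated * t g i)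
    have i3 : Integrable (fun ω => t (H ω) i * |nodeAS G (H ω) y (Z ω) p i c|) μ :=
      h.integrable_comp fun T g => t g i * |nodeAS G g y T p i c|
    have i4 : Integrable (fun ω => e * t (H ω) i) μ := h.integrable_comp fun _ g => e * t g i
    have i12 : Integrable (fun ω => a / π * armInd (Z ω) i c.treated
      + b / π * (armInd (Z ω) i c.treated * t (H ω) i)) μ := i1.add i2
    have i123 : Integrable (fun ω => a / π * armInd (Z ω) i c.treated
      + b / π * (armInd (Z ω) i c.treated * t (H ω) i)
      + t (H ω) i * |nodeAS G (H ω) y (Z ω) p i c|) μ := i12.add i3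
    have h3 := h.integral_mul_abs_nodeAS_le y r.M_nonneg r.abs_y_le i c (fun g => t g i)
      (fun g => by simp only [ht]; split_ifs <;> norm_num)
    simp_rw [e1]
    rw [integral_add i123 i4, integral_add i12 i3, integral_add i1 i2, integral_const_mul,
      integral_const_mul, integral_const_mul, h.integral_armInd,
      h.integral_armInd_mul c.treated i fun g => t g i, ← hπd, htint]
    rw [htint] at h3
    have e2 : a / π * π = a := by field_simp
    have e3 : b / π * (π * μ.real {ω | ¬ IsTypical G p α β dbar ε δ (H ω) i})
        = b * μ.real {ω | ¬ IsTypical G p α β dbar ε δ (H ω) i} := by field_simp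
    rw [e2, e3]
    linarith
  unfold atypicalSum
  rw [integral_const_mul, integral_finsetSum]
  · calc _ ≤ (1 / (n : ℝ)) * ∑ i, (a + (b + M + e) *
          μ.real {ω | ¬ IsTypical G p α β dbar ε δ (H ω) i}) :=
          mul_le_mul_of_nonneg_left (Finset.sum_le_sum fun i _ => hterm i) (by positivity)
      _ = _ := by
          rw [Finset.sum_add_distrib, Finset.sum_const, Finset.card_univ, Fintype.card_fin,
            nsmul_eq_mul, ← Finset.mul_sum]
          field_simp
  · exact fun i _ => h.integrable_comp fun T g => a * (armInd T i c.treated / π)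
      + t g i * (b * (armInd T i c.treated / π) + |nodeAS G g y T p i c| + e)

theorem integral_abs_le_sqrt [IsProbabilityMeasure μ] {f : Ω → ℝ} (hf : Integrable f μ)
    (hf2 : Integrable (fun ω => f ω ^ 2) μ) :
    ∫ ω, |f ω| ∂μ ≤ √(∫ ω, f ω ^ 2 ∂μ) := by
  apply Real.le_sqrt_of_sq_le
  set m := ∫ ω, |f ω| ∂μ with hm
  have h1 : 0 ≤ ∫ ω, (|f ω| - m) * (|f ω| - m) ∂μ :=
    integral_nonneg fun ω => mul_self_nonneg _
  have e : (fun ω => |f ω| * |f ω|) = fun ω => f ω ^ 2 := by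
    funext ω; rw [← sq, sq_abs]
  rw [integral_sub_mul_sub hf.abs hf.abs (by rw [e]; exact hf2), e, ← hm] at h1
  linarith

open scoped Classical in
/-- The mean absolute error of the oracle estimator. -/
theorem IsNoisyExperiment.integral_abs_oracleError_le (h : IsNoisyExperiment μ G p α β Z H)
    (r : Regime G y p α β dbar C₁ C₂ lo hi η ε K M) (c : Exposure) :
    ∫ ω, |oracleError G (H ω) y (Z ω) p α β dbar ε c| ∂μ
      ≤ 4 * (4 * (2 * M / detBound lo hi η)
        * √(1 / (n * armProb p c.treated) + (2 * (hi / (p * n)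
            + (1 - pairsWithoutCommonNeighbor G / (n : ℝ) ^ 2))
          + α * (3 + 3 * hi)))) := by
  have := h.isProbabilityMeasure
  have hn : (0 : ℝ) < n := by exact_mod_cast r.n_pos
  have hπ := r.armProb_pos c.treated
  have hp := r.p_pos
  have hM := r.M_nonneg
  have hκ := r.detBound_pos
  have hhi := r.hi_pos
  set π := armProb p c.treated with hπd
  set S : Finset (Fin n) := Finset.univ.filter fun i => |(deg G i : ℝ) - dbar| ≤ ε / 2 * dbar
    with hSdef
  have hS : ∀ i ∈ S, |(deg G i : ℝ) - dbar| ≤ ε / 2 * dbar := fun i hi =>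
    (Finset.mem_filter.1 hi).2
  set A := 4 * (2 * M / detBound lo hi η) with hA
  have hA0 : 0 ≤ A := by positivity
  set f : Bool → Bool → Finset (Fin n) → SimpleGraph (Fin n) → ℝ := fun s t T g =>
    ∑ i ∈ S, isoCoef (oracleCoef G y p α β i c) s t * (isoInd G c.treated s t i T g
      - ∫ ω, isoInd G c.treated s t i (Z ω) (H ω) ∂μ) with hf
  set W := 1 / (n * π) + (2 * (hi / (p * n) + (1 - pairsWithoutCommonNeighbor G / (n : ℝ) ^ 2))
          + α * (3 + 3 * hi)) with hW
  -- the oracle error is a combination of four weighted sums of centred isolation indicators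
  have hdecomp : ∀ T g, oracleError G g y T p α β dbar ε c
      = (1 / (n * π)) * ∑ s, ∑ t, f s t T g := by
    intro T g
    unfold oracleError
    have e1 : ∀ i ∈ S, oracleMME G g y T p α β i c - y i c
        = 1 / π * ∑ s, ∑ t, isoCoef (oracleCoef G y p α β i c) s t * (isoInd G c.treated s t i T g
          - ∫ ω, isoInd G c.treated s t i (Z ω) (H ω) ∂μ) := by
      intro i hi
      rw [oracleMME, h.nodeMME_sub_eq y i c hπ.ne' (r.ratesInRange_true (hS i hi)).det_ne_zero
        (oracleCoef G y p α β i c) rfl T g, Finset.mul_sum]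
      refine Finset.sum_congr rfl fun s _ => ?_
      rw [Finset.mul_sum]
      refine Finset.sum_congr rfl fun t _ => ?_
      rw [← hπd]
      ring
    rw [Finset.sum_congr rfl e1, ← Finset.mul_sum, Finset.sum_comm]
    have e2 : ∀ s : Bool, ∑ i ∈ S, ∑ t, isoCoef (oracleCoef G y p α β i c) s t
        * (isoInd G c.treated s t i T g - ∫ ω, isoInd G c.treated s t i (Z ω) (H ω) ∂μ)
        = ∑ t, f s t T g := fun s => Finset.sum_comm
    simp_rw [e2]
    rw [← mul_assoc]
    congr 1
    field_simp
  have hbound : ∀ s t, ∫ ω, |f s t (Z ω) (H ω)| ∂μ ≤ n * π * (A * √W) := by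
    intro s t
    refine (integral_abs_le_sqrt (h.integrable_comp (f s t))
      (h.integrable_comp fun T g => f s t T g ^ 2)).trans ?_
    have h1 := h.integral_sq_sum_isoInd_le c.treated s t S
      (fun i => isoCoef (oracleCoef G y p α β i c) s t) (A := A) (D := hi / p) hA0 (by positivity)
      (fun i hi => abs_isoCoef_le (r.abs_oracleCoef_le (hS i hi) c) s t)
      (fun i hi => by
        rw [le_div_iff₀ hp, mul_comm]
        exact (r.ratesInRange_true (hS i hi)).le_hi)
    have h2 : A ^ 2 * (n * π + π ^ 2 *
        (2 * (n * (hi / p) + ((n : ℝ) ^ 2 - pairsWithoutCommonNeighbor G))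
          + (n : ℝ) ^ 2 * (α * (3 + 2 * (p * (hi / p)) + n * p * α))))
        ≤ (n * π * A) ^ 2 * W := by
      have h3 : α * (3 + 2 * (p * (hi / p)) + n * p * α) ≤ α * (3 + 3 * hi) := by
        refine mul_le_mul_of_nonneg_left ?_ r.alpha_pos.le
        have e3 : p * (hi / p) = hi := by field_simp
        have := r.nap_le'
        rw [e3]
        linarith
      have e4 : (n * π * A) ^ 2 * W = A ^ 2 * (n * π + π ^ 2 *
        (2 * (n * (hi / p) + ((n : ℝ) ^ 2 - pairsWithoutCommonNeighbor G))
          + (n : ℝ) ^ 2 * (α * (3 + 3 * hi)))) := by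
        rw [hW]
        field_simp
      rw [e4]
      gcongr
    calc _ ≤ √((n * π * A) ^ 2 * W) := Real.sqrt_le_sqrt (h1.trans h2)
      _ = n * π * (A * √W) := by
        rw [Real.sqrt_mul (sq_nonneg _), Real.sqrt_sq (by positivity)]
        ring
  have hfi : ∀ s t, Integrable (fun ω => |f s t (Z ω) (H ω)|) μ := fun s t =>
    h.integrable_comp fun T g => |f s t T g|
  calc _ ≤ ∫ ω, (1 / (n * π)) * ∑ s, ∑ t, |f s t (Z ω) (H ω)| ∂μ := by
        refine integral_mono (h.integrable_comp fun T g => |oracleError G g y T p α β dbar ε c|)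
          (h.integrable_comp fun T g => (1 / (n * π)) * ∑ s, ∑ t, |f s t T g|) fun ω => ?_
        dsimp only
        rw [hdecomp, abs_mul, abs_of_pos (show 0 < 1 / (n * π) by positivity)]
        refine mul_le_mul_of_nonneg_left ?_ (by positivity)
        exact (Finset.abs_sum_le_sum_abs _ _).trans (Finset.sum_le_sum fun s _ =>
          Finset.abs_sum_le_sum_abs _ _)
    _ = (1 / (n * π)) * ∑ s, ∑ t, ∫ ω, |f s t (Z ω) (H ω)| ∂μ := by
        rw [integral_const_mul, integral_finsetSum _ fun s _ => integrable_finsetSum _ fun t _ =>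
          hfi s t]
        congr 1
        exact Finset.sum_congr rfl fun s _ => integral_finsetSum _ fun t _ => hfi s t
    _ ≤ (1 / (n * π)) * ∑ _s : Bool, ∑ _t : Bool, n * π * (A * √W) := by
        refine mul_le_mul_of_nonneg_left ?_ (by positivity)
        exact Finset.sum_le_sum fun s _ => Finset.sum_le_sum fun t _ => hbound s t
    _ = 4 * (A * √W) := by
        simp only [Fintype.sum_bool]
        field_simp
        norm_num

/-- The normalized fraction of vertices with treatment status `τ` is at most `2` up to an error that
vanishes in mean; this provides uniform integrability. -/
theorem avg_armInd_le (T : Finset (Fin n)) (τ : Bool) (p : ℝ)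
    (hn : 0 < n) (hπ : 0 < armProb p τ) :
    (1 / (n : ℝ)) * ∑ i, armInd T i τ / armProb p τ
      ≤ 2 + (∑ i, (armInd T i τ - armProb p τ)) ^ 2 / (n * armProb p τ) ^ 2 := by
  have hn' : (0 : ℝ) < n := by exact_mod_cast hn
  rw [← Finset.sum_div, Finset.sum_sub_distrib, Finset.sum_const, Finset.card_univ,
    Fintype.card_fin, nsmul_eq_mul]
  set s := ∑ i, armInd T i τ
  set π := armProb p τ
  have e : (s - n * π) ^ 2 / (n * π) ^ 2 = (1 / (n : ℝ) * (s / π) - 1) ^ 2 := by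
    field_simp
  rw [e]
  nlinarith [sq_nonneg (1 / (n : ℝ) * (s / π) - 1 - 1 / 2)]

end Law

/-! ### Measurability of the estimator -/

theorem measurable_matrix_det {X ι : Type*} [MeasurableSpace X] [Fintype ι] [DecidableEq ι]
    {A : X → Matrix ι ι ℝ} (hA : ∀ i j, Measurable fun x => A x i j) :
    Measurable fun x => (A x).det := by
  simp_rw [Matrix.det_apply]
  exact Finset.measurable_sum _ fun σ _ =>
    (Finset.measurable_prod _ fun i _ => hA _ _).const_smul _

theorem measurable_matrix_inv {X ι : Type*} [MeasurableSpace X] [Fintype ι] [DecidableEq ι]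
    {A : X → Matrix ι ι ℝ} (hA : ∀ i j, Measurable fun x => A x i j) (i j : ι) :
    Measurable fun x => (A x)⁻¹ i j := by
  simp_rw [Matrix.inv_def, Matrix.smul_apply, Ring.inverse_eq_inv', Matrix.adjugate_apply,
    smul_eq_mul]
  refine (measurable_matrix_det hA).inv.mul (measurable_matrix_det fun k l => ?_)
  by_cases hk : k = j
  · subst hk
    simp only [Matrix.updateRow_self]
    exact measurable_const
  · simp only [Matrix.updateRow_ne hk]
    exact hA k l

theorem measurable_confusion {X : Type*} [MeasurableSpace X] (n : ℕ) (p : ℝ) {d a b : X → ℝ}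
    (hd : Measurable d) (ha : Measurable a) (hb : Measurable b) (o t : Exposure) :
    Measurable fun x => confusion n p (d x) (a x) (b x) o t := by
  cases o <;> cases t <;> simp only [confusion, Matrix.of_apply] <;> fun_prop

theorem measurable_mme {n : ℕ} (G g : SimpleGraph (Fin n)) (y : Fin n → Exposure → ℝ)
    (T : Finset (Fin n)) (p C₁ C₂ : ℝ) (c : Exposure) :
    Measurable fun x : ℝ × ℝ => mme G g y T p x.1 x.2 C₁ C₂ c := by
  have hd : ∀ i, Measurable fun x : ℝ × ℝ => degreeEst g x.1 x.2 i := by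
    intro i
    unfold degreeEst
    fun_prop
  unfold mme
  refine (Finset.measurable_sum _ fun i _ => Measurable.ite ?_ ?_ measurable_const).const_mul _
  · exact (measurableSet_le measurable_const (hd i)).inter
      (measurableSet_lt (hd i) measurable_const)
  · unfold nodeMME Matrix.mulVec dotProduct
    exact Finset.measurable_sum _ fun o _ => (measurable_matrix_inv (fun k l =>
      measurable_confusion n p (hd i) measurable_fst measurable_snd k l) _ _).mul_const _

section Law

variable {n : ℕ} {Ω : Type*} [MeasurableSpace Ω] {μ : Measure Ω} {G : SimpleGraph (Fin n)}
  {y : Fin n → Exposure → ℝ} {p α β dbar C₁ C₂ lo hi η ε K M : ℝ}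
  {Z : Ω → Finset (Fin n)} {H : Ω → SimpleGraph (Fin n)}

theorem IsNoisyExperiment.aestronglyMeasurable_mme (h : IsNoisyExperiment μ G p α β Z H)
    (y : Fin n → Exposure → ℝ) (p' C₁ C₂ : ℝ) (c : Exposure) {a b : Ω → ℝ}
    (ha : AEMeasurable a μ) (hb : AEMeasurable b μ) :
    AEStronglyMeasurable (fun ω => mme G (H ω) y (Z ω) p' (a ω) (b ω) C₁ C₂ c) μ := by
  have hm : Measurable fun ω => mme G (H ω) y (Z ω) p' (ha.mk a ω) (hb.mk b ω) C₁ C₂ c := by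
    intro s hs
    have e : (fun ω => mme G (H ω) y (Z ω) p' (ha.mk a ω) (hb.mk b ω) C₁ C₂ c) ⁻¹' s
        = ⋃ T : Finset (Fin n), ⋃ g : SimpleGraph (Fin n), {ω | Z ω = T} ∩ {ω | H ω = g} ∩
          (fun ω => mme G g y T p' (ha.mk a ω) (hb.mk b ω) C₁ C₂ c) ⁻¹' s := by
      ext ω; simp
    rw [e]
    exact MeasurableSet.iUnion fun T => MeasurableSet.iUnion fun g =>
      ((h.measurableSet_treated_eq T).inter (h.measurableSet_graph_eq g)).inter
        (((measurable_mme G g y T p' C₁ C₂ c).comp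
          (ha.measurable_mk.prodMk hb.measurable_mk)) hs)
  refine hm.aestronglyMeasurable.congr ?_
  filter_upwards [ha.ae_eq_mk, hb.ae_eq_mk] with ω h1 h2
  rw [h1, h2]

/-! ### Passage from probability to mean -/

/-- A dominated random variable is small in mean if it is small in probability. -/
theorem integral_abs_le_of_dominated [IsProbabilityMeasure μ] {X R : Ω → ℝ} {B ξ : ℝ}
    (hX : Integrable X μ) (hR : Integrable R μ) (hB : 0 ≤ B) (hξ : 0 ≤ ξ) (hR0 : ∀ ω, 0 ≤ R ω)
    (hdom : ∀ᵐ ω ∂μ, |X ω| ≤ B + R ω) :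
    ∫ ω, |X ω| ∂μ ≤ ξ + B * μ.real {ω | ξ ≤ |X ω|} + ∫ ω, R ω ∂μ := by
  -- a measurable hull, since `X` is only almost everywhere measurable
  set S := toMeasurable μ {ω | ξ ≤ |X ω|} with hS
  have hSm : MeasurableSet S := measurableSet_toMeasurable _ _
  have hSe : μ.real S = μ.real {ω | ξ ≤ |X ω|} := by
    rw [measureReal_def, measureReal_def, hS, measure_toMeasurable]
  have hI : Integrable (S.indicator fun _ => B) μ := (integrable_const B).indicator hSm
  have hi : Integrable (fun ω => ξ + S.indicator (fun _ => B) ω) μ := (integrable_const ξ).add hI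
  calc ∫ ω, |X ω| ∂μ ≤ ∫ ω, ξ + S.indicator (fun _ => B) ω + R ω ∂μ := by
        refine integral_mono_ae hX.abs (hi.add hR) ?_
        filter_upwards [hdom] with ω hω
        by_cases hs : ξ ≤ |X ω|
        · have hmem : ω ∈ S := subset_toMeasurable μ _ hs
          simp only [Set.indicator_of_mem hmem]
          linarith
        · have h0 : 0 ≤ S.indicator (fun _ => B) ω := Set.indicator_nonneg (fun _ _ => hB) ω
          push Not at hs
          change |X ω| ≤ ξ + S.indicator (fun _ => B) ω + R ω
          linarith [hR0 ω]
    _ = _ := by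
        rw [integral_add hi hR, integral_add (integrable_const ξ) hI,
          integral_indicator_const _ hSm, hSe]
        simp [mul_comm]

/-! ### The two conclusions for a single graph -/

theorem atypicalSum_nonneg (r : Regime G y p α β dbar C₁ C₂ lo hi η ε K M)
    (g : SimpleGraph (Fin n)) (T : Finset (Fin n)) {δ a b e : ℝ} (ha : 0 ≤ a) (hb : 0 ≤ b)
    (he : 0 ≤ e) (c : Exposure) : 0 ≤ atypicalSum G g y T p α β dbar ε δ a b e c := by
  have hζ0 : ∀ i, 0 ≤ armInd T i c.treated / armProb p c.treated :=
    fun i => div_nonneg (armInd_nonneg _ _ _) (r.armProb_pos _).le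
  refine mul_nonneg (by positivity) (Finset.sum_nonneg fun i _ => ?_)
  have := hζ0 i
  split_ifs <;> positivity

/-- The estimator deviates with small probability, for precise estimates of the error rates. -/
theorem IsNoisyExperiment.measure_mme_far_le (h : IsNoisyExperiment μ G p α β Z H)
    (r : Regime G y p α β dbar C₁ C₂ lo hi η ε K M) (c : Exposure) {a b : Ω → ℝ} {δ ξ : ℝ}
    (hξ : 0 < ξ) (hδ0 : 0 < δ)
    (hδ1 : δ ≤ 1) (hδη : δ ≤ η / 4) (hδε : 2 / η * (1 + 3 * hi) * δ < ε / 2 * lo) :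
    μ {ω | ξ ≤ |mme G (H ω) y (Z ω) p (a ω) (b ω) C₁ C₂ c - ybar y c|}
      ≤ μ {ω | δ ≤ |a ω / α - 1|} + μ {ω | δ ≤ |b ω - β|}
        + ENNReal.ofReal ((∫ ω, |oracleError G (H ω) y (Z ω) p α β dbar ε c| ∂μ
          + (lipBound lo hi η * δ * M + (2 * (2 * M / detBound lo hi η) + M + M)
            * ((1 / (n : ℝ)) * ∑ i, μ.real {ω | ¬ IsTypical G p α β dbar ε δ (H ω) i}))) / ξ) := by
  have := h.isProbabilityMeasure
  have hα := r.alpha_pos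
  set A := 2 * (2 * M / detBound lo hi η) with hA
  set L := lipBound lo hi η * δ * M with hL
  have hA0 : 0 ≤ A := by
    have := r.detBound_pos; have := r.M_nonneg
    positivity
  have hL0 : 0 ≤ L := by
    have := r.hi_pos; have := r.detBound_pos; have := r.eta_pos; have := r.M_nonneg
    rw [hL]
    unfold lipBound
    positivity
  set Q : Finset (Fin n) → SimpleGraph (Fin n) → ℝ := fun T g =>
    |oracleError G g y T p α β dbar ε c| + atypicalSum G g y T p α β dbar ε δ L A M c with hQ
  have hsub : {ω | ξ ≤ |mme G (H ω) y (Z ω) p (a ω) (b ω) C₁ C₂ c - ybar y c|}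
      ⊆ ({ω | δ ≤ |a ω / α - 1|} ∪ {ω | δ ≤ |b ω - β|}) ∪ {ω | ξ ≤ Q (Z ω) (H ω)} := by
    intro ω hω
    by_cases h1 : δ ≤ |a ω / α - 1|
    · exact Or.inl (Or.inl h1)
    by_cases h2 : δ ≤ |b ω - β|
    · exact Or.inl (Or.inr h2)
    right
    push Not at h1 h2
    have h3 : |a ω - α| ≤ δ * α := by
      have e : a ω / α - 1 = (a ω - α) / α := by field_simp
      rw [e, abs_div, abs_of_pos hα, div_lt_iff₀ hα] at h1
      exact h1.le
    exact le_trans hω (r.abs_mme_sub_ybar_le (H ω) (Z ω) c hδ1 hδη hδε h3 h2.le)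
  have hQ0 : ∀ T g, 0 ≤ Q T g := fun T g =>
    add_nonneg (abs_nonneg _) (atypicalSum_nonneg r g T hL0 hA0 r.M_nonneg c)
  have hQint : ∫ ω, Q (Z ω) (H ω) ∂μ ≤ ∫ ω, |oracleError G (H ω) y (Z ω) p α β dbar ε c| ∂μ
      + (L + (A + M + M) * ((1 / (n : ℝ)) *
        ∑ i, μ.real {ω | ¬ IsTypical G p α β dbar ε δ (H ω) i})) := by
    rw [hQ]
    dsimp only
    rw [integral_add (h.integrable_comp fun T g => |oracleError G g y T p α β dbar ε c|)
      (h.integrable_comp fun T g => atypicalSum G g y T p α β dbar ε δ L A M c)]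
    exact add_le_add_right (h.integral_atypicalSum_le r c) _
  refine (measure_mono hsub).trans ((measure_union_le _ _).trans
    (add_le_add (measure_union_le _ _) ?_))
  rw [← ofReal_measureReal]
  refine ENNReal.ofReal_le_ofReal ?_
  rw [le_div_iff₀ hξ, mul_comm]
  exact (mul_meas_ge_le_integral_of_nonneg (Eventually.of_forall fun ω => hQ0 _ _)
    (h.integrable_comp Q) ξ).trans hQint

/-- The constant that dominates the estimator under range-respecting estimates of the error rates. -/
noncomputable def domBound (lo hi η M : ℝ) : ℝ :=
  2 * M / detBound lo hi η
    + M / min (1 - Real.exp (-(η * lo / 2))) (Real.exp (-(2 * (2 * hi + 1))))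

theorem domBound_nonneg (r : Regime G y p α β dbar C₁ C₂ lo hi η ε K M) :
    0 ≤ domBound lo hi η M := by
  have hM := r.M_nonneg
  have := r.detBound_pos
  refine add_nonneg (by positivity) (div_nonneg hM (le_min ?_ (Real.exp_pos _).le))
  rw [sub_nonneg, Real.exp_le_one_iff]
  have := mul_pos r.eta_pos r.lo_pos
  linarith

theorem abs_ybar_le (r : Regime G y p α β dbar C₁ C₂ lo hi η ε K M) (c : Exposure) :
    |ybar y c| ≤ M := by
  have hn : (0 : ℝ) < n := by exact_mod_cast r.n_pos
  rw [ybar, abs_mul, abs_of_pos (show (0 : ℝ) < 1 / n by positivity), one_div, inv_mul_le_iff₀ hn]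
  refine (Finset.abs_sum_le_sum_abs _ _).trans ?_
  refine (Finset.sum_le_sum fun i _ => r.abs_y_le i c).trans (le_of_eq ?_)
  simp

/-- Under range-respecting estimates of the error rates, the estimator is integrable, and its error
is small in mean once it is small in probability. -/
theorem IsNoisyExperiment.integral_abs_mme_sub_le (h : IsNoisyExperiment μ G p α β Z H)
    (r : Regime G y p α β dbar C₁ C₂ lo hi η ε K M) (c : Exposure) {a b : Ω → ℝ} {δ ξ : ℝ}
    (ha : AEMeasurable a μ) (hb : AEMeasurable b μ)
    (hrange : ∀ᵐ ω ∂μ, 0 ≤ a ω ∧ a ω ≤ K * α ∧ 0 ≤ b ω ∧ b ω ≤ 1 - η)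
    (hξ : 0 < ξ) (hδ : δ ≤ η * lo / 2) (hδ1 : δ ≤ 1) :
    Integrable (fun ω => mme G (H ω) y (Z ω) p (a ω) (b ω) C₁ C₂ c) μ ∧
    ∫ ω, |mme G (H ω) y (Z ω) p (a ω) (b ω) C₁ C₂ c - ybar y c| ∂μ
      ≤ ξ + (2 * domBound lo hi η M + M) * μ.real {ω | ξ ≤
          |mme G (H ω) y (Z ω) p (a ω) (b ω) C₁ C₂ c - ybar y c|}
        + (domBound lo hi η M * (1 / (n * armProb p c.treated))
          + M * ((1 / (n : ℝ)) * ∑ i, μ.real {ω | ¬ IsTypical G p α β dbar ε δ (H ω) i})) := by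
  have := h.isProbabilityMeasure
  have hn : (0 : ℝ) < n := by exact_mod_cast r.n_pos
  have hπ := r.armProb_pos c.treated
  set π := armProb p c.treated with hπd
  have hB0 := domBound_nonneg r
  have hM := r.M_nonneg
  have hbound : ∀ᵐ ω ∂μ, |mme G (H ω) y (Z ω) p (a ω) (b ω) C₁ C₂ c|
      ≤ atypicalSum G (H ω) y (Z ω) p α β dbar ε δ (domBound lo hi η M) 0 0 c := by
    filter_upwards [hrange] with ω hω
    exact r.abs_mme_le (H ω) (Z ω) c hδ hδ1 hω.1 hω.2.1 hω.2.2.1 hω.2.2.2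
  have hint : Integrable (fun ω => mme G (H ω) y (Z ω) p (a ω) (b ω) C₁ C₂ c) μ :=
    Integrable.mono' (h.integrable_comp fun T g =>
        atypicalSum G g y T p α β dbar ε δ (domBound lo hi η M) 0 0 c)
      (h.aestronglyMeasurable_mme y p C₁ C₂ c ha hb) hbound
  refine ⟨hint, ?_⟩
  set B := domBound lo hi η M
  -- `V` is the part of the dominating function that is small in mean but not bounded
  set V : Finset (Fin n) → SimpleGraph (Fin n) → ℝ := fun T g =>
    B * ((∑ i, (armInd T i c.treated - π)) ^ 2 / (n * π) ^ 2)
      + atypicalSum G g y T p α β dbar ε δ 0 0 0 c with hV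
  have hV0 : ∀ T g, 0 ≤ V T g := fun T g =>
    add_nonneg (by positivity) (atypicalSum_nonneg r g T le_rfl le_rfl le_rfl c)
  have hdom : ∀ᵐ ω ∂μ, |mme G (H ω) y (Z ω) p (a ω) (b ω) C₁ C₂ c - ybar y c|
      ≤ (2 * B + M) + V (Z ω) (H ω) := by
    filter_upwards [hbound] with ω hω
    have h1 := abs_sub (mme G (H ω) y (Z ω) p (a ω) (b ω) C₁ C₂ c) (ybar y c)
    have h2 := abs_ybar_le r c
    have h3 : atypicalSum G (H ω) y (Z ω) p α β dbar ε δ B 0 0 c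
        = B * ((1 / (n : ℝ)) * ∑ i, armInd (Z ω) i c.treated / π)
          + atypicalSum G (H ω) y (Z ω) p α β dbar ε δ 0 0 0 c := by
      unfold atypicalSum
      simp only [zero_mul, zero_add, add_zero]
      rw [Finset.sum_add_distrib, ← Finset.mul_sum]
      ring
    have h4 := mul_le_mul_of_nonneg_left (avg_armInd_le (Z ω) c.treated p r.n_pos hπ) hB0
    rw [h3] at hω
    simp only [hV]
    linarith
  refine (integral_abs_le_of_dominated (ξ := ξ) (hint.sub (integrable_const _))
    (h.integrable_comp V) (by positivity) hξ.le (fun ω => hV0 _ _) hdom).trans ?_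
  refine add_le_add_right ?_ _
  have i1 : Integrable (fun ω => B * ((∑ i, (armInd (Z ω) i c.treated - π)) ^ 2 / (n * π) ^ 2)) μ :=
    h.integrable_comp fun T _ => B * ((∑ i, (armInd T i c.treated - π)) ^ 2 / (n * π) ^ 2)
  simp only [hV]
  rw [integral_add i1 (h.integrable_comp fun T g => atypicalSum G g y T p α β dbar ε δ 0 0 0 c),
    integral_const_mul, integral_div]
  refine add_le_add (mul_le_mul_of_nonneg_left ?_ hB0) ?_
  · have h5 := h.integral_sq_sum_armInd_le c.treated
    rw [← hπd] at h5
    calc _ ≤ n * π / (n * π) ^ 2 := div_le_div_of_nonneg_right h5 (by positivity)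
      _ = _ := by field_simp
  · have := h.integral_atypicalSum_le r (δ := δ) (a := 0) (b := 0) (e := 0) c
    simpa using this

end Law

/-! ### Asymptotics -/

theorem tendsto_mul_atTop_of_isLittleO {N : ℕ → ℕ} {p : ℕ → ℝ} (hp0 : ∀ m, 0 ≤ p m)
    (hN : Tendsto N atTop atTop) (hpN : (fun m => 1 / (N m : ℝ)) =o[atTop] p) :
    Tendsto (fun m => p m * N m) atTop atTop := by
  rw [tendsto_atTop]
  intro b
  have h1 := hpN.def (show (0 : ℝ) < 1 / (|b| + 1) by positivity)
  filter_upwards [h1, hN.eventually_gt_atTop 0] with m h2 h3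
  have hn : (0 : ℝ) < N m := by exact_mod_cast h3
  rw [Real.norm_of_nonneg (by positivity), Real.norm_of_nonneg (hp0 m), div_mul_eq_mul_div, one_mul,
    div_le_div_iff₀ hn (by positivity)] at h2
  linarith [le_abs_self b]

theorem eventually_pos_of_isLittleO {N : ℕ → ℕ} {p : ℕ → ℝ} (hp0 : ∀ m, 0 ≤ p m)
    (hN : Tendsto N atTop atTop) (hpN : (fun m => 1 / (N m : ℝ)) =o[atTop] p) :
    ∀ᶠ m in atTop, 0 < p m := by
  filter_upwards [(tendsto_mul_atTop_of_isLittleO hp0 hN hpN).eventually_gt_atTop 0] with m h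
  exact lt_of_le_of_ne (hp0 m) fun h0 => by rw [← h0, zero_mul] at h; exact lt_irrefl _ h

theorem IsHomogeneous.dbar_nonneg {N : ℕ → ℕ} {G : ∀ m, SimpleGraph (Fin (N m))}
    {dbar : ℕ → ℝ} (h : IsHomogeneous N G dbar) (m : ℕ) : 0 ≤ dbar m := by
  obtain ⟨rate, hrate, -⟩ := h
  rw [(hrate m).2]
  exact integral_nonneg fun k => Nat.cast_nonneg k

/-- Under the assumptions of the theorem, the graphs are eventually in the regime of the
single-graph bounds, with constants that do not depend on the graph. -/
theorem exists_regime {N : ℕ → ℕ} {G : ∀ m, SimpleGraph (Fin (N m))}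
    {p α β dbar : ℕ → ℝ} {y : ∀ m, Fin (N m) → Exposure → ℝ} {C₁ C₂ : ℕ → ℝ}
    (hp01 : ∀ m, p m ∈ Set.Icc (0 : ℝ) 1) (hα01 : ∀ m, α m ∈ Set.Icc (0 : ℝ) 1)
    (hβ01 : ∀ m, β m ∈ Set.Icc (0 : ℝ) 1)
    (hhom : IsHomogeneous N G dbar) (hN : Tendsto N atTop atTop)
    (hp : p =o[atTop] fun _ => (1 : ℝ)) (hpN : (fun m => 1 / (N m : ℝ)) =o[atTop] p)
    (hy : ∃ c : ℝ, ∀ m i k, |y m i k| ≤ c)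
    (hβ : (fun _ => (1 : ℝ)) =O[atTop] fun m => 1 - β m)
    (hα : α =Θ[atTop] fun m => 1 / (p m * (N m : ℝ)))
    (hα0 : Tendsto α atTop (𝓝 0))
    (hwin : IsDegreeWindow p dbar C₁ C₂) {K η₀ : ℝ} (hK : 2 ≤ K) (hη₀ : 0 < η₀) :
    ∃ lo hi η ε M : ℝ, η ≤ η₀ ∧ ∀ᶠ m in atTop,
      Regime (G m) (y m) (p m) (α m) (β m) (dbar m) (C₁ m) (C₂ m) lo hi η ε K M := by
  obtain ⟨a, ha, b, hb, ε, hε, hw⟩ := hwin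
  obtain ⟨M, hM⟩ := hy
  obtain ⟨L, hL, hαL⟩ := hα.1.exists_pos
  obtain ⟨l, hl, hαl⟩ := hα.2.exists_pos
  obtain ⟨q, hq, hβq⟩ := hβ.exists_pos
  have hp' : Tendsto p atTop (𝓝 0) := (isLittleO_one_iff ℝ).1 hp
  have hpn := tendsto_mul_atTop_of_isLittleO (fun m => (hp01 m).1) hN hpN
  have hppos := eventually_pos_of_isLittleO (fun m => (hp01 m).1) hN hpN
  set η := min (1 / (2 * q)) η₀ with hη
  have hη0 : 0 < η := lt_min (by positivity) hη₀
  refine ⟨a, max b (K * L), η, ε, M, min_le_right _ _, ?_⟩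
  filter_upwards [hw, hαL.bound, hαl.bound, hβq.bound, hppos,
    hp'.eventually_le_const (show (0 : ℝ) < 1 / 4 by norm_num),
    hα0.eventually_le_const (show (0 : ℝ) < η / 8 by positivity),
    hα0.eventually_le_const (show (0 : ℝ) < 1 / K by positivity),
    hpn.eventually_ge_atTop (2 * b), hN.eventually_ge_atTop 2] with m h1 h2 h3 h4 h5 h6 h7 h8 h9 h10
  have hn2 : (2 : ℝ) ≤ N m := by exact_mod_cast h10
  have hn : (0 : ℝ) < N m := by linarith
  have hα00 := (hα01 m).1
  have hpn0 : 0 < p m * N m := by positivity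
  rw [Real.norm_of_nonneg hα00, Real.norm_of_nonneg (by positivity), mul_one_div,
    le_div_iff₀ hpn0] at h2
  have hαpos : 0 < α m := by
    refine lt_of_le_of_ne hα00 fun h0 => ?_
    rw [← h0, norm_zero, mul_zero, Real.norm_of_nonneg (by positivity)] at h3
    have : 0 < 1 / (p m * N m) := by positivity
    linarith
  have hβ1 : 0 ≤ 1 - β m := by linarith [(hβ01 m).2]
  rw [norm_one, Real.norm_of_nonneg hβ1] at h4
  obtain ⟨w1, w2, w3, w4⟩ := h1
  have hC₁ : 0 < C₁ m := lt_of_lt_of_le (by positivity) w1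
  refine
    { n_pos := by omega
      p_pos := h5
      p_le := h6
      alpha_pos := hαpos
      alpha_le := h7
      K_alpha_le := by
        rw [le_div_iff₀ (by linarith)] at h8
        linarith
      two_le_K := hK
      nap_le := by
        refine le_trans ?_ (le_max_right _ _)
        have := mul_le_mul_of_nonneg_left h2 (show 0 ≤ K by linarith)
        linarith
      eta_pos := hη0
      eta_le := by
        have e1 : η ≤ 1 / (2 * q) := min_le_left _ _
        rw [le_div_iff₀ (by positivity)] at e1
        have e2 : q * (2 * η) ≤ q * (1 - β m) := by linarith
        exact le_of_mul_le_mul_left e2 hq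
      beta_nonneg := (hβ01 m).1
      lo_pos := ha
      lo_le := by
        rw [div_le_iff₀ h5] at w1
        linarith
      le_hi := by
        rw [le_div_iff₀ h5] at w4
        exact le_trans (by linarith) (le_max_left _ _)
      C₂_le := by
        refine w4.trans ?_
        rw [div_le_iff₀ h5]
        nlinarith
      eps_pos := hε
      eps_lt := by
        by_contra hcon
        push Not at hcon
        have := hhom.dbar_nonneg m
        nlinarith
      C₁_le := w2
      le_C₂ := w3
      abs_y_le := hM m }

/-- The expected number of vertices in either treatment arm tends to infinity. -/
theorem tendsto_one_div_mul_armProb {N : ℕ → ℕ} {p : ℕ → ℝ}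
    (hN : Tendsto N atTop atTop) (hp : Tendsto p atTop (𝓝 0))
    (hpn : Tendsto (fun m => p m * N m) atTop atTop) (τ : Bool) :
    Tendsto (fun m => 1 / ((N m : ℝ) * armProb (p m) τ)) atTop (𝓝 0) := by
  simp_rw [one_div]
  refine tendsto_inv_atTop_zero.comp ?_
  cases τ with
  | true => simpa [armProb, mul_comm] using hpn
  | false =>
    have h1 : Tendsto (fun m => (1 - p m)) atTop (𝓝 (1 - 0)) := tendsto_const_nhds.sub hp
    have h2 : Tendsto (fun m => (N m : ℝ)) atTop atTop := tendsto_natCast_atTop_atTop.comp hN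
    simpa [armProb] using h2.atTop_mul_pos (by norm_num : (0 : ℝ) < 1 - 0) h1

/-- The variance bound for the oracle estimator vanishes asymptotically. -/
theorem tendsto_oracle_bound {N : ℕ → ℕ} {G : ∀ m, SimpleGraph (Fin (N m))} {p α : ℕ → ℝ}
    (hN : Tendsto N atTop atTop) (hp : Tendsto p atTop (𝓝 0))
    (hpn : Tendsto (fun m => p m * N m) atTop atTop)
    (hC : (fun m => (pairsWithoutCommonNeighbor (G m) : ℝ)) ~[atTop] fun m => (N m : ℝ) ^ 2)
    (hα0 : Tendsto α atTop (𝓝 0)) (hi A : ℝ) (τ : Bool) :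
    Tendsto (fun m => 4 * (4 * A * √(1 / (N m * armProb (p m) τ) + (2 * (hi / (p m * N m)
            + (1 - pairsWithoutCommonNeighbor (G m) / (N m : ℝ) ^ 2))
          + α m * (3 + 3 * hi))))) atTop (𝓝 0) := by
  have h1 := tendsto_one_div_mul_armProb hN hp hpn τ
  have h2 : Tendsto (fun m => hi / (p m * N m)) atTop (𝓝 0) := tendsto_const_nhds.div_atTop hpn
  have h3 : Tendsto (fun m => (pairsWithoutCommonNeighbor (G m) : ℝ) / (N m : ℝ) ^ 2)
      atTop (𝓝 1) := by
    refine (isEquivalent_iff_tendsto_one ?_).1 hC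
    filter_upwards [hN.eventually_gt_atTop 0] with m hm
    have : (0 : ℝ) < N m := by exact_mod_cast hm
    positivity
  have h4 := (h1.add (((h2.add (h3.const_sub 1)).const_mul 2).add
    (hα0.mul_const (3 + 3 * hi)))).sqrt
  have h5 := (h4.const_mul (4 * A)).const_mul 4
  simpa using h5

end NoisyInterference

open NoisyInterference

theorem theorem4 (N : ℕ → ℕ) (G : ∀ m, SimpleGraph (Fin (N m)))
    (p α β dbar : ℕ → ℝ)
    (y : ∀ m, Fin (N m) → NoisyInterference.Exposure → ℝ)
    (Ω : ℕ → Type*) [∀ m, MeasurableSpace (Ω m)]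
    (μ : ∀ m, Measure (Ω m)) [∀ m, IsProbabilityMeasure (μ m)]
    (Z : ∀ m, Ω m → Finset (Fin (N m)))
    (H : ∀ m, Ω m → SimpleGraph (Fin (N m)))
    (αhat βhat : ∀ m, Ω m → ℝ) (C₁ C₂ : ℕ → ℝ)
    -- Bernoulli assignment; constant error probabilities and independent noise
    (hexp : ∀ m, NoisyInterference.IsNoisyExperiment (μ m) (G m) (p m) (α m) (β m) (Z m) (H m))
    -- homogeneous network setting
    (hhom : NoisyInterference.IsHomogeneous N G dbar)
    -- large graphs
    (hN : Tendsto N atTop atTop)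
    -- treatment probability, mean degree, common neighbours, bounded potential outcomes
    (hp : p =o[atTop] fun _ => (1 : ℝ))
    (hpN : (fun m => 1 / (N m : ℝ)) =o[atTop] p)
    (hd : dbar =Θ[atTop] fun m => 1 / p m)
    (hC : (fun m => (NoisyInterference.pairsWithoutCommonNeighbor (G m) : ℝ))
      ~[atTop] fun m => (N m : ℝ) ^ 2)
    (hy : ∃ c : ℝ, ∀ m i k, |y m i k| ≤ c)
    -- error rates
    (hβ : (fun _ => (1 : ℝ)) =O[atTop] fun m => 1 - β m)
    (hα : α =Θ[atTop] fun m => 1 / (p m * (N m : ℝ)))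
    (hαp : α =o[atTop] p)
    -- consistent estimators of the error rates (relative to `α`, which tends to `0`)
    (hαm : ∀ m, AEMeasurable (αhat m) (μ m))
    (hβm : ∀ m, AEMeasurable (βhat m) (μ m))
    (hαc : NoisyInterference.ErrorTendstoZeroInProb μ (fun m ω => αhat m ω / α m) fun _ => 1)
    (hβc : NoisyInterference.ErrorTendstoZeroInProb μ βhat β)
    -- estimated degrees of order `1 / p`
    (hwin : NoisyInterference.IsDegreeWindow p dbar C₁ C₂) :
    ∀ k : NoisyInterference.Exposure,
      -- consistency
      NoisyInterference.ErrorTendstoZeroInProb μ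
        (fun m ω => NoisyInterference.mme (G m) (H m ω) (y m) (Z m ω) (p m)
          (αhat m ω) (βhat m ω) (C₁ m) (C₂ m) k)
        (fun m => NoisyInterference.ybar (y m) k) ∧
      -- asymptotic unbiasedness, when the estimates respect the ranges of the error rates
      ((∃ K : ℝ, ∃ η > 0, ∀ᶠ m in atTop, ∀ᵐ ω ∂(μ m),
          0 ≤ αhat m ω ∧ αhat m ω ≤ K * α m ∧ 0 ≤ βhat m ω ∧ βhat m ω ≤ 1 - η) →
        (∀ᶠ m in atTop, Integrable (fun ω =>
          NoisyInterference.mme (G m) (H m ω) (y m) (Z m ω) (p m)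
            (αhat m ω) (βhat m ω) (C₁ m) (C₂ m) k) (μ m)) ∧
        Tendsto (fun m =>
          (∫ ω, NoisyInterference.mme (G m) (H m ω) (y m) (Z m ω) (p m)
            (αhat m ω) (βhat m ω) (C₁ m) (C₂ m) k ∂(μ m))
            - NoisyInterference.ybar (y m) k) atTop (𝓝 0)) := by
  classical
  intro k
  have hp01 := fun m => (hexp m).p_mem
  have hα01 := fun m => (hexp m).alpha_mem
  have hβ01 := fun m => (hexp m).beta_mem
  have hp' : Tendsto p atTop (𝓝 0) := (isLittleO_one_iff ℝ).1 hp
  have hα0 : Tendsto α atTop (𝓝 0) := hαp.isBigO.trans_tendsto hp'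
  have hpn := tendsto_mul_atTop_of_isLittleO (fun m => (hp01 m).1) hN hpN
  have hppos := eventually_pos_of_isLittleO (fun m => (hp01 m).1) hN hpN
  have hdbar : Tendsto dbar atTop atTop := by
    obtain ⟨a, ha, b, hb, ε, hε, hw⟩ := hwin
    -- the lower end of the degree window has the order of `1 / p`
    have h1 : Tendsto (fun m => a / p m) atTop atTop := by
      have h2 : Tendsto p atTop (𝓝[>] 0) := tendsto_nhdsWithin_iff.2 ⟨hp', hppos⟩
      simpa [div_eq_mul_inv] using (tendsto_inv_nhdsGT_zero.comp h2).const_mul_atTop ha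
    refine tendsto_atTop_mono' _ ?_ h1
    filter_upwards [hw] with m hm
    have := hhom.dbar_nonneg m
    nlinarith [hm.1, hm.2.1]
  -- the mean fraction of the vertices that are not typical vanishes
  have htyp : ∀ lo hi η ε K M : ℝ, (∀ᶠ m in atTop,
      Regime (G m) (y m) (p m) (α m) (β m) (dbar m) (C₁ m) (C₂ m) lo hi η ε K M) →
      ∀ δ > 0, Tendsto (fun m => (1 / (N m : ℝ)) * ∑ i, (μ m).real
        {ω | ¬ IsTypical (G m) (p m) (α m) (β m) (dbar m) ε δ (H m ω) i}) atTop (𝓝 0) := by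
    intro lo hi η ε K M hr δ hδ
    obtain ⟨m₀, hm₀⟩ := hr.exists
    have h1 := hhom.tendsto_card_far hN hdbar (ε := ε / 2) (by linarith [hm₀.eps_pos])
      (by linarith [hm₀.eps_lt])
    have h2 : Tendsto (fun m => 2 * hi * p m / δ ^ 2) atTop (𝓝 0) := by
      simpa using (hp'.const_mul (2 * hi)).div_const (δ ^ 2)
    have h3 := h1.add h2
    rw [add_zero] at h3
    refine tendsto_of_tendsto_of_tendsto_of_le_of_le' tendsto_const_nhds h3 ?_ ?_
    · exact Eventually.of_forall fun m => mul_nonneg (by positivity)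
        (Finset.sum_nonneg fun i _ => measureReal_nonneg)
    · filter_upwards [hr] with m hm
      exact (hexp m).sum_atypical_le hm hδ
  have hcons : ErrorTendstoZeroInProb μ
        (fun m ω => mme (G m) (H m ω) (y m) (Z m ω) (p m)
          (αhat m ω) (βhat m ω) (C₁ m) (C₂ m) k)
        (fun m => ybar (y m) k) := by
    intro ξ hξ
    obtain ⟨lo, hi, η, ε, M, -, hr⟩ := exists_regime hp01 hα01 hβ01 hhom hN hp hpN hy hβ hα hα0 hwin
      (le_refl (2 : ℝ)) one_pos
    obtain ⟨m₀, hm₀⟩ := hr.exists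
    have hlo := hm₀.lo_pos
    have hη := hm₀.eta_pos
    have hε := hm₀.eps_pos
    have hhi := hm₀.hi_pos
    have hM := hm₀.M_nonneg
    have hκ := hm₀.detBound_pos
    have hL : 0 ≤ lipBound lo hi η := by unfold lipBound; positivity
    rw [ENNReal.tendsto_nhds_zero]
    intro θ hθ
    obtain ⟨t, ht0, htθ⟩ : ∃ t : ℝ, 0 < t ∧ ENNReal.ofReal t ≤ θ := by
      rcases eq_or_ne θ ⊤ with rfl | hne
      · exact ⟨1, one_pos, le_top⟩
      · exact ⟨θ.toReal, ENNReal.toReal_pos hθ.ne' hne, ENNReal.ofReal_toReal hne |>.le⟩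
    -- the precision of the estimated error rates, as required by `measure_mme_far_le`
    obtain ⟨δ, hδ0, hδ1, hδη, hδε, hδt⟩ : ∃ δ : ℝ, 0 < δ ∧ δ ≤ 1 ∧ δ ≤ η / 4 ∧
        2 / η * (1 + 3 * hi) * δ < ε / 2 * lo ∧ lipBound lo hi η * δ * M ≤ t / 6 * ξ := by
      have hc1 : Tendsto (fun δ : ℝ => 2 / η * (1 + 3 * hi) * δ) (𝓝[>] 0) (𝓝 0) := by
        have : Tendsto (fun δ : ℝ => 2 / η * (1 + 3 * hi) * δ) (𝓝 0)
            (𝓝 (2 / η * (1 + 3 * hi) * 0)) := (continuous_const.mul continuous_id).tendsto 0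
        rw [mul_zero] at this
        exact this.mono_left nhdsWithin_le_nhds
      have hc2 : Tendsto (fun δ : ℝ => lipBound lo hi η * δ * M) (𝓝[>] 0) (𝓝 0) := by
        have : Tendsto (fun δ : ℝ => lipBound lo hi η * δ * M) (𝓝 0)
            (𝓝 (lipBound lo hi η * 0 * M)) :=
          ((continuous_const.mul continuous_id).mul continuous_const).tendsto 0
        rw [mul_zero, zero_mul] at this
        exact this.mono_left nhdsWithin_le_nhds
      have hc3 : Tendsto (fun δ : ℝ => δ) (𝓝[>] 0) (𝓝 0) := nhdsWithin_le_nhds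
      have hev := (self_mem_nhdsWithin (a := (0 : ℝ)) (s := Set.Ioi 0))
      obtain ⟨δ, h1, h2, h3, h4, h5⟩ := (Filter.Eventually.and hev
        ((hc3.eventually_le_const one_pos).and
        ((hc3.eventually_le_const (show (0 : ℝ) < η / 4 by positivity)).and
        ((hc1.eventually_lt_const (show (0 : ℝ) < ε / 2 * lo by positivity)).and
        (hc2.eventually_le_const (show (0 : ℝ) < t / 6 * ξ by positivity)))))).exists
      exact ⟨δ, h1, h2, h3, h4, h5⟩
    have ht3 : (0 : ENNReal) < ENNReal.ofReal (t / 3) := ENNReal.ofReal_pos.2 (by positivity)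
    have hB := tendsto_oracle_bound hN hp' hpn hC hα0 hi
      (2 * M / detBound lo hi η) k.treated
    have hA := (htyp lo hi η ε 2 M hr δ hδ0).const_mul (2 * (2 * M / detBound lo hi η) + M + M)
    have hBA := hB.add hA
    rw [mul_zero, add_zero] at hBA
    filter_upwards [hr, (ENNReal.tendsto_nhds_zero.1 (hαc δ hδ0)) _ ht3,
      (ENNReal.tendsto_nhds_zero.1 (hβc δ hδ0)) _ ht3,
      hBA.eventually_le_const (show (0 : ℝ) < t / 6 * ξ by positivity)] with m hm h1 h2 h3
    have h4 := (hexp m).measure_mme_far_le hm k (a := αhat m) (b := βhat m) hξ hδ0 hδ1 hδη hδε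
    refine le_trans ?_ htθ
    refine h4.trans ((add_le_add (add_le_add h1 h2) (ENNReal.ofReal_le_ofReal ?_)).trans
      (le_of_eq (b := ENNReal.ofReal (t / 3) + ENNReal.ofReal (t / 3) + ENNReal.ofReal (t / 3)) rfl
        |>.trans ?_))
    · have h5 := (hexp m).integral_abs_oracleError_le hm k
      rw [div_le_iff₀ hξ]
      linarith
    · rw [← ENNReal.ofReal_add (by positivity) (by positivity),
        ← ENNReal.ofReal_add (by positivity) (by positivity)]
      exact ENNReal.ofReal_le_ofReal (by linarith)
  refine ⟨hcons, ?_⟩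
  rintro ⟨K, η₀, hη₀, hrange⟩
  -- `K` is enlarged to at least `2`, as the regime requires
  obtain ⟨lo, hi, η, ε, M, hηle, hr⟩ := exists_regime hp01 hα01 hβ01 hhom hN hp hpN hy hβ hα hα0
    hwin (le_max_right K 2) hη₀
  obtain ⟨m₀, hm₀⟩ := hr.exists
  have hlo := hm₀.lo_pos
  have hη := hm₀.eta_pos
  have hM := hm₀.M_nonneg
  have hB := domBound_nonneg hm₀
  have hrange' : ∀ᶠ m in atTop, ∀ᵐ ω ∂(μ m), 0 ≤ αhat m ω ∧ αhat m ω ≤ max K 2 * α m ∧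
      0 ≤ βhat m ω ∧ βhat m ω ≤ 1 - η := by
    filter_upwards [hrange, hr] with m h1 h2
    filter_upwards [h1] with ω h3
    exact ⟨h3.1, h3.2.1.trans (mul_le_mul_of_nonneg_right (le_max_left _ _) h2.alpha_pos.le),
      h3.2.2.1, h3.2.2.2.trans (by linarith)⟩
  obtain ⟨δ, hδ0, hδη, hδ1⟩ : ∃ δ : ℝ, 0 < δ ∧ δ ≤ η * lo / 2 ∧ δ ≤ 1 :=
    ⟨min (η * lo / 2) 1, lt_min (by positivity) one_pos, min_le_left _ _, min_le_right _ _⟩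
  have hmain : ∀ ξ : ℝ, 0 < ξ → ∀ᶠ m in atTop, _ := fun ξ hξ => by
    filter_upwards [hr, hrange'] with m h1 h2
    exact (hexp m).integral_abs_mme_sub_le (δ := δ) h1 k (hαm m) (hβm m) h2 hξ hδη hδ1
  refine ⟨(hmain 1 one_pos).mono fun m h => h.1, ?_⟩
  rw [Metric.tendsto_nhds]
  intro ξ hξ
  have hprob : Tendsto (fun m => (μ m).real {ω | ξ / 4 ≤
      |mme (G m) (H m ω) (y m) (Z m ω) (p m) (αhat m ω) (βhat m ω) (C₁ m) (C₂ m) k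
        - ybar (y m) k|}) atTop (𝓝 0) := by
    have := (ENNReal.tendsto_toReal ENNReal.zero_ne_top).comp (hcons (ξ / 4) (by positivity))
    rw [ENNReal.toReal_zero] at this
    exact this
  have hlim := (hprob.const_mul (2 * domBound lo hi η M + M)).add
    (((tendsto_one_div_mul_armProb hN hp' hpn k.treated).const_mul
      (domBound lo hi η M)).add ((htyp lo hi η ε _ M hr δ hδ0).const_mul M))
  simp only [mul_zero, add_zero] at hlim
  filter_upwards [hmain (ξ / 4) (by positivity),
    hlim.eventually_le_const (show (0 : ℝ) < ξ / 4 by positivity)] with m h1 h2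
  obtain ⟨hint, h3⟩ := h1
  rw [Real.dist_eq, sub_zero]
  have e : (∫ ω, mme (G m) (H m ω) (y m) (Z m ω) (p m) (αhat m ω) (βhat m ω) (C₁ m) (C₂ m) k ∂(μ m))
      - ybar (y m) k = ∫ ω, (mme (G m) (H m ω) (y m) (Z m ω) (p m) (αhat m ω) (βhat m ω)
        (C₁ m) (C₂ m) k - ybar (y m) k) ∂(μ m) := by
    rw [integral_sub hint (integrable_const _)]
    simp
  rw [e]
  refine lt_of_le_of_lt (abs_integral_le_integral_abs.trans h3) ?_
  linarith
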